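/- A Gauss diagram $G$ with $m$ circles consists of $m$ oriented circles and finitely many signed arrows that join pairwise distinct points of the circles, up to orientation-preserving diffeomorphisms of the circles. It is based if a base point, different from the ends of the arrows, is marked on one of the circles. The Gauss diagram of an oriented link diagram has one circle for every component and one arrow for every (classical) crossing, pointing from the preimage on the overpass to the preimage on the underpass and carrying the writhe of the crossing as its sign. $G$ is the Gauss diagram of a classical $m$-component link if it arises from a link diagram in the plane without virtual crossings; every Gauss diagram arises from a virtual link diagram. An arrow diagram is a Gauss diagram without signs. For a based arrow diagram $A$ let $\Sigma(A)$ be the oriented surface made of one disk for every circle and one ribbon for every arrow. Suppose that $\Sigma(A)$ has exactly one boundary component. $A$ is called ascending (descending) if the passage along $\partial\Sigma(A)$ that starts at the base point runs along every ribbon for the first time in the direction opposite to its core arrow, i.e. coming from its head (respectively in the direction of its core arrow, i.e. coming from its tail). Let $\mathcal A_{n,m}$ and $\mathcal D_{n,m}$ be the sets of all ascending and of all descending based arrow diagrams with $n$ arrows, $m$ circles and one boundary component, up to isomorphism. For a based Gauss diagram $G$ with $m$ circles put $\langle A,G\rangle=\sum_{\varphi}\operatorname{sign}(\varphi)$, where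 $\varphi:A\to G$ runs over all homomorphisms (up to isotopy), i.e. orientation-preserving homeomorphisms from the circles of $A$ to the circles of $G$ which map base point to base point and induce an injective map from the arrows of $A$ to the arrows of $G$, and where $\operatorname{sign}(\varphi)$ is the product of the signs of the arrows of $G$ in the image of $\varphi$. Let $$\nabla_A(G)=\sum_{n\ge0}\Big(\sum_{A\in\mathcal A_{n,m}}\langle A,G\rangle\Big)z^n,\qquad \nabla_D(G)=\sum_{n\ge0}\Big(\sum_{A\in\mathcal D_{n,m}}\langle A,G\rangle\Big)z^n .$$ Theorem. (1) Let $G$ be the Gauss diagram of a classical $m$-component link. The polynomials $\nabla_A$ and $\nabla_D$ of $G$ with a base point do not depend on the position of the base point: any two positions, on the same circle or on different circles, give the same $\nabla_A$ and the same $\nabla_D$. (2) This fails for virtual links: there is a Gauss diagram, with one circle and two arrows, and there are two positions of the base point on it for which the polynomials $\nabla_A$ differ and the polynomials $\nabla_D$ differ. -/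

import Mathlib

noncomputable section

namespace GaussLink

open Polynomial

/-! ### Arrow diagrams -/

/-- The marked points of a based diagram with set of arrows `α`: the base point `none`, the tail
`some (a, false)` and the head `some (a, true)` of every arrow `a`. -/
abbrev Pt (α : Type*) : Type _ := Option (α × Bool)

/-- The other end of the same arrow; the base point is left alone. -/
def Pt.opp {α : Type*} : Pt α → Pt α := Option.map (fun e => (e.1, !e.2))

theorem Pt.opp_involutive {α : Type*} : Function.Involutive (Pt.opp (α := α)) := by
  rintro (_ | ⟨a, b⟩) <;> simp [Pt.opp]

/-- The map of marked points induced by a map of arrows. -/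
def Pt.map {α β : Type*} (f : α → β) : Pt α → Pt β := Option.map (Prod.map f id)

/-- A based arrow diagram with `m` oriented circles and set of arrows `α`, up to
orientation-preserving diffeomorphisms of the circles.  Only the circle of every marked point and
the cyclic order of the marked points on every circle matter; the cyclic order is recorded by the
map sending a marked point to the one that follows it on its circle.  A circle
may carry no marked point. -/
structure BasedArrowDiagram (m : ℕ) (α : Type*) where
  /-- the circle on which a marked point lies -/
  circle : Pt α → Fin m
  /-- the next marked point on the same circle -/
  next : Equiv.Perm (Pt α)
  sameCycle_iff : ∀ p q, next.SameCycle p q ↔ circle p = circle q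

namespace BasedArrowDiagram

variable {m : ℕ} {α β γ : Type*}

@[ext]
theorem ext' {A B : BasedArrowDiagram m α} (h₁ : A.circle = B.circle) (h₂ : A.next = B.next) :
    A = B := by
  cases A; cases B; cases h₁; cases h₂; rfl

instance [Finite α] : Finite (BasedArrowDiagram m α) :=
  Finite.of_injective
    (fun A : BasedArrowDiagram m α => ((A.circle, A.next) : (Pt α → Fin m) × Equiv.Perm (Pt α)))
    (fun _ _ h => ext' (congrArg Prod.fst h) (congrArg Prod.snd h))

/-- The passage along the boundary of the surface `Σ(A)`, which consists of one oriented disk for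
every circle and one ribbon for every arrow: having come along an arc to the marked point `p`, turn
along the ribbon to the other end of its arrow (at the base point, just go on), and follow the
circle to the next marked point. -/
def trace (A : BasedArrowDiagram m α) : Equiv.Perm (Pt α) :=
  Pt.opp_involutive.toPerm.trans A.next

/-- The number of boundary components of `Σ(A)`: the closed paths of the passage, and one for
each circle without marked points. -/
def boundaryCount (A : BasedArrowDiagram m α) : ℕ :=
  Nat.card (Quotient (Equiv.Perm.SameCycle.setoid A.trace)) +
    Nat.card {i : Fin m // ∀ p, A.circle p ≠ i}

/-- `A` has one boundary component (and hence is connected), and the passage along the boundary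
that starts at the base point comes to every arrow for the first time at its head. -/
def IsAscending (A : BasedArrowDiagram m α) : Prop :=
  A.boundaryCount = 1 ∧ ∀ a : α, ∃ k : ℕ,
    (A.trace ^ k) none = some (a, true) ∧ ∀ j < k, (A.trace ^ j) none ≠ some (a, false)

/-- `A` has one boundary component (and hence is connected), and the passage along the boundary
that starts at the base point comes to every arrow for the first time at its tail. -/
def IsDescending (A : BasedArrowDiagram m α) : Prop :=
  A.boundaryCount = 1 ∧ ∀ a : α, ∃ k : ℕ,
    (A.trace ^ k) none = some (a, false) ∧ ∀ j < k, (A.trace ^ j) none ≠ some (a, true)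

/-- The same diagram up to the names of the circles and arrows. -/
def Iso (A : BasedArrowDiagram m α) (B : BasedArrowDiagram m β) : Prop :=
  ∃ (c : Equiv.Perm (Fin m)) (f : α ≃ β),
    (∀ p, B.circle (Pt.map f p) = c (A.circle p)) ∧ ∀ p, B.next (Pt.map f p) = Pt.map f (A.next p)

theorem Pt_map_comp (g : β → γ) (f : α → β) (p : Pt α) :
    Pt.map g (Pt.map f p) = Pt.map (g ∘ f) p := by
  cases p <;> rfl

theorem Pt_map_id (p : Pt α) : Pt.map id p = p := by
  cases p <;> simp [Pt.map]

theorem Pt_map_injective {f : α → β} (hf : Function.Injective f) :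
    Function.Injective (Pt.map f) :=
  Option.map_injective (hf.prodMap Function.injective_id)

theorem Iso.refl (A : BasedArrowDiagram m α) : A.Iso A :=
  ⟨1, Equiv.refl α, fun p => by simp [Pt_map_id], fun p => by simp [Pt_map_id]⟩

theorem Iso.symm {A : BasedArrowDiagram m α} {B : BasedArrowDiagram m β} (h : A.Iso B) :
    B.Iso A := by
  obtain ⟨c, f, h₁, h₂⟩ := h
  have hf : ∀ p, Pt.map f (Pt.map f.symm p) = p := fun p => by
    rw [Pt_map_comp, Equiv.self_comp_symm, Pt_map_id]
  refine ⟨c.symm, f.symm, fun p => ?_, fun p => Pt_map_injective f.injective ?_⟩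
  · rw [Equiv.eq_symm_apply, ← h₁, hf]
  · rw [← h₂, hf, hf]

theorem Iso.trans {A : BasedArrowDiagram m α} {B : BasedArrowDiagram m β}
    {C : BasedArrowDiagram m γ} (h : A.Iso B) (h' : B.Iso C) : A.Iso C := by
  obtain ⟨c, f, h₁, h₂⟩ := h
  obtain ⟨c', f', h₁', h₂'⟩ := h'
  refine ⟨c' * c, f.trans f', fun p => ?_, fun p => ?_⟩
  · rw [Equiv.coe_trans, ← Pt_map_comp, h₁', h₁]; rfl
  · rw [Equiv.coe_trans, ← Pt_map_comp, h₂', h₂, Pt_map_comp]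

/-- Isomorphism of based arrow diagrams with `m` circles and `n` arrows. -/
instance isoSetoid (m n : ℕ) : Setoid (BasedArrowDiagram m (Fin n)) where
  r := Iso
  iseqv := ⟨Iso.refl, Iso.symm, Iso.trans⟩

/-- A homomorphism `A → G`, up to isotopy: a bijection between the circles and an injective map of
arrows, such that the induced map of marked points (which sends base point to base point) goes
to the right circles and respects the cyclic orders: the next marked point
on a circle of `A` goes to the next one of `G` that is in the image. -/
structure Hom (A : BasedArrowDiagram m β) (G : BasedArrowDiagram m α) where
  /-- the map of circles -/
  onCircle : Equiv.Perm (Fin m)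
  /-- the map of arrows -/
  onArrow : β ↪ α
  circle_map : ∀ p, G.circle (Pt.map onArrow p) = onCircle (A.circle p)
  next_map : ∀ p, ∃ k : ℕ, (G.next ^ (k + 1)) (Pt.map onArrow p) = Pt.map onArrow (A.next p) ∧
    ∀ j < k, (G.next ^ (j + 1)) (Pt.map onArrow p) ∉ Set.range (Pt.map onArrow)

theorem Hom.ext' {A : BasedArrowDiagram m β} {G : BasedArrowDiagram m α} {φ ψ : Hom A G}
    (h₁ : φ.onCircle = ψ.onCircle) (h₂ : φ.onArrow = ψ.onArrow) : φ = ψ := by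
  cases φ; cases ψ; cases h₁; cases h₂; rfl

instance [Finite α] [Finite β] (A : BasedArrowDiagram m β) (G : BasedArrowDiagram m α) :
    Finite (Hom A G) :=
  Finite.of_injective
    (fun φ : Hom A G => ((φ.onCircle, φ.onArrow) : Equiv.Perm (Fin m) × (β ↪ α)))
    (fun _ _ h => Hom.ext' (congrArg Prod.fst h) (congrArg Prod.snd h))

/-- The state of a homomorphism: the set of arrows in its image. -/
def Hom.state [Fintype β] {A : BasedArrowDiagram m β} {G : BasedArrowDiagram m α}
    (φ : Hom A G) : Finset α :=
  Finset.univ.map φ.onArrow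

end BasedArrowDiagram

/-! ### Gauss diagrams -/

/-- A Gauss diagram (without base point) with `m` oriented circles and set of arrows `α`, up to
orientation-preserving diffeomorphisms of the circles.  Here `(a, false)` is the
tail and `(a, true)` the head of the arrow `a`.  Every such diagram is the Gauss diagram of a
virtual link diagram with `m` components. -/
structure GaussDiagram (m : ℕ) (α : Type*) where
  /-- the circle on which an end of an arrow lies -/
  circle : α × Bool → Fin m
  /-- the next end of an arrow on the same circle -/
  next : Equiv.Perm (α × Bool)
  sameCycle_iff : ∀ e e', next.SameCycle e e' ↔ circle e = circle e'
  /-- the signs of the arrows -/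
  sign : α → ℤˣ

/-- A Gauss diagram with a base point, different from the ends of the arrows. -/
structure BasedGaussDiagram (m : ℕ) (α : Type*) extends BasedArrowDiagram m α where
  /-- the signs of the arrows -/
  sign : α → ℤˣ

namespace BasedGaussDiagram

variable {m : ℕ} {α : Type*}

/-- `B` is the Gauss diagram `G` with a base point put on one of its circles.  The permutation
`Equiv.removeNone B.next` of the ends of the arrows skips the base point. -/
def IsBasingOf (B : BasedGaussDiagram m α) (G : GaussDiagram m α) : Prop :=
  (∀ e, B.circle (some e) = G.circle e) ∧ Equiv.removeNone B.next = G.next ∧ B.sign = G.sign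

/-- The pairing `⟨A, G⟩ = ∑ sign φ` over all homomorphisms `φ : A → G`, where `sign φ` is the
product of the signs of the arrows in the state of `φ`. -/
def pairing {n : ℕ} (A : BasedArrowDiagram m (Fin n)) (G : BasedGaussDiagram m α) : ℤ :=
  ∑ᶠ φ : BasedArrowDiagram.Hom A G.toBasedArrowDiagram, ∏ a ∈ φ.state, (G.sign a : ℤ)

theorem pairing_congr {n : ℕ} (A B : BasedArrowDiagram m (Fin n)) (G : BasedGaussDiagram m α)
    (h : A ≈ B) : pairing A G = pairing B G := by
  obtain ⟨c, f, h₁, h₂⟩ := h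
  have hf : ∀ p, Pt.map f (Pt.map f.symm p) = p := fun p => by
    rw [BasedArrowDiagram.Pt_map_comp, Equiv.self_comp_symm, BasedArrowDiagram.Pt_map_id]
  have hf' : ∀ p, Pt.map f.symm (Pt.map f p) = p := fun p => by
    rw [BasedArrowDiagram.Pt_map_comp, Equiv.symm_comp_self, BasedArrowDiagram.Pt_map_id]
  have key : ∀ (g : Fin n ↪ α) p, Pt.map (f.toEmbedding.trans g) p = Pt.map g (Pt.map f p) :=
    fun g p => (BasedArrowDiagram.Pt_map_comp g f p).symm
  have key' : ∀ (g : Fin n ↪ α) p,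
      Pt.map (f.symm.toEmbedding.trans g) p = Pt.map g (Pt.map f.symm p) :=
    fun g p => (BasedArrowDiagram.Pt_map_comp g f.symm p).symm
  have hr : ∀ g : Fin n ↪ α,
      Set.range (Pt.map (f.toEmbedding.trans g)) = Set.range (Pt.map g) := fun g => by
    ext x
    constructor
    · rintro ⟨p, rfl⟩; exact ⟨_, (key g p).symm⟩
    · rintro ⟨p, rfl⟩; exact ⟨Pt.map f.symm p, by rw [key, hf]⟩
  have hr' : ∀ g : Fin n ↪ α,
      Set.range (Pt.map (f.symm.toEmbedding.trans g)) = Set.range (Pt.map g) := fun g => by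
    ext x
    constructor
    · rintro ⟨p, rfl⟩; exact ⟨_, (key' g p).symm⟩
    · rintro ⟨p, rfl⟩; exact ⟨Pt.map f p, by rw [key', hf']⟩
  let e : BasedArrowDiagram.Hom B G.toBasedArrowDiagram ≃
      BasedArrowDiagram.Hom A G.toBasedArrowDiagram :=
    { toFun := fun φ =>
        { onCircle := φ.onCircle * c
          onArrow := f.toEmbedding.trans φ.onArrow
          circle_map := fun p => by rw [key, φ.circle_map, h₁]; rfl
          next_map := fun p => by
            rw [hr, key, key, ← h₂]; exact φ.next_map _ }
      invFun := fun φ =>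
        { onCircle := φ.onCircle * c⁻¹
          onArrow := f.symm.toEmbedding.trans φ.onArrow
          circle_map := fun p => by
            rw [key', φ.circle_map, Equiv.Perm.mul_apply]
            congr 1
            rw [Equiv.Perm.eq_inv_iff_eq, ← h₁, hf]
          next_map := fun p => by
            have : Pt.map f.symm (B.next p) = A.next (Pt.map f.symm p) := by
              rw [← hf' (A.next _), ← h₂, hf]
            rw [hr', key', key', this]; exact φ.next_map _ }
      left_inv := fun φ => BasedArrowDiagram.Hom.ext' (by simp) (by ext; simp)
      right_inv := fun φ => BasedArrowDiagram.Hom.ext' (by simp) (by ext; simp) }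
  refine (finsum_eq_of_bijective e e.bijective fun φ => ?_).symm
  simp only [BasedArrowDiagram.Hom.state, Finset.prod_map]
  exact (Equiv.prod_comp f fun i => (G.sign (φ.onArrow i) : ℤ)).symm

/-- The pairing with an isomorphism class of arrow diagrams. -/
def classPairing {n : ℕ} (q : Quotient (BasedArrowDiagram.isoSetoid m n))
    (G : BasedGaussDiagram m α) : ℤ :=
  Quotient.lift (fun A => pairing A G) (fun A B h => pairing_congr A B G h) q

/-- The set of all ascending arrow diagrams with `n` arrows, `m` circles and one boundary
component, up to isomorphism. -/
def ascendingDiagrams (n m : ℕ) : Set (Quotient (BasedArrowDiagram.isoSetoid m n)) :=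
  {q | ∃ A : BasedArrowDiagram m (Fin n), ⟦A⟧ = q ∧ A.IsAscending}

/-- The set of all descending arrow diagrams with `n` arrows, `m` circles and one boundary
component, up to isomorphism. -/
def descendingDiagrams (n m : ℕ) : Set (Quotient (BasedArrowDiagram.isoSetoid m n)) :=
  {q | ∃ A : BasedArrowDiagram m (Fin n), ⟦A⟧ = q ∧ A.IsDescending}

/-- `A_{n,m}(G)`, the sum of `⟨A, G⟩` over all ascending diagrams `A` with `n` arrows. -/
def ascendingCount (n : ℕ) (G : BasedGaussDiagram m α) : ℤ :=
  ∑ᶠ q ∈ ascendingDiagrams n m, classPairing q G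

/-- `D_{n,m}(G)`, the sum of `⟨A, G⟩` over all descending diagrams `A` with `n` arrows. -/
def descendingCount (n : ℕ) (G : BasedGaussDiagram m α) : ℤ :=
  ∑ᶠ q ∈ descendingDiagrams n m, classPairing q G

theorem classPairing_eq_zero [Fintype α] {n : ℕ} (hn : Fintype.card α < n)
    (q : Quotient (BasedArrowDiagram.isoSetoid m n)) (G : BasedGaussDiagram m α) :
    classPairing q G = 0 := by
  induction q using Quotient.inductionOn with
  | _ A =>
    have : IsEmpty (BasedArrowDiagram.Hom A G.toBasedArrowDiagram) :=
      ⟨fun φ => by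
        have := Fintype.card_le_of_embedding φ.onArrow
        rw [Fintype.card_fin] at this
        omega⟩
    exact finsum_of_isEmpty _

/-- The polynomial `∇_A(G) = ∑ₙ A_{n,m}(G) zⁿ`; the terms with more arrows than `G` has vanish. -/
def nablaA [Fintype α] (G : BasedGaussDiagram m α) : ℤ[X] :=
  ∑ n ∈ Finset.range (Fintype.card α + 1), C (ascendingCount n G) * X ^ n

/-- The polynomial `∇_D(G) = ∑ₙ D_{n,m}(G) zⁿ`; the terms with more arrows than `G` has vanish. -/
def nablaD [Fintype α] (G : BasedGaussDiagram m α) : ℤ[X] :=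
  ∑ n ∈ Finset.range (Fintype.card α + 1), C (descendingCount n G) * X ^ n

theorem coeff_nablaA [Fintype α] (G : BasedGaussDiagram m α) (n : ℕ) :
    (nablaA G).coeff n = ascendingCount n G := by
  simp only [nablaA, finsetSum_coeff, coeff_C_mul_X_pow, Finset.sum_ite_eq, Finset.mem_range]
  split_ifs with h
  · rfl
  · simp [ascendingCount, classPairing_eq_zero (show Fintype.card α < n by omega)]

theorem coeff_nablaD [Fintype α] (G : BasedGaussDiagram m α) (n : ℕ) :
    (nablaD G).coeff n = descendingCount n G := by
  simp only [nablaD, finsetSum_coeff, coeff_C_mul_X_pow, Finset.sum_ite_eq, Finset.mem_range]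
  split_ifs with h
  · rfl
  · simp [descendingCount, classPairing_eq_zero (show Fintype.card α < n by omega)]

end BasedGaussDiagram

/-! ### Classical link diagrams -/

/-- `m` closed oriented polygons in the plane.  The `i`-th one has the vertices
`vertex i k`, `k ∈ ℤ`, which repeat with period `period i`. -/
structure PolygonalCurves (m : ℕ) where
  /-- the number of edges of the polygons -/
  period : Fin m → ℕ
  period_pos : ∀ i, 0 < period i
  /-- the vertices of the polygons -/
  vertex : Fin m → ℤ → ℝ × ℝ
  vertex_periodic : ∀ i k, vertex i (k + period i) = vertex i k

namespace PolygonalCurves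

variable {m : ℕ} (D : PolygonalCurves m)

/-- The oriented circles that parametrize the polygons; the `i`-th circle is
`[0, period i)`, whose ends are thought of as glued. -/
def Param : Type := {x : Fin m × ℝ // 0 ≤ x.2 ∧ x.2 < D.period x.1}

/-- The circle of a parameter. -/
def Param.circle {D : PolygonalCurves m} (x : D.Param) : Fin m := x.1.1

/-- The coordinate of a parameter on its circle. -/
def Param.time {D : PolygonalCurves m} (x : D.Param) : ℝ := x.1.2

/-- The parametrization: at integer times the vertices, and affine in between. -/
def point (x : D.Param) : ℝ × ℝ :=
  AffineMap.lineMap (D.vertex x.circle ⌊x.time⌋) (D.vertex x.circle (⌊x.time⌋ + 1))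
    (Int.fract x.time)

/-- The direction of the edge that starts at the last vertex up to the parameter `x`. -/
def direction (x : D.Param) : ℝ × ℝ :=
  D.vertex x.circle (⌊x.time⌋ + 1) - D.vertex x.circle ⌊x.time⌋

/-- The determinant of the directions of the curves at two parameters. -/
def det (x y : D.Param) : ℝ :=
  (D.direction x).1 * (D.direction y).2 - (D.direction x).2 * (D.direction y).1

/-- For two parameters on the same circle: the time in `(0, period]` that it takes to come from
`x` to `y` (the whole period if `x = y`) in the direction of the circle. -/
def timeTo (x y : D.Param) : ℝ :=
  if x.time < y.time then y.time - x.time else y.time - x.time + D.period x.circle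

end PolygonalCurves

/-- A diagram of a classical oriented `m`-component link: closed polygons in the plane in general
position, with the choice of the overpass at every crossing.  General position means that two
branches meet only in interior points of edges and transversally, and
that no three branches meet.  (In particular, the edges are not degenerate and consecutive
edges do not fold back.) -/
structure LinkDiagram (m : ℕ) extends PolygonalCurves m where
  transversal : ∀ x y : toPolygonalCurves.Param, x ≠ y →
    toPolygonalCurves.point x = toPolygonalCurves.point y →
    Int.fract x.time ≠ 0 ∧ Int.fract y.time ≠ 0 ∧ toPolygonalCurves.det x y ≠ 0
  no_triple : ∀ x y z : toPolygonalCurves.Param, x ≠ y → y ≠ z → x ≠ z →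
    ¬ (toPolygonalCurves.point x = toPolygonalCurves.point y ∧
      toPolygonalCurves.point y = toPolygonalCurves.point z)
  /-- the preimages of the crossings on the overpassing branches -/
  overpass : Set toPolygonalCurves.Param
  overpass_iff : ∀ x y : toPolygonalCurves.Param, x ≠ y →
    toPolygonalCurves.point x = toPolygonalCurves.point y → (x ∈ overpass ↔ y ∉ overpass)

namespace GaussDiagram

variable {m : ℕ} {α : Type*}

/-- `G` is the Gauss diagram of the link diagram `D`. -/
structure IsGaussDiagramOf (G : GaussDiagram m α) (D : LinkDiagram m) : Prop where
  exists_position : ∃ pos : α × Bool → D.Param,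
    -- the ends of the arrows lie on the circles of `D`, in the right cyclic order
    (∀ e, (pos e).circle = G.circle e) ∧
    (∀ e e', G.circle e' = G.circle e →
      D.timeTo (pos e) (pos (G.next e)) ≤ D.timeTo (pos e) (pos e')) ∧
    -- every arrow joins the preimages of a crossing
    (∀ a, pos (a, false) ≠ pos (a, true) ∧ D.point (pos (a, false)) = D.point (pos (a, true))) ∧
    -- the tails are on the overpasses
    (∀ a, pos (a, false) ∈ D.overpass) ∧
    -- every crossing has exactly one arrow
    (∀ x y : D.Param, x ≠ y → D.point x = D.point y → x ∈ D.overpass →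
      ∃! a, pos (a, false) = x ∧ pos (a, true) = y) ∧
    -- the sign of an arrow is the writhe of the crossing
    ∀ a, 0 < ((G.sign a : ℤ) : ℝ) * D.det (pos (a, false)) (pos (a, true))

/-- `G` is the Gauss diagram of some diagram of a classical link. -/
def IsClassical (G : GaussDiagram m α) : Prop :=
  ∃ D : LinkDiagram m, G.IsGaussDiagramOf D

end GaussDiagram

end GaussLink

end

set_option linter.unusedSectionVars false

/-! Both polynomials are state sums. Sorting homomorphisms by the set of arrows that they hit turns
the coefficient of `z ^ n` into a signed count of sets `T` of `n` arrows: the diagram smoothed at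
`T` has to be one closed curve which, from the base point on, meets every arrow of `T` first at its
head (or first at its tail). For every diagram, classical or not, this `stateSum` satisfies Conway's
skein relation (`stateSum_skein`). On a layered diagram, where no unsmoothed crossing is visited
first on the underpass, it is 1 or 0 according to whether the smoothed diagram is connected
(`stateSum_of_isLayered`). These two facts determine it, because changing and smoothing the badly
visited crossings leads to layered diagrams.

The Alexander determinant behaves in the same way. `alexanderMatrix` describes a walk that follows
the arcs and may jump from an underpass to the overpass; the walk is cut at the base point. Up to
powers of `τ` its determinant satisfies the same skein relation with `z = τ⁻¹ - τ`
(`det_alexanderMatrix_skein`), and on connected layered diagrams the matrix is triangular. Planarity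
is needed for the remaining points: the determinant vanishes on disconnected layered diagrams
(`PlanarAngles.det_eq_zero`), and all connected layered smoothings have the same total writhe
(`PlanarAngles.layeredWrithe_eq`). Hence the determinant is a sign times a power of `τ` times the
state sum (`det_alexanderMatrix_eq_stateSum`).

The determinant is also an entry of the adjugate of the matrix of the diagram without base point
(`det_alexanderMatrix_eq_adjugate`). That matrix has the constant vector in its right kernel and,
again by planarity, a vector of powers of `τ` in its left kernel. So two base points give state sums
that differ by a factor `±τ ^ r`, and the symmetry between `τ` and `τ⁻¹` leaves only equality
(`stateSum_eq_of_isBasingOf`).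

Planarity is used only through the winding data in `PlanarAngles`. For polygons they come from a
combinatorial angle `turn` with values in half turns: the directions from one segment to a disjoint
one stay in an open half plane, so the total turning is zero, and only common ends of arcs
contribute. The counterexample is the virtual trefoil, where moving the base point exchanges heads
and tails in the order of the visits. -/

namespace GaussLink

open Equiv

/-! ### First return permutations -/

/-- `τ` is the first return permutation of `σ` to the image of the injection `ι`. -/
def IsFirstReturn {X Y : Type*} (ι : X → Y) (σ : Perm Y) (τ : Perm X) : Prop :=
  ∀ x, ∃ k : ℕ, (σ ^ (k + 1)) (ι x) = ι (τ x) ∧ ∀ j < k, (σ ^ (j + 1)) (ι x) ∉ Set.range ι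

namespace IsFirstReturn

variable {X Y : Type*} {ι : X → Y} {σ : Perm Y} {τ : Perm X}

/-- Concatenating `j` returns gives the time `n`. Up to then `σ` meets the image of `ι` only at the
earlier points of the `τ`-orbit, so both orbits meet the image in the same order. -/
theorem exists_time (h : IsFirstReturn ι σ τ) (hι : Function.Injective ι) (x₀ : X) (j : ℕ) :
    ∃ n, j ≤ n ∧ (σ ^ n) (ι x₀) = ι ((τ ^ j) x₀) ∧
      ∀ t < n, ∀ y, (σ ^ t) (ι x₀) = ι y → ∃ i < j, y = (τ ^ i) x₀ := by
  induction j with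
  | zero => exact ⟨0, le_rfl, by simp, by simp⟩
  | succ j ih =>
    obtain ⟨n, hjn, hn, ht⟩ := ih
    obtain ⟨k, hk, hk'⟩ := h ((τ ^ j) x₀)
    refine ⟨k + 1 + n, by omega, ?_, fun t htn y hy => ?_⟩
    · rw [pow_add, Perm.mul_apply, hn, hk, pow_succ', Perm.mul_apply]
    · rcases lt_trichotomy t n with hlt | rfl | hgt
      · obtain ⟨i, hi, rfl⟩ := ht t hlt y hy
        exact ⟨i, by omega, rfl⟩
      · exact ⟨j, by omega, hι (hy.symm.trans hn)⟩
      · obtain ⟨d, rfl⟩ : ∃ d, t = (d + 1) + n := ⟨t - n - 1, by omega⟩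
        rw [pow_add, Perm.mul_apply, hn] at hy
        exact absurd ⟨y, hy.symm⟩ (hk' d (by omega))

theorem exists_index (h : IsFirstReturn ι σ τ) (hι : Function.Injective ι) (x₀ : X) (t : ℕ) (y : X)
    (hy : (σ ^ t) (ι x₀) = ι y) :
    ∃ j, (τ ^ j) x₀ = y ∧ ∀ i < j, ∃ t' < t, (σ ^ t') (ι x₀) = ι ((τ ^ i) x₀) := by
  classical
  -- After `t + 1` returns more than `t` steps have been made, so the visit at time `t` is among the
  -- recorded ones. The least index is taken below, so that earlier points of the `τ`-orbit are
  -- reached strictly before time `t`.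
  obtain ⟨n, hn, -, hn'⟩ := h.exists_time hι x₀ (t + 1)
  obtain ⟨i₀, -, hi₀⟩ := hn' t (by omega) y hy
  have hex : ∃ i, y = (τ ^ i) x₀ := ⟨i₀, hi₀⟩
  refine ⟨Nat.find hex, (Nat.find_spec hex).symm, fun i hi => ?_⟩
  obtain ⟨n', -, hn₁, hn₂⟩ := h.exists_time hι x₀ i
  refine ⟨n', ?_, hn₁⟩
  by_contra hle
  rcases (not_lt.mp hle).lt_or_eq with hlt | rfl
  · obtain ⟨i', hi', hy'⟩ := hn₂ t hlt y hy
    exact Nat.find_min hex (hi'.trans hi) hy'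
  · exact Nat.find_min hex hi (hι (hy.symm.trans hn₁))

/-- This lets ascending and descending diagrams be recognized inside the ambient Gauss diagram,
without passing to the subdiagram. -/
theorem visits_first_iff (h : IsFirstReturn ι σ τ) (hι : Function.Injective ι) (x₀ x y : X) :
    (∃ k : ℕ, (τ ^ k) x₀ = x ∧ ∀ j < k, (τ ^ j) x₀ ≠ y) ↔
      ∃ k : ℕ, (σ ^ k) (ι x₀) = ι x ∧ ∀ j < k, (σ ^ j) (ι x₀) ≠ ι y := by
  constructor
  · rintro ⟨k, rfl, hk⟩
    obtain ⟨n, -, hn, hn'⟩ := h.exists_time hι x₀ k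
    refine ⟨n, hn, fun t ht hy => ?_⟩
    obtain ⟨i, hi, rfl⟩ := hn' t ht y hy
    exact hk i hi rfl
  · rintro ⟨k, hk, hk'⟩
    obtain ⟨j, hj, hj'⟩ := h.exists_index hι x₀ k x hk
    refine ⟨j, hj, fun i hi hy => ?_⟩
    obtain ⟨t, ht, ht'⟩ := hj' i hi
    exact hk' t ht (by rw [ht', hy])

theorem sameCycle_iff [Finite X] [Finite Y] (h : IsFirstReturn ι σ τ) (hι : Function.Injective ι)
    (x y : X) : τ.SameCycle x y ↔ σ.SameCycle (ι x) (ι y) := by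
  constructor
  · intro hxy
    obtain ⟨k, rfl⟩ := hxy.exists_nat_pow_eq
    obtain ⟨n, -, hn, -⟩ := h.exists_time hι x k
    exact ⟨n, by rw [zpow_natCast, hn]⟩
  · intro hxy
    obtain ⟨k, hk⟩ := hxy.exists_nat_pow_eq
    obtain ⟨j, hj, -⟩ := h.exists_index hι x k y hk
    exact ⟨j, by rw [zpow_natCast, hj]⟩

theorem exists_of_injective [Finite Y] (hι : Function.Injective ι) (σ : Perm Y) :
    ∃ τ : Perm X, IsFirstReturn ι σ τ := by
  classical
  have hfin : Finite X := Finite.of_injective ι hι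
  have hex : ∀ x, ∃ k : ℕ, (σ ^ (k + 1)) (ι x) ∈ Set.range ι := fun x =>
    ⟨orderOf σ - 1, x, by
      rw [Nat.sub_add_cancel (orderOf_pos σ), pow_orderOf_eq_one, Perm.one_apply]⟩
  choose f hf using fun x => Nat.find_spec (hex x)
  have hinj : Function.Injective f := by
    -- If two points return to the same point, the one with the longer way passes through the other
    -- on its way, which contradicts the minimality of its return time.
    have key : ∀ x y, f x = f y → Nat.find (hex x) ≤ Nat.find (hex y) → x = y := by
      intro x y hxy hle
      have h := hf x
      rw [hxy, hf y] at h
      obtain ⟨d, hd⟩ := Nat.exists_eq_add_of_le hle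
      rw [hd, show Nat.find (hex x) + d + 1 = (Nat.find (hex x) + 1) + d by ring, pow_add,
        Perm.mul_apply] at h
      have h2 := (σ ^ (Nat.find (hex x) + 1)).injective h
      rcases d with _ | d
      · exact (hι (by simpa using h2)).symm
      · exact absurd ⟨x, h2.symm⟩ (Nat.find_min (hex y) (m := d) (by omega))
    intro x y hxy
    rcases le_total (Nat.find (hex x)) (Nat.find (hex y)) with hle | hle
    · exact key x y hxy hle
    · exact (key y x hxy.symm hle).symm
  refine ⟨Equiv.ofBijective f (Finite.injective_iff_bijective.mp hinj), fun x =>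
    ⟨Nat.find (hex x), (hf x).symm, fun j hj => Nat.find_min (hex x) hj⟩⟩

end IsFirstReturn
end GaussLink

namespace GaussLink

open Equiv

/-! ### Smoothings of arrow diagrams -/

namespace BasedArrowDiagram

variable {m : ℕ} {α β : Type*} [DecidableEq α]

/-- The map of marked points that exchanges the ends of the arrows in `S`. -/
def smoothOpp (S : Finset α) : Pt α → Pt α :=
  Option.map fun e => (e.1, if e.1 ∈ S then !e.2 else e.2)

theorem smoothOpp_involutive (S : Finset α) : Function.Involutive (smoothOpp S) := by
  rintro (_ | ⟨a, b⟩)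
  · rfl
  · by_cases h : a ∈ S <;> simp [smoothOpp, h]

@[simp]
theorem smoothOpp_none (S : Finset α) : smoothOpp S none = none := rfl

theorem smoothOpp_of_mem {S : Finset α} {a : α} (h : a ∈ S) (b : Bool) :
    smoothOpp S (some (a, b)) = some (a, !b) := by
  simp [smoothOpp, h]

theorem smoothOpp_of_notMem {S : Finset α} {a : α} (h : a ∉ S) (b : Bool) :
    smoothOpp S (some (a, b)) = some (a, b) := by
  simp [smoothOpp, h]

/-- The passage along the diagram smoothed at the arrows in `S`: having come along an arc to a
marked point, go over to the other end of its arrow if it is in `S`, and follow the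
circle to the next marked point. -/
def smoothTrace (B : BasedArrowDiagram m α) (S : Finset α) : Perm (Pt α) :=
  (smoothOpp_involutive S).toPerm.trans B.next

theorem smoothTrace_apply (B : BasedArrowDiagram m α) (S : Finset α) (p : Pt α) :
    B.smoothTrace S p = B.next (smoothOpp S p) := rfl

/-- The smoothing of `B` at the arrows in `S` is connected. -/
def Feasible (B : BasedArrowDiagram m α) (S : Finset α) : Prop :=
  ∀ q, (B.smoothTrace S).SameCycle none q

/-- Starting from the base point, `σ` comes to `p`, and does not come to `q` before. -/
def VisitsFirst {X : Type*} (σ : Perm (Option X)) (p q : Option X) : Prop :=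
  ∃ k : ℕ, (σ ^ k) none = p ∧ ∀ j < k, (σ ^ j) none ≠ q

/-- Ascending diagrams for `c = true`, descending ones for `c = false`. -/
def IsMonotone (c : Bool) (A : BasedArrowDiagram m β) : Prop :=
  A.boundaryCount = 1 ∧ ∀ a, VisitsFirst A.trace (some (a, c)) (some (a, !c))

/-- The subdiagram with the arrows in `S` is ascending (descending). -/
def IsMonotoneState (c : Bool) (B : BasedArrowDiagram m α) (S : Finset α) : Prop :=
  Function.Surjective B.circle ∧ B.Feasible S ∧
    ∀ a ∈ S, VisitsFirst (B.smoothTrace S) (some (a, c)) (some (a, !c))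

/-- The base point is always a marked point, so the passage has at least one cycle. Count one
therefore leaves exactly one cycle and no circle without marked points. -/
theorem boundaryCount_eq_one_iff [Finite β] (A : BasedArrowDiagram m β) :
    A.boundaryCount = 1 ↔
      (∀ p, A.trace.SameCycle none p) ∧ Function.Surjective A.circle := by
  have hpos : 0 < Nat.card (Quotient (Perm.SameCycle.setoid A.trace)) := by
    have : Nonempty (Quotient (Perm.SameCycle.setoid A.trace)) := ⟨Quotient.mk _ none⟩
    exact Nat.card_pos
  constructor
  · intro h
    have h1 : Nat.card (Quotient (Perm.SameCycle.setoid A.trace)) = 1 := by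
      unfold boundaryCount at h; omega
    have h2 : Nat.card {i : Fin m // ∀ p, A.circle p ≠ i} = 0 := by
      unfold boundaryCount at h; omega
    constructor
    · intro p
      have := (Nat.card_eq_one_iff_unique.mp h1).1
      exact Quotient.exact (Subsingleton.elim (Quotient.mk (Perm.SameCycle.setoid A.trace) none)
        (Quotient.mk _ p))
    · intro i
      by_contra hi
      push Not at hi
      have := (Finite.card_eq_zero_iff.mp h2)
      exact this.false ⟨i, hi⟩
  · rintro ⟨h1, h2⟩
    have e1 : Nat.card (Quotient (Perm.SameCycle.setoid A.trace)) = 1 := by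
      rw [Nat.card_eq_one_iff_unique]
      refine ⟨⟨fun x y => ?_⟩, ⟨Quotient.mk _ none⟩⟩
      induction x using Quotient.inductionOn
      induction y using Quotient.inductionOn
      exact Quotient.sound ((h1 _).symm.trans (h1 _))
    have e2 : Nat.card {i : Fin m // ∀ p, A.circle p ≠ i} = 0 := by
      rw [Finite.card_eq_zero_iff]
      refine ⟨fun ⟨i, hi⟩ => ?_⟩
      obtain ⟨p, hp⟩ := h2 i
      exact hi p hp
    rw [boundaryCount, e1, e2]

section Hom

variable [Fintype β] {A : BasedArrowDiagram m β} {B : BasedArrowDiagram m α}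

theorem Hom.mem_state (φ : Hom A B) (b : β) : φ.onArrow b ∈ φ.state := by
  simp [Hom.state]

theorem Hom.map_injective (φ : Hom A B) : Function.Injective (Pt.map φ.onArrow) :=
  Pt_map_injective φ.onArrow.injective

theorem Hom.mem_range_map (φ : Hom A B) {a : α} (h : a ∈ φ.state) (c : Bool) :
    some (a, c) ∈ Set.range (Pt.map φ.onArrow) := by
  obtain ⟨b, -, rfl⟩ := Finset.mem_map.mp h
  exact ⟨some (b, c), rfl⟩

theorem Hom.smoothOpp_map (φ : Hom A B) (p : Pt β) :
    smoothOpp φ.state (Pt.map φ.onArrow p) = Pt.map φ.onArrow (Pt.opp p) := by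
  rcases p with _ | ⟨b, c⟩
  · rfl
  · exact smoothOpp_of_mem (φ.mem_state b) c

theorem Hom.smoothOpp_of_notMem_range (φ : Hom A B) {q : Pt α}
    (h : q ∉ Set.range (Pt.map φ.onArrow)) : smoothOpp φ.state q = q := by
  rcases q with _ | ⟨a, c⟩
  · rfl
  · exact smoothOpp_of_notMem (fun ha => h (φ.mem_range_map ha c)) c

/-- Between two points of the image the passage meets only arrows outside the state, and there it
simply follows the circle. -/
theorem Hom.trace_isFirstReturn (φ : Hom A B) :
    IsFirstReturn (Pt.map φ.onArrow) (B.smoothTrace φ.state) A.trace := by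
  intro p
  obtain ⟨k, hk, hk'⟩ := φ.next_map (Pt.opp p)
  have key : ∀ j ≤ k, (B.smoothTrace φ.state ^ (j + 1)) (Pt.map φ.onArrow p) =
      (B.next ^ (j + 1)) (Pt.map φ.onArrow (Pt.opp p)) := by
    intro j hj
    induction j with
    | zero => simp [smoothTrace_apply, φ.smoothOpp_map]
    | succ j ih =>
      rw [pow_succ', Perm.mul_apply, ih (by omega), smoothTrace_apply,
        φ.smoothOpp_of_notMem_range (hk' j (by omega)), pow_succ' _ (j + 1), Perm.mul_apply]
  exact ⟨k, (key k le_rfl).trans hk, fun j hj => by rw [key j hj.le]; exact hk' j hj⟩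

theorem Hom.connected_iff [Finite α] (φ : Hom A B) :
    ((∀ p, A.trace.SameCycle none p) ∧ Function.Surjective A.circle) ↔
      Function.Surjective B.circle ∧ B.Feasible φ.state := by
  have hcyc := fun p => φ.trace_isFirstReturn.sameCycle_iff φ.map_injective none p
  -- A passage that never meets the image of `A` is never switched and runs around a single circle.
  -- This circle would carry no marked point of `A`.
  have key : ∀ q, (∀ k : ℕ, ((B.smoothTrace φ.state) ^ k) q ∉ Set.range (Pt.map φ.onArrow)) →
      ∀ k : ℕ, ((B.smoothTrace φ.state) ^ k) q = (B.next ^ k) q := by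
    intro q hq k
    induction k with
    | zero => rfl
    | succ k ih =>
      rw [pow_succ', Perm.mul_apply, smoothTrace_apply, φ.smoothOpp_of_notMem_range (hq k), ih,
        pow_succ', Perm.mul_apply]
  constructor
  · rintro ⟨h1, h2⟩
    refine ⟨fun i => ?_, fun q => ?_⟩
    · obtain ⟨p, hp⟩ := h2 (φ.onCircle.symm i)
      exact ⟨Pt.map φ.onArrow p, by rw [φ.circle_map, hp, Equiv.apply_symm_apply]⟩
    · by_cases hq : ∀ k : ℕ, ((B.smoothTrace φ.state) ^ k) q ∉ Set.range (Pt.map φ.onArrow)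
      · obtain ⟨p, hp⟩ := h2 (φ.onCircle.symm (B.circle q))
        have hsame : B.next.SameCycle q (Pt.map φ.onArrow p) := by
          rw [B.sameCycle_iff, φ.circle_map, hp, Equiv.apply_symm_apply]
        obtain ⟨k, hk⟩ := hsame.exists_nat_pow_eq
        exact absurd ⟨p, by rw [key q hq, hk]⟩ (hq k)
      · push Not at hq
        obtain ⟨k, p, hp⟩ := hq
        have : (B.smoothTrace φ.state).SameCycle none (((B.smoothTrace φ.state) ^ k) q) := by
          rw [← hp]; exact (hcyc p).mp (h1 p)
        exact (Perm.sameCycle_pow_right).mp this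
  · rintro ⟨h1, h2⟩
    refine ⟨fun p => (hcyc p).mpr (h2 _), fun i => ?_⟩
    obtain ⟨q, hq⟩ := h1 (φ.onCircle i)
    by_contra hi
    push Not at hi
    have hout : ∀ k : ℕ, (B.next ^ k) q ∉ Set.range (Pt.map φ.onArrow) := by
      rintro k ⟨p, hp⟩
      refine hi p (φ.onCircle.injective ?_)
      rw [← φ.circle_map, hp, ← hq]
      exact ((B.sameCycle_iff _ _).mp ⟨k, by simp⟩).symm
    have hk : ∀ k : ℕ, ((B.smoothTrace φ.state) ^ k) q = (B.next ^ k) q := by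
      intro k
      induction k with
      | zero => rfl
      | succ k ih =>
        rw [pow_succ', Perm.mul_apply, smoothTrace_apply, ih,
          φ.smoothOpp_of_notMem_range (hout k), pow_succ', Perm.mul_apply]
    obtain ⟨k, hk'⟩ := (h2 q).symm.exists_nat_pow_eq
    exact hout k ⟨none, by rw [← hk, hk']; rfl⟩

theorem Hom.isMonotone_iff [Finite α] (φ : Hom A B) (c : Bool) :
    A.IsMonotone c ↔ B.IsMonotoneState c φ.state := by
  rw [IsMonotone, IsMonotoneState, boundaryCount_eq_one_iff, φ.connected_iff, and_assoc]
  refine and_congr_right fun _ => and_congr_right fun _ => ?_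
  have key : ∀ b, VisitsFirst A.trace (some (b, c)) (some (b, !c)) ↔
      VisitsFirst (B.smoothTrace φ.state) (some (φ.onArrow b, c)) (some (φ.onArrow b, !c)) :=
    fun b => φ.trace_isFirstReturn.visits_first_iff φ.map_injective none _ _
  constructor
  · intro h a ha
    obtain ⟨b, -, rfl⟩ := Finset.mem_map.mp ha
    exact (key b).mp (h b)
  · exact fun h b => (key b).mpr (h _ (φ.mem_state b))

end Hom

/-- Homomorphisms with the same state have isomorphic sources. -/
theorem Hom.exists_iso_of_state_eq {n : ℕ} {A A' : BasedArrowDiagram m (Fin n)}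
    {B : BasedArrowDiagram m α} (φ : Hom A B) (ψ : Hom A' B) (h : φ.state = ψ.state) :
    ∃ f : Perm (Fin n), (∀ b, ψ.onArrow (f b) = φ.onArrow b) ∧
      (∀ p, A'.next (Pt.map f p) = Pt.map f (A.next p)) ∧
      ∀ p, A'.circle (Pt.map f p) = (ψ.onCircle⁻¹ * φ.onCircle) (A.circle p) := by
  have hex : ∀ b, ∃ b', ψ.onArrow b' = φ.onArrow b := fun b => by
    have := φ.mem_state b
    rw [h] at this
    obtain ⟨b', -, hb'⟩ := Finset.mem_map.mp this
    exact ⟨b', hb'⟩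
  choose f hf using hex
  have hinj : Function.Injective f := fun b b' hbb => φ.onArrow.injective (by
    rw [← hf b, ← hf b', hbb])
  let f' : Perm (Fin n) := Equiv.ofBijective f (Finite.injective_iff_bijective.mp hinj)
  have hmap : ∀ p, Pt.map ψ.onArrow (Pt.map f' p) = Pt.map φ.onArrow p := fun p => by
    rw [Pt_map_comp]
    congr 1
    exact funext hf
  have hrange : Set.range (Pt.map φ.onArrow) = Set.range (Pt.map ψ.onArrow) := by
    ext q
    constructor
    · rintro ⟨p, rfl⟩
      exact ⟨_, hmap p⟩
    · rintro ⟨p, rfl⟩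
      have hs : Pt.map f' (Pt.map f'.symm p) = p := by
        rw [Pt_map_comp, Equiv.self_comp_symm, Pt_map_id]
      exact ⟨Pt.map f'.symm p, by rw [← hmap, hs]⟩
  refine ⟨f', hf, fun p => ?_, fun p => ?_⟩
  · apply ψ.map_injective
    rw [hmap]
    obtain ⟨k, hk, hk'⟩ := φ.next_map p
    obtain ⟨l, hl, hl'⟩ := ψ.next_map (Pt.map f' p)
    rw [hmap, ← hrange] at hl'
    rw [hmap] at hl
    rcases lt_trichotomy k l with hlt | rfl | hgt
    · exact absurd ⟨_, hk.symm⟩ (hl' k hlt)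
    · rw [← hk, ← hl]
    · refine absurd ?_ (hk' l hgt)
      rw [hl, hrange]
      exact ⟨_, rfl⟩
  · rw [Perm.mul_apply, Perm.eq_inv_iff_eq, ← ψ.circle_map, hmap, φ.circle_map]

/-- A homomorphism from a connected diagram is determined by its state. -/
theorem Hom.eq_of_state_eq {n : ℕ} {A : BasedArrowDiagram m (Fin n)} {B : BasedArrowDiagram m α}
    (hA : A.boundaryCount = 1) (φ ψ : Hom A B) (h : φ.state = ψ.state) : φ = ψ := by
  obtain ⟨hA1, hA2⟩ := (boundaryCount_eq_one_iff A).mp hA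
  obtain ⟨f, hf1, hf2, hf3⟩ := φ.exists_iso_of_state_eq ψ h
  have hopp : ∀ p : Pt (Fin n), Pt.opp (Pt.map f p) = Pt.map f (Pt.opp p) := by
    rintro (_ | ⟨b, c⟩) <;> rfl
  have htr : ∀ p, A.trace (Pt.map f p) = Pt.map f (A.trace p) := fun p => by
    change A.next (Pt.opp (Pt.map f p)) = Pt.map f (A.next (Pt.opp p))
    rw [hopp, hf2]
  -- The relabelling `f` is an automorphism of `A` that fixes the base point and commutes with the
  -- passage; as the passage reaches every marked point, `f` is the identity.
  have hfix : ∀ k : ℕ, Pt.map f ((A.trace ^ k) none) = (A.trace ^ k) none := by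
    intro k
    induction k with
    | zero => rfl
    | succ k ih => rw [pow_succ', Perm.mul_apply, ← htr, ih]
  have hid : ∀ p, Pt.map f p = p := fun p => by
    obtain ⟨k, rfl⟩ := (hA1 p).exists_nat_pow_eq
    exact hfix k
  refine Hom.ext' ?_ ?_
  · ext i
    obtain ⟨p, rfl⟩ := hA2 i
    have := hf3 p
    rw [hid, Perm.mul_apply, eq_comm, Perm.inv_eq_iff_eq] at this
    rw [this]
  · ext b
    have := hid (some (b, false))
    have hb : f b = b := by simpa [Pt.map] using this
    rw [← hf1, hb]

/-- Every set of `n` arrows is the state of a homomorphism. -/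
theorem exists_hom_state_eq [Finite α] {n : ℕ} (B : BasedArrowDiagram m α) (S : Finset α)
    (hS : S.card = n) : ∃ (A : BasedArrowDiagram m (Fin n)) (φ : Hom A B), φ.state = S := by
  let e : Fin n ↪ α := (S.equivFinOfCardEq hS).symm.toEmbedding.trans (Function.Embedding.subtype _)
  have he : Finset.univ.map e = S := by
    ext a
    simp only [Finset.mem_map, Finset.mem_univ, true_and]
    constructor
    · rintro ⟨b, rfl⟩
      exact ((S.equivFinOfCardEq hS).symm b).2
    · intro ha
      exact ⟨S.equivFinOfCardEq hS ⟨a, ha⟩, by simp [e]⟩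
  have hι : Function.Injective (Pt.map e) := Pt_map_injective e.injective
  obtain ⟨τ, hτ⟩ := IsFirstReturn.exists_of_injective hι B.next
  let A : BasedArrowDiagram m (Fin n) :=
    { circle := fun p => B.circle (Pt.map e p)
      next := τ
      sameCycle_iff := fun p q => by
        rw [hτ.sameCycle_iff hι, B.sameCycle_iff] }
  exact ⟨A, ⟨1, e, fun p => rfl, hτ⟩, he⟩

end BasedArrowDiagram
end GaussLink

/-! ### Coefficients as sums over ascending and descending states -/

namespace GaussLink

open Equiv

namespace BasedGaussDiagram

open BasedArrowDiagram

variable {m : ℕ} {α : Type*} [Fintype α] [DecidableEq α]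

open Classical in
theorem pairing_eq_sum {n : ℕ} {A : BasedArrowDiagram m (Fin n)} (hA : A.boundaryCount = 1)
    (G : BasedGaussDiagram m α) :
    pairing A G = ∑ S : Finset α,
      if ∃ φ : Hom A G.toBasedArrowDiagram, φ.state = S then ∏ a ∈ S, (G.sign a : ℤ) else 0 := by
  have hinj : Function.Injective (Hom.state : Hom A G.toBasedArrowDiagram → Finset α) :=
    fun φ ψ h => Hom.eq_of_state_eq hA φ ψ h
  refine Eq.trans ?_ (Finset.sum_filter _ _)
  have hfin : Fintype (Hom A G.toBasedArrowDiagram) := Fintype.ofFinite _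
  rw [pairing, finsum_eq_sum_of_fintype]
  refine (Finset.sum_map Finset.univ ⟨Hom.state, hinj⟩
    (fun S => ∏ a ∈ S, (G.sign a : ℤ))).symm.trans ?_
  refine Finset.sum_congr ?_ fun _ _ => rfl
  ext S
  simp

open Classical in
/-- The sum of the pairings with all ascending (descending) diagrams is the sum over all ascending
(descending) states. -/
theorem finsum_classPairing (c : Bool) (n : ℕ) (G : BasedGaussDiagram m α) :
    ∑ᶠ q ∈ {q : Quotient (isoSetoid m n) | ∃ A : BasedArrowDiagram m (Fin n), ⟦A⟧ = q ∧
      A.IsMonotone c}, classPairing q G =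
    ∑ S : Finset α, if S.card = n ∧ G.IsMonotoneState c S then ∏ a ∈ S, (G.sign a : ℤ) else 0 := by
  set Q := {q : Quotient (isoSetoid m n) | ∃ A : BasedArrowDiagram m (Fin n), ⟦A⟧ = q ∧
      A.IsMonotone c} with hQ
  have hfinQ : Q.Finite := Set.toFinite Q
  rw [finsum_mem_eq_finite_toFinset_sum _ hfinQ]
  have h1 : ∀ q ∈ hfinQ.toFinset, classPairing q G = ∑ S : Finset α,
      if ∃ (A : BasedArrowDiagram m (Fin n)) (φ : Hom A G.toBasedArrowDiagram),
        ⟦A⟧ = q ∧ A.IsMonotone c ∧ φ.state = S then ∏ a ∈ S, (G.sign a : ℤ) else 0 := by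
    intro q hq
    obtain ⟨A, rfl, hA⟩ := hfinQ.mem_toFinset.mp hq
    change pairing A G = _
    rw [pairing_eq_sum hA.1]
    refine Finset.sum_congr rfl fun S _ => ?_
    congr 1
    refine propext ⟨fun ⟨φ, hφ⟩ => ⟨A, φ, rfl, hA, hφ⟩, ?_⟩
    -- Conversely, a homomorphism from another representative of the class is composed with an
    -- isomorphism, which keeps its state.
    rintro ⟨A', φ', hA', -, rfl⟩
    obtain ⟨c', f, h1, h2⟩ : Iso A A' := Quotient.exact hA'.symm
    refine ⟨⟨φ'.onCircle * c', f.toEmbedding.trans φ'.onArrow, fun p => ?_, fun p => ?_⟩, ?_⟩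
    · have := φ'.circle_map (Pt.map f p)
      rw [h1, Pt_map_comp] at this
      exact this
    · have := φ'.next_map (Pt.map f p)
      rw [h2, Pt_map_comp, Pt_map_comp] at this
      have hr : Set.range (Pt.map (f.toEmbedding.trans φ'.onArrow)) =
          Set.range (Pt.map φ'.onArrow) := by
        have hc : Pt.map (f.toEmbedding.trans φ'.onArrow) = Pt.map φ'.onArrow ∘ Pt.map f := by
          funext p
          exact (Pt_map_comp φ'.onArrow f p).symm
        rw [hc]
        refine Function.Surjective.range_comp (fun p => ⟨Pt.map f.symm p, ?_⟩) _
        rw [Pt_map_comp, Equiv.self_comp_symm, Pt_map_id]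
      rw [hr]
      exact this
    · ext a
      simp only [Hom.state, Finset.mem_map, Finset.mem_univ, true_and]
      constructor
      · rintro ⟨b, rfl⟩
        exact ⟨f b, rfl⟩
      · rintro ⟨b, rfl⟩
        exact ⟨f.symm b, by simp⟩
  rw [Finset.sum_congr rfl h1, Finset.sum_comm]
  refine Finset.sum_congr rfl fun S _ => ?_
  split_ifs with hS
  · obtain ⟨hn, hS⟩ := hS
    obtain ⟨A, φ, hφ⟩ := exists_hom_state_eq G.toBasedArrowDiagram S hn
    have hA : A.IsMonotone c := by rw [φ.isMonotone_iff, hφ]; exact hS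
    -- A state determines the isomorphism class of the source, so every monotone state is counted in
    -- exactly one class.
    rw [Finset.sum_eq_single (⟦A⟧ : Quotient (isoSetoid m n)), if_pos ⟨A, φ, rfl, hA, hφ⟩]
    · intro q _ hq
      refine if_neg ?_
      rintro ⟨A', φ', rfl, -, hφ'⟩
      obtain ⟨f, -, h2, h3⟩ := φ'.exists_iso_of_state_eq φ (hφ'.trans hφ.symm)
      exact hq (Quotient.sound ⟨_, f, h3, h2⟩)
    · intro h
      exact absurd (hfinQ.mem_toFinset.mpr ⟨A, rfl, hA⟩) h
  · refine Finset.sum_eq_zero fun q _ => if_neg ?_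
    rintro ⟨A, φ, -, hA, rfl⟩
    refine hS ⟨by simp [Hom.state], (φ.isMonotone_iff c).mp hA⟩

open Classical in
theorem coeff_nablaA_eq (G : BasedGaussDiagram m α) (n : ℕ) :
    (nablaA G).coeff n = ∑ S : Finset α,
      if S.card = n ∧ G.IsMonotoneState true S then ∏ a ∈ S, (G.sign a : ℤ) else 0 := by
  rw [coeff_nablaA]
  exact finsum_classPairing true n G

open Classical in
theorem coeff_nablaD_eq (G : BasedGaussDiagram m α) (n : ℕ) :
    (nablaD G).coeff n = ∑ S : Finset α,
      if S.card = n ∧ G.IsMonotoneState false S then ∏ a ∈ S, (G.sign a : ℤ) else 0 := by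
  rw [coeff_nablaD]
  exact finsum_classPairing false n G

end BasedGaussDiagram
end GaussLink

namespace GaussLink

open Equiv

namespace BasedArrowDiagram

/-! ### The time of the first visit -/

section VisitTime

variable {X : Type*} {σ : Perm (Option X)}

/-- The number of steps that it takes to come from the base point to `q`. -/
noncomputable def visitTime (σ : Perm (Option X)) (q : Option X) : ℕ :=
  sInf {k : ℕ | (σ ^ k) none = q}

theorem visitTime_le {q : Option X} {k : ℕ} (h : (σ ^ k) none = q) : visitTime σ q ≤ k :=
  Nat.sInf_le h

theorem VisitsFirst.asymm {p q : Option X} (hpq : p ≠ q) (h : VisitsFirst σ p q) :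
    ¬ VisitsFirst σ q p := by
  rintro ⟨l, hl, hl'⟩
  obtain ⟨k, hk, hk'⟩ := h
  rcases lt_trichotomy k l with hlt | rfl | hgt
  · exact hl' k hlt hk
  · exact hpq (hk.symm.trans hl)
  · exact hk' l hgt hl

variable [Finite X] (hσ : ∀ q, σ.SameCycle none q)
include hσ

theorem pow_visitTime (q : Option X) : (σ ^ visitTime σ q) none = q :=
  Nat.sInf_mem (s := {k : ℕ | (σ ^ k) none = q}) (hσ q).exists_nat_pow_eq

theorem visitTime_injective : Function.Injective (visitTime σ) := fun p q h => by
  rw [← pow_visitTime hσ p, h, pow_visitTime hσ]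

theorem visitTime_apply {q : Option X} (h : σ q ≠ none) :
    visitTime σ (σ q) = visitTime σ q + 1 := by
  apply le_antisymm
  · exact visitTime_le (by rw [pow_succ', Perm.mul_apply, pow_visitTime hσ])
  · have hs := pow_visitTime hσ (σ q)
    rcases hk : visitTime σ (σ q) with _ | k
    · rw [hk] at hs
      exact absurd hs.symm h
    · rw [hk, pow_succ', Perm.mul_apply] at hs
      have := visitTime_le (σ.injective hs)
      omega

theorem visitsFirst_iff {p q : Option X} (hpq : p ≠ q) :
    VisitsFirst σ p q ↔ visitTime σ p < visitTime σ q := by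
  constructor
  · rintro ⟨k, hk, hk'⟩
    by_contra hlt
    have h1 := visitTime_le hk
    rcases (show visitTime σ q < k ∨ visitTime σ q = k by omega) with h2 | h2
    · exact hk' _ h2 (pow_visitTime hσ q)
    · exact hpq (by rw [← hk, ← h2, pow_visitTime hσ])
  · intro h
    refine ⟨_, pow_visitTime hσ p, fun j hj hq => ?_⟩
    have := visitTime_le hq
    omega

theorem visitsFirst_or {p q : Option X} (hpq : p ≠ q) :
    VisitsFirst σ p q ∨ VisitsFirst σ q p := by
  rw [visitsFirst_iff hσ hpq, visitsFirst_iff hσ hpq.symm]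
  have := (visitTime_injective hσ).ne hpq
  omega

/-- The point before the base point is visited last; one more step closes the cycle. -/
theorem pow_period : (σ ^ (visitTime σ (σ⁻¹ none) + 1)) none = none := by
  rw [pow_succ', Perm.mul_apply, pow_visitTime hσ, show σ (σ⁻¹ none) = none from σ.apply_symm_apply none]

theorem visitTime_le_last (q : Option X) : visitTime σ q ≤ visitTime σ (σ⁻¹ none) := by
  by_contra h
  push Not at h
  obtain ⟨d, hd⟩ : ∃ d, visitTime σ q = d + (visitTime σ (σ⁻¹ none) + 1) :=
    ⟨visitTime σ q - (visitTime σ (σ⁻¹ none) + 1), by omega⟩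
  have hs := pow_visitTime hσ q
  rw [hd, pow_add, Perm.mul_apply, pow_period hσ] at hs
  have := visitTime_le hs
  omega

theorem visitTime_pow {k : ℕ} (hk : k ≤ visitTime σ (σ⁻¹ none)) :
    visitTime σ ((σ ^ k) none) = k := by
  refine le_antisymm (visitTime_le rfl) ?_
  by_contra h
  push Not at h
  obtain ⟨d, hd⟩ : ∃ d, k = visitTime σ ((σ ^ k) none) + d := ⟨_, (Nat.add_sub_of_le h.le).symm⟩
  have h1 : (σ ^ d) none = none := by
    apply (σ ^ visitTime σ ((σ ^ k) none)).injective
    rw [← Perm.mul_apply, ← pow_add, ← hd, pow_visitTime hσ]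
  have h2 := pow_visitTime hσ (σ⁻¹ none)
  rw [show visitTime σ (σ⁻¹ none) = (visitTime σ (σ⁻¹ none) - d) + d by omega, pow_add,
    Perm.mul_apply, h1] at h2
  have := visitTime_le h2
  omega

theorem sum_eq_sum_range [Fintype X] {M : Type*} [AddCommMonoid M] (f : Option X → M) :
    ∑ q, f q = ∑ k ∈ Finset.range (visitTime σ (σ⁻¹ none) + 1), f ((σ ^ k) none) := by
  refine Finset.sum_bij' (fun q _ => visitTime σ q) (fun k _ => (σ ^ k) none) ?_ ?_ ?_ ?_ ?_
  · intro q _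
    exact Finset.mem_range.mpr (Nat.lt_succ_of_le (visitTime_le_last hσ q))
  · intro k _
    exact Finset.mem_univ _
  · intro q _
    exact pow_visitTime hσ q
  · intro k hk
    exact visitTime_pow hσ (Nat.lt_succ_iff.mp (Finset.mem_range.mp hk))
  · intro q _
    rw [pow_visitTime hσ]

/-- The sum telescopes along the passage from the point after `p` until the return to the base
point. -/
theorem sum_visitTime_gt [Fintype X] (g : Option X → ℝ) (p : Option X) :
    ∑ q, (if visitTime σ p < visitTime σ q then g (σ q) - g q else 0) = g none - g (σ p) := by
  rw [sum_eq_sum_range hσ]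
  have hp := visitTime_le_last hσ p
  have h1 : ∀ k ∈ Finset.range (visitTime σ (σ⁻¹ none) + 1),
      (if visitTime σ p < visitTime σ ((σ ^ k) none) then
        g (σ ((σ ^ k) none)) - g ((σ ^ k) none) else 0) =
      if visitTime σ p + 1 ≤ k then g ((σ ^ (k + 1)) none) - g ((σ ^ k) none) else 0 := by
    intro k hk
    rw [visitTime_pow hσ (Nat.lt_succ_iff.mp (Finset.mem_range.mp hk)), pow_succ',
      Perm.mul_apply]
    rfl
  have h2 : (Finset.range (visitTime σ (σ⁻¹ none) + 1)).filter (fun k => visitTime σ p + 1 ≤ k) =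
      Finset.Ico (visitTime σ p + 1) (visitTime σ (σ⁻¹ none) + 1) := by
    ext k
    simp only [Finset.mem_filter, Finset.mem_range, Finset.mem_Ico]
    omega
  rw [Finset.sum_congr rfl h1, ← Finset.sum_filter, h2,
    Finset.sum_Ico_sub (fun k => g ((σ ^ k) none)) (by omega), pow_period hσ, pow_succ',
    Perm.mul_apply, pow_visitTime hσ]

theorem sum_visitTime_lt [Fintype X] (g : Option X → ℝ) (p : Option X) :
    ∑ q, (if visitTime σ q < visitTime σ p then g q - g (σ q) else 0) = g none - g p := by
  rw [sum_eq_sum_range hσ]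
  have hp := visitTime_le_last hσ p
  have h1 : ∀ k ∈ Finset.range (visitTime σ (σ⁻¹ none) + 1),
      (if visitTime σ ((σ ^ k) none) < visitTime σ p then
        g ((σ ^ k) none) - g (σ ((σ ^ k) none)) else 0) =
      if k < visitTime σ p then g ((σ ^ k) none) - g ((σ ^ (k + 1)) none) else 0 := by
    intro k hk
    rw [visitTime_pow hσ (Nat.lt_succ_iff.mp (Finset.mem_range.mp hk)), pow_succ',
      Perm.mul_apply]
  have h2 : (Finset.range (visitTime σ (σ⁻¹ none) + 1)).filter (fun k => k < visitTime σ p) =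
      Finset.range (visitTime σ p) := by
    ext k
    simp only [Finset.mem_filter, Finset.mem_range]
    omega
  rw [Finset.sum_congr rfl h1, ← Finset.sum_filter, h2,
    Finset.sum_range_sub' (fun k => g ((σ ^ k) none)), pow_visitTime hσ]
  rfl

end VisitTime

/-! ### The state sum and its skein relation -/

section StateSum

variable {m : ℕ} {α : Type*} [DecidableEq α]

/-- The writhe of a crossing with the end `(a, ov a)` on the overpass, where `s a` is the writhe
if the end `(a, false)` is on the overpass. -/
def writhe (s : α → ℤˣ) (ov : α → Bool) (a : α) : ℤ := if ov a then -(s a) else s a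

/-- The crossing change at `a`. -/
def changeCrossing (ov : α → Bool) (a : α) : α → Bool := Function.update ov a (!ov a)

theorem writhe_changeCrossing_self (s : α → ℤˣ) (ov : α → Bool) (a : α) :
    writhe s (changeCrossing ov a) a = -writhe s ov a := by
  cases h : ov a <;> simp [writhe, changeCrossing, h]

theorem changeCrossing_of_ne (ov : α → Bool) {a b : α} (h : b ≠ a) :
    changeCrossing ov a b = ov b := by
  simp [changeCrossing, h]

theorem writhe_changeCrossing_of_ne (s : α → ℤˣ) (ov : α → Bool) {a b : α} (h : b ≠ a) :
    writhe s (changeCrossing ov a) b = writhe s ov b := by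
  simp [writhe, changeCrossing_of_ne ov h]

theorem changeCrossing_changeCrossing (ov : α → Bool) (a : α) :
    changeCrossing (changeCrossing ov a) a = ov := by
  simp [changeCrossing]

open Classical in
/-- The contribution of the state `T` to the state sum of the diagram with the arrows
in `S` smoothed. -/
noncomputable def stateWeight (B : BasedArrowDiagram m α) (s : α → ℤˣ) (z : ℝ) (ov : α → Bool)
    (S T : Finset α) : ℝ :=
  if S ⊆ T ∧ B.Feasible T ∧
      ∀ a ∈ T \ S, VisitsFirst (B.smoothTrace T) (some (a, !ov a)) (some (a, ov a))
    then ∏ a ∈ T \ S, (writhe s ov a : ℝ) * z else 0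

theorem end_ne (a : α) (b : Bool) : (some (a, b) : Pt α) ≠ some (a, !b) := by
  simp

/-- The relation holds for every state separately. If `a` is not in `T`, the crossing change does
not matter. If it is, connectedness makes exactly one end of `a` the first one visited. So the
condition at `a` holds either before or after the change, and as the writhes are opposite, the
difference is the term of the smoothed diagram. -/
theorem stateWeight_skein [Finite α] (B : BasedArrowDiagram m α) (s : α → ℤˣ) (z : ℝ)
    (ov : α → Bool) (S T : Finset α) {a : α} (ha : a ∉ S) :
    B.stateWeight s z ov S T = B.stateWeight s z (changeCrossing ov a) S T +
      writhe s ov a * z * B.stateWeight s z ov (insert a S) T := by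
  classical
  by_cases hST : S ⊆ T
  swap
  · have : ¬ insert a S ⊆ T := fun h => hST ((Finset.subset_insert a S).trans h)
    simp [stateWeight, hST, this]
  by_cases haT : a ∈ T
  swap
  · have h1 : ¬ insert a S ⊆ T := fun h => haT (h (Finset.mem_insert_self a S))
    have h2 : ∀ b ∈ T \ S, b ≠ a := fun b hb h => haT (h ▸ (Finset.mem_sdiff.mp hb).1)
    have h3 : B.stateWeight s z ov (insert a S) T = 0 := if_neg fun h => h1 h.1
    rw [h3, mul_zero, add_zero]
    unfold stateWeight
    refine if_congr ?_ (Finset.prod_congr rfl fun b hb => ?_) rfl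
    · refine and_congr_right fun _ => and_congr_right fun _ => forall₂_congr fun b hb => ?_
      rw [changeCrossing_of_ne ov (h2 b hb)]
    · rw [writhe_changeCrossing_of_ne s ov (h2 b hb)]
  have hins : insert a S ⊆ T := Finset.insert_subset haT hST
  have hdec : T \ S = insert a (T \ insert a S) := by
    ext b
    simp only [Finset.mem_sdiff, Finset.mem_insert]
    by_cases hb : b = a
    · subst hb; simp [haT, ha]
    · simp [hb]
  have hnot : a ∉ T \ insert a S := by simp
  have hne : ∀ b ∈ T \ insert a S, b ≠ a := fun b hb h => hnot (h ▸ hb)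
  by_cases hF : B.Feasible T
  swap
  · simp [stateWeight, hF]
  by_cases hR : ∀ b ∈ T \ insert a S,
      VisitsFirst (B.smoothTrace T) (some (b, !ov b)) (some (b, ov b))
  swap
  · have h1 : ∀ ov' : α → Bool, (∀ b, b ≠ a → ov' b = ov b) →
        B.stateWeight s z ov' S T = 0 := by
      intro ov' ho
      refine if_neg fun h => hR fun b hb => ?_
      have := h.2.2 b (by rw [hdec]; exact Finset.mem_insert_of_mem hb)
      rwa [ho b (hne b hb)] at this
    have h2 : B.stateWeight s z ov (insert a S) T = 0 := if_neg fun h => hR h.2.2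
    rw [h1 ov fun _ _ => rfl, h1 _ fun b hb => changeCrossing_of_ne ov hb, h2]
    simp
  have e3 : B.stateWeight s z ov (insert a S) T =
      ∏ b ∈ T \ insert a S, (writhe s ov b : ℝ) * z := if_pos ⟨hins, hF, hR⟩
  have e12 : ∀ ov' : α → Bool, (∀ b, b ≠ a → ov' b = ov b) →
      B.stateWeight s z ov' S T =
        if VisitsFirst (B.smoothTrace T) (some (a, !ov' a)) (some (a, ov' a)) then
          (writhe s ov' a : ℝ) * z * ∏ b ∈ T \ insert a S, (writhe s ov b : ℝ) * z else 0 := by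
    intro ov' ho
    unfold stateWeight
    refine if_congr ?_ ?_ rfl
    · rw [hdec]
      constructor
      · intro h
        exact h.2.2 a (Finset.mem_insert_self _ _)
      · intro h
        refine ⟨hST, hF, fun b hb => ?_⟩
        rcases Finset.mem_insert.mp hb with rfl | hb
        · exact h
        · rw [ho b (hne b hb)]
          exact hR b hb
    · rw [hdec, Finset.prod_insert hnot]
      congr 1
      refine Finset.prod_congr rfl fun b hb => ?_
      simp [writhe, ho b (hne b hb)]
  rw [e12 ov fun _ _ => rfl, e12 _ fun b hb => changeCrossing_of_ne ov hb, e3,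
    writhe_changeCrossing_self]
  have hc : changeCrossing ov a a = !ov a := by simp [changeCrossing]
  rw [hc, Bool.not_not]
  rcases visitsFirst_or hF (end_ne a (ov a)) with h | h
  · rw [if_pos h, if_neg (h.asymm (end_ne a (ov a)))]
    push_cast
    ring
  · rw [if_pos h, if_neg (h.asymm (end_ne a (ov a)).symm)]
    ring

/-- The state sum of the diagram with the arrows in `S` smoothed. -/
noncomputable def stateSum [Fintype α] (B : BasedArrowDiagram m α) (s : α → ℤˣ) (z : ℝ)
    (ov : α → Bool) (S : Finset α) : ℝ :=
  ∑ T : Finset α, B.stateWeight s z ov S T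

theorem stateSum_skein [Fintype α] (B : BasedArrowDiagram m α) (s : α → ℤˣ) (z : ℝ)
    (ov : α → Bool) (S : Finset α) {a : α} (ha : a ∉ S) :
    B.stateSum s z ov S = B.stateSum s z (changeCrossing ov a) S +
      writhe s ov a * z * B.stateSum s z ov (insert a S) := by
  rw [stateSum, stateSum, stateSum, Finset.mul_sum, ← Finset.sum_add_distrib]
  exact Finset.sum_congr rfl fun T _ => B.stateWeight_skein s z ov S T ha

/-- No arrow outside of `S` is visited first on the underpass. -/
def IsLayered (B : BasedArrowDiagram m α) (ov : α → Bool) (S : Finset α) : Prop :=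
  ∀ a ∉ S, ¬ VisitsFirst (B.smoothTrace S) (some (a, !ov a)) (some (a, ov a))

theorem smoothOpp_congr {S T : Finset α} {a : α} (h : a ∈ S ↔ a ∈ T) (b : Bool) :
    smoothOpp S (some (a, b)) = smoothOpp T (some (a, b)) := by
  simp [smoothOpp, h]

/-- The passages smoothed at `S` and at `T` agree until an arrow of `T \ S` is met for the first
time. As the diagram is layered, this happens on the overpass, whereas a state that counts needs the
underpass first. -/
theorem stateWeight_eq_zero_of_isLayered [Finite α] (B : BasedArrowDiagram m α) (s : α → ℤˣ)
    (z : ℝ) {ov : α → Bool} {S T : Finset α} (hl : B.IsLayered ov S) (hST : S ≠ T) :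
    B.stateWeight s z ov S T = 0 := by
  classical
  refine if_neg ?_
  rintro ⟨hsub, hF, hV⟩
  obtain ⟨a₀, ha₀⟩ : (T \ S).Nonempty := by
    rw [Finset.sdiff_nonempty]
    exact fun h => hST (hsub.antisymm h)
  have hagree : ∀ k : ℕ, (∀ j < k, ∀ a ∈ T \ S, ∀ b, (B.smoothTrace S ^ j) none ≠ some (a, b)) →
      (B.smoothTrace T ^ k) none = (B.smoothTrace S ^ k) none := by
    intro k
    induction k with
    | zero => intro _; rfl
    | succ k ih =>
      intro h
      rw [pow_succ', pow_succ', Perm.mul_apply, Perm.mul_apply,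
        ih fun j hj => h j (by omega), smoothTrace_apply, smoothTrace_apply]
      congr 1
      rcases hq : (B.smoothTrace S ^ k) none with _ | ⟨a, b⟩
      · rfl
      · refine smoothOpp_congr ⟨fun haT => ?_, fun haS => hsub haS⟩ b
        by_contra haS
        exact h k (by omega) a (Finset.mem_sdiff.mpr ⟨haT, haS⟩) b hq
  have hex : ∃ k : ℕ, ∃ a ∈ T \ S, ∃ b, (B.smoothTrace S ^ k) none = some (a, b) := by
    by_contra hno
    push Not at hno
    obtain ⟨k, hk⟩ := (hF (some (a₀, false))).exists_nat_pow_eq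
    exact hno k a₀ ha₀ false (by rw [← hagree k fun j _ => hno j, hk])
  obtain ⟨a, ha, b, hab⟩ := Nat.find_spec hex
  have hmin : ∀ j < Nat.find hex, ∀ a ∈ T \ S, ∀ b, (B.smoothTrace S ^ j) none ≠ some (a, b) :=
    fun j hj a ha b h => Nat.find_min hex hj ⟨a, ha, b, h⟩
  have hS : VisitsFirst (B.smoothTrace S) (some (a, b)) (some (a, !b)) :=
    ⟨_, hab, fun j hj => hmin j hj a ha _⟩
  have hT : VisitsFirst (B.smoothTrace T) (some (a, b)) (some (a, !b)) :=
    ⟨_, (hagree _ hmin).trans hab, fun j hj => by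
      rw [hagree j fun i hi => hmin i (hi.trans hj)]
      exact hmin j hj a ha _⟩
  have hb : b = ov a := by
    by_contra hne
    have hb' : b = !ov a := (by decide : ∀ x y : Bool, x ≠ y → x = !y) _ _ hne
    subst hb'
    rw [Bool.not_not] at hS
    exact hl a (Finset.mem_sdiff.mp ha).2 hS
  subst hb
  exact hT.asymm (end_ne a (ov a)) (hV a ha)

open Classical in
theorem stateSum_of_isLayered [Fintype α] (B : BasedArrowDiagram m α) (s : α → ℤˣ)
    (z : ℝ) {ov : α → Bool} {S : Finset α} (hl : B.IsLayered ov S) :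
    B.stateSum s z ov S = if B.Feasible S then 1 else 0 := by
  rw [stateSum, Finset.sum_eq_single S
    (fun T _ hT => B.stateWeight_eq_zero_of_isLayered s z hl hT.symm) (by simp)]
  simp [stateWeight]

end StateSum

end BasedArrowDiagram
end GaussLink

/-! ### The Alexander determinant: skein relation and values on connected layered diagrams -/

namespace GaussLink

open Equiv Matrix

namespace BasedArrowDiagram

section Det

variable {α : Type*} [Fintype α] [DecidableEq α]

/-- The determinant of `M` with two rows replaced. -/
noncomputable def rowPairDet {ι : Type*} [Fintype ι] [DecidableEq ι] (M : Matrix ι ι ℝ) (i j : ι)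
    (x y : ι → ℝ) : ℝ :=
  ((M.updateRow i x).updateRow j y).det

section RowPair

variable {ι : Type*} [Fintype ι] [DecidableEq ι] (M : Matrix ι ι ℝ) {i j : ι}

theorem rowPairDet_add_right (x y y' : ι → ℝ) :
    rowPairDet M i j x (y + y') = rowPairDet M i j x y + rowPairDet M i j x y' :=
  det_updateRow_add _ _ _ _

theorem rowPairDet_smul_right (x y : ι → ℝ) (c : ℝ) :
    rowPairDet M i j x (c • y) = c * rowPairDet M i j x y :=
  det_updateRow_smul _ _ _ _

theorem rowPairDet_comm (hij : i ≠ j) (x y : ι → ℝ) :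
    rowPairDet M i j x y = ((M.updateRow j y).updateRow i x).det := by
  rw [rowPairDet, Matrix.updateRow_comm _ hij]

theorem rowPairDet_add_left (hij : i ≠ j) (x x' y : ι → ℝ) :
    rowPairDet M i j (x + x') y = rowPairDet M i j x y + rowPairDet M i j x' y := by
  simp only [rowPairDet_comm M hij]
  exact det_updateRow_add _ _ _ _

theorem rowPairDet_smul_left (hij : i ≠ j) (x y : ι → ℝ) (c : ℝ) :
    rowPairDet M i j (c • x) y = c * rowPairDet M i j x y := by
  simp only [rowPairDet_comm M hij]
  exact det_updateRow_smul _ _ _ _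

theorem rowPairDet_self (hij : i ≠ j) (x : ι → ℝ) : rowPairDet M i j x x = 0 := by
  refine det_zero_of_row_eq hij ?_
  rw [updateRow_self, updateRow_ne hij, updateRow_self]

theorem rowPairDet_swap (hij : i ≠ j) (x y : ι → ℝ) :
    rowPairDet M i j x y = -rowPairDet M i j y x := by
  have h := rowPairDet_self M hij (x + y)
  rw [rowPairDet_add_right, rowPairDet_add_left M hij, rowPairDet_add_left M hij,
    rowPairDet_self M hij, rowPairDet_self M hij] at h
  linarith

theorem det_eq_rowPairDet (hij : i ≠ j) (N : Matrix ι ι ℝ)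
    (h : ∀ k, k ≠ i → k ≠ j → N k = M k) : N.det = rowPairDet M i j (N i) (N j) := by
  rw [rowPairDet]
  congr 1
  ext k l
  by_cases hj : k = j
  · subst hj; rw [updateRow_self]
  · rw [updateRow_ne hj]
    by_cases hi : k = i
    · subst hi; rw [updateRow_self]
    · rw [updateRow_ne hi, h k hi hj]

/-- The skein relation of the local contributions of a crossing and its smoothing. -/
theorem rowPairDet_skein (hij : i ≠ j) (x y p q : ι → ℝ) {v : ℝ} (hv : v ≠ 0) :
    v⁻¹ * rowPairDet M i j (x - p) (v ^ 2 • y + (1 - v ^ 2) • x - q) -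
      v * rowPairDet M i j (v⁻¹ ^ 2 • x + (1 - v⁻¹ ^ 2) • y - p) (y - q) =
      (v⁻¹ - v) * rowPairDet M i j (y - p) (x - q) := by
  have hsub : ∀ a b : ι → ℝ, a - b = a + (-1 : ℝ) • b := fun a b => by
    rw [neg_one_smul, sub_eq_add_neg]
  simp only [hsub, rowPairDet_add_right, rowPairDet_add_left M hij, rowPairDet_smul_right,
    rowPairDet_smul_left M hij, rowPairDet_self M hij, rowPairDet_swap M hij y x]
  field_simp
  ring

end RowPair

variable {m : ℕ}

/-- The rows of the walk matrix that belong to the crossings. -/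
noncomputable def crossingRow (s : α → ℤˣ) (τ : ℝ) (ov : α → Bool) (S : Finset α) (e : α × Bool) :
    α × Bool → ℝ :=
  if e.1 ∈ S then Pi.single (e.1, !e.2) 1
  else if e.2 = ov e.1 then Pi.single e 1
  else (τ ^ writhe s ov e.1) ^ 2 • Pi.single e 1 +
    (1 - (τ ^ writhe s ov e.1) ^ 2) • Pi.single (e.1, !e.2) 1

/-- The row of the walk matrix that belongs to the arc that comes to an end of an arrow. -/
def arcRow (B : BasedArrowDiagram m α) (e f : α × Bool) : ℝ :=
  if B.next (some f) = some e then 1 else 0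

/-- The Alexander matrix of the diagram with the arrows in `S` smoothed; the arc that
starts at the base point has no column. -/
noncomputable def alexanderMatrix (B : BasedArrowDiagram m α) (s : α → ℤˣ) (τ : ℝ) (ov : α → Bool)
    (S : Finset α) : Matrix (α × Bool) (α × Bool) ℝ :=
  fun e => crossingRow s τ ov S e - B.arcRow e

theorem crossingRow_congr (s : α → ℤˣ) (τ : ℝ) {ov ov' : α → Bool} {S S' : Finset α} {e : α × Bool}
    (ho : ov' e.1 = ov e.1) (hS : e.1 ∈ S' ↔ e.1 ∈ S) :
    crossingRow s τ ov' S' e = crossingRow s τ ov S e := by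
  simp only [crossingRow, hS, ho, writhe]

/-- The three matrices differ only in the two rows of the ends of `a`; on these rows the relation is
the bilinear identity `rowPairDet_skein`. -/
theorem det_alexanderMatrix_skein_aux (B : BasedArrowDiagram m α) (s : α → ℤˣ) {τ : ℝ} (hτ : 0 < τ)
    (ov : α → Bool) (S : Finset α) {a : α} (ha : a ∉ S) (hov : ov a = false) :
    (τ ^ writhe s ov a)⁻¹ * (B.alexanderMatrix s τ ov S).det -
      τ ^ writhe s ov a * (B.alexanderMatrix s τ (changeCrossing ov a) S).det =
      ((τ ^ writhe s ov a)⁻¹ - τ ^ writhe s ov a) *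
        (B.alexanderMatrix s τ ov (insert a S)).det := by
  have hij : ((a, false) : α × Bool) ≠ (a, true) := by simp
  have hne : ∀ e : α × Bool, e ≠ (a, false) → e ≠ (a, true) → e.1 ≠ a := by
    rintro ⟨b, c⟩ h1 h2 rfl
    cases c
    · exact h1 rfl
    · exact h2 rfl
  set v := τ ^ writhe s ov a with hv
  have hv0 : v ≠ 0 := (zpow_pos hτ _).ne'
  have hov' : changeCrossing ov a a = true := by simp [changeCrossing, hov]
  have hw' : τ ^ writhe s (changeCrossing ov a) a = v⁻¹ := by
    rw [writhe_changeCrossing_self, _root_.zpow_neg]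
  have h := rowPairDet_skein (B.alexanderMatrix s τ ov S) hij (Pi.single (a, false) 1)
    (Pi.single (a, true) 1) (B.arcRow (a, false)) (B.arcRow (a, true)) hv0
  rw [det_eq_rowPairDet (B.alexanderMatrix s τ ov S) hij (B.alexanderMatrix s τ ov S)
      fun _ _ _ => rfl,
    det_eq_rowPairDet (B.alexanderMatrix s τ ov S) hij
      (B.alexanderMatrix s τ (changeCrossing ov a) S) fun e h1 h2 => ?_,
    det_eq_rowPairDet (B.alexanderMatrix s τ ov S) hij
      (B.alexanderMatrix s τ ov (insert a S)) fun e h1 h2 => ?_]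
  · convert h using 4 <;>
      simp [alexanderMatrix, crossingRow, ha, hov, hov', ← hv, hw']
  · unfold alexanderMatrix
    rw [crossingRow_congr s τ rfl]
    simp [hne e h1 h2]
  · unfold alexanderMatrix
    rw [crossingRow_congr s τ (changeCrossing_of_ne ov (hne e h1 h2)) Iff.rfl]

theorem inv_zpow_writhe_sub (s : α → ℤˣ) (τ : ℝ) (ov : α → Bool) (a : α) :
    (τ ^ writhe s ov a)⁻¹ - τ ^ writhe s ov a = writhe s ov a * (τ⁻¹ - τ) := by
  unfold writhe
  rcases Int.units_eq_one_or (s a) with h | h <;> cases ov a <;> simp [h]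

/-- When `ov a` is `true`, the case already treated is applied to the diagram with `a` changed; the
smoothing at `a` does not see the change. -/
theorem det_alexanderMatrix_skein (B : BasedArrowDiagram m α) (s : α → ℤˣ) {τ : ℝ} (hτ : 0 < τ)
    (ov : α → Bool) (S : Finset α) {a : α} (ha : a ∉ S) :
    (τ ^ writhe s ov a)⁻¹ * (B.alexanderMatrix s τ ov S).det =
      τ ^ writhe s ov a * (B.alexanderMatrix s τ (changeCrossing ov a) S).det +
      writhe s ov a * (τ⁻¹ - τ) * (B.alexanderMatrix s τ ov (insert a S)).det := by
  rw [← inv_zpow_writhe_sub]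
  cases hov : ov a
  · linarith [B.det_alexanderMatrix_skein_aux s hτ ov S ha hov]
  · have h := B.det_alexanderMatrix_skein_aux s hτ (changeCrossing ov a) S ha
      (by simp [changeCrossing, hov])
    have hsm : B.alexanderMatrix s τ (changeCrossing ov a) (insert a S) =
        B.alexanderMatrix s τ ov (insert a S) := by
      funext e
      unfold alexanderMatrix
      by_cases he : e.1 = a
      · simp [crossingRow, he]
      · rw [crossingRow_congr s τ (changeCrossing_of_ne ov he) Iff.rfl]
    rw [changeCrossing_changeCrossing, writhe_changeCrossing_self, _root_.zpow_neg, inv_inv, hsm] at h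
    linarith

/-- The permutation of the ends of the arrows that exchanges the ends of the arrows in `S`. -/
def endOpp (S : Finset α) : Perm (α × Bool) :=
  Equiv.prodCongrRight fun a => if a ∈ S then Equiv.swap false true else 1

theorem some_endOpp (S : Finset α) (e : α × Bool) : some (endOpp S e) = smoothOpp S (some e) := by
  obtain ⟨a, b⟩ := e
  by_cases h : a ∈ S <;> cases b <;> simp [endOpp, smoothOpp, h]

theorem sign_endOpp (S : Finset α) : Perm.sign (endOpp S) = (-1) ^ S.card := by
  rw [endOpp, Perm.sign_prodCongrRight]
  have : ∀ a, Perm.sign (if a ∈ S then Equiv.swap false true else 1) =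
      if a ∈ S then -1 else 1 := fun a => by split_ifs <;> simp
  simp only [this]
  rw [Finset.prod_ite_mem, Finset.univ_inter, Finset.prod_const]

theorem sign_smoothTrace (B : BasedArrowDiagram m α) (S : Finset α) :
    Perm.sign (B.smoothTrace S) = Perm.sign B.next * (-1) ^ S.card := by
  have : (smoothOpp_involutive S).toPerm = Equiv.optionCongr (endOpp S) := by
    ext1 p
    rcases p with _ | e
    · rfl
    · exact (some_endOpp S e).symm
  rw [smoothTrace, Perm.sign_trans, this, Equiv.optionCongr_sign, sign_endOpp]

/-- The number of arrows in a state with connected smoothing has the same parity for all states. -/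
theorem Feasible.neg_one_pow_card_eq {B : BasedArrowDiagram m α} {S T : Finset α}
    (hS : B.Feasible S) (hT : B.Feasible T) : (-1 : ℤˣ) ^ S.card = (-1) ^ T.card := by
  rcases isEmpty_or_nonempty α with h | ⟨⟨a⟩⟩
  · rw [Finset.eq_empty_of_isEmpty S, Finset.eq_empty_of_isEmpty T]
  -- For connected `U` the passage is one cycle through all marked points, so its sign depends only
  -- on their number. Comparison with `sign_smoothTrace` gives the parity of the number of arrows in
  -- `U`.
  have key : ∀ U : Finset α, B.Feasible U →
      Perm.sign (B.smoothTrace U) = -(-1) ^ Fintype.card (Pt α) := by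
    intro U hU
    have hne : ∀ p, B.smoothTrace U p ≠ p := by
      intro p hp
      have hall : ∀ q, q = p := fun q => by
        obtain ⟨k, hk⟩ := ((hU p).symm.trans (hU q)).exists_nat_pow_eq
        rw [← hk]
        clear hk
        induction k with
        | zero => rfl
        | succ k ih => rw [pow_succ', Perm.mul_apply, ih, hp]
      have := (hall none).trans (hall (some (a, true))).symm
      simp at this
    have hc : (B.smoothTrace U).IsCycle :=
      ⟨none, hne none, fun q _ => hU q⟩
    rw [hc.sign]
    congr 2
    rw [← Finset.card_univ]
    congr 1
    ext p
    simp [hne p]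
  have h1 := key S hS
  rw [← key T hT, sign_smoothTrace, sign_smoothTrace] at h1
  exact mul_left_cancel h1

theorem det_eq_prod_diag {ι : Type*} [Fintype ι] [DecidableEq ι] (M : Matrix ι ι ℝ) (t : ι → ℕ)
    (ht : Function.Injective t) (h : ∀ i j, t i < t j → M i j = 0) : M.det = ∏ i, M i i := by
  let _ : LinearOrder ι := LinearOrder.lift' t ht
  have hM : M.IsLowerTriangular := fun i j hij => h i j hij
  convert Matrix.det_of_isLowerTriangular M hM

/-- With the columns exchanged by `endOpp S` and everything ordered by the time of the visit, the
matrix is lower triangular: an arc leads to the next visit, and the row of an underpass involves,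
besides itself, only the overpass, which was visited before. The sign is that of the exchange of
columns, and the underpasses give the diagonal entries that are not 1. -/
theorem det_alexanderMatrix_of_isLayered (B : BasedArrowDiagram m α) (s : α → ℤˣ) (τ : ℝ)
    {ov : α → Bool} {S : Finset α} (hl : B.IsLayered ov S) (hF : B.Feasible S) :
    (B.alexanderMatrix s τ ov S).det = (-1) ^ S.card * ∏ a ∈ Sᶜ, (τ ^ writhe s ov a) ^ 2 := by
  set M := (B.alexanderMatrix s τ ov S).submatrix id (endOpp S) with hM
  have hdet : M.det = (-1) ^ S.card * (B.alexanderMatrix s τ ov S).det := by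
    rw [hM, Matrix.det_permute', sign_endOpp]
    push_cast
    rfl
  have hlt : ∀ a ∉ S, visitTime (B.smoothTrace S) (some (a, ov a)) <
      visitTime (B.smoothTrace S) (some (a, !ov a)) := by
    intro a ha
    rw [← visitsFirst_iff hF (end_ne a (ov a))]
    exact (visitsFirst_or hF (end_ne a (ov a))).resolve_right (hl a ha)
  have harc : ∀ e f, visitTime (B.smoothTrace S) (some e) ≤ visitTime (B.smoothTrace S) (some f) →
      B.arcRow e (endOpp S f) = 0 := by
    intro e f hef
    refine if_neg fun h => ?_
    rw [some_endOpp, ← smoothTrace_apply] at h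
    have := visitTime_apply hF (q := some f) (by rw [h]; simp)
    rw [h] at this
    omega
  have hcross : ∀ e f, visitTime (B.smoothTrace S) (some e) < visitTime (B.smoothTrace S) (some f) →
      crossingRow s τ ov S e (endOpp S f) = 0 := by
    rintro ⟨a, b⟩ ⟨a', b'⟩ hef
    by_cases haa : a = a'
    · subst haa
      have hbb : b' = !b := by
        cases b <;> cases b' <;> simp_all
      subst hbb
      by_cases ha : a ∈ S
      · have hE : endOpp S (a, !b) = (a, b) := by cases b <;> simp [endOpp, ha]
        simp [hE, crossingRow, ha]
      · have hE : endOpp S (a, !b) = (a, !b) := by cases b <;> simp [endOpp, ha]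
        have hb : b = ov a := by
          by_contra hne
          have hb' : b = !ov a := (by decide : ∀ x y : Bool, x ≠ y → x = !y) _ _ hne
          subst hb'
          rw [Bool.not_not] at hef
          have := hlt a ha
          omega
        rw [hE]
        simp [crossingRow, ha, hb]
    · have hE : endOpp S (a', b') = (a', (endOpp S (a', b')).2) := rfl
      have : (endOpp S (a', b')).1 ≠ a := fun h => haa h.symm
      rw [hE]
      have haa' : ∀ c c', ((a', c) : α × Bool) ≠ (a, c') := fun c c' h =>
        haa (congrArg Prod.fst h).symm
      simp [crossingRow]
      split_ifs <;> simp [haa']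
  have hdiag : M.det = ∏ e, M e e := by
    refine det_eq_prod_diag M (fun e => visitTime (B.smoothTrace S) (some e))
      (fun e f h => Option.some_injective _ (visitTime_injective hF h)) fun e f hef => ?_
    change crossingRow s τ ov S e (endOpp S f) - B.arcRow e (endOpp S f) = 0
    rw [harc e f hef.le, hcross e f hef, sub_zero]
  have hMe : ∀ e : α × Bool, M e e = if e.1 ∈ S then 1 else
      if e.2 = ov e.1 then 1 else (τ ^ writhe s ov e.1) ^ 2 := by
    rintro ⟨a, b⟩
    change crossingRow s τ ov S (a, b) (endOpp S (a, b)) - B.arcRow (a, b) (endOpp S (a, b)) = _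
    rw [harc _ _ le_rfl, sub_zero]
    by_cases ha : a ∈ S
    · have hE : endOpp S (a, b) = (a, !b) := by cases b <;> simp [endOpp, ha]
      simp [hE, crossingRow, ha]
    · have hE : endOpp S (a, b) = (a, b) := by cases b <;> simp [endOpp, ha]
      by_cases hb : b = ov a
      · subst hb
        simp [hE, crossingRow, ha]
      · simp [hE, crossingRow, ha, hb]
  have hprod : ∏ e, M e e = ∏ a ∈ Sᶜ, (τ ^ writhe s ov a) ^ 2 := by
    rw [Fintype.prod_prod_type]
    simp only [hMe]
    rw [← Finset.prod_subset (Finset.subset_univ Sᶜ) (fun a _ ha => by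
      have : a ∈ S := by simpa using ha
      simp [this])]
    refine Finset.prod_congr rfl fun a ha => ?_
    have : a ∉ S := by simpa using ha
    cases ov a <;> simp [this]
  rw [← hprod, ← hdiag, hdet, ← mul_assoc, ← pow_add, Even.neg_one_pow ⟨_, rfl⟩, one_mul]

end Det
end BasedArrowDiagram
end GaussLink

/-! ### The determinant as a state sum -/

namespace GaussLink

open Equiv

namespace BasedArrowDiagram

variable {m : ℕ} {α : Type*} [Fintype α] [DecidableEq α]

/-- The sum of the writhes of all crossings that are not smoothed. -/
def totalWrithe (s : α → ℤˣ) (ov : α → Bool) (S : Finset α) : ℤ := ∑ a ∈ Sᶜ, writhe s ov a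

open Classical in
/-- The total writhe for the choice of the overpasses for which every crossing that is not smoothed
is visited first on the overpass. -/
noncomputable def layeredWrithe (B : BasedArrowDiagram m α) (s : α → ℤˣ) (S : Finset α) : ℤ :=
  ∑ a ∈ Sᶜ, if VisitsFirst (B.smoothTrace S) (some (a, false)) (some (a, true))
    then (s a : ℤ) else -(s a)

theorem totalWrithe_eq_layeredWrithe (B : BasedArrowDiagram m α) (s : α → ℤˣ) {ov : α → Bool}
    {S : Finset α} (hl : B.IsLayered ov S) (hF : B.Feasible S) :
    totalWrithe s ov S = B.layeredWrithe s S := by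
  refine Finset.sum_congr rfl fun a ha => ?_
  have ha' : a ∉ S := by simpa using ha
  have h := (visitsFirst_or hF (end_ne a (ov a))).resolve_right (hl a ha')
  cases ho : ov a
  · rw [ho] at h
    rw [if_pos (by simpa using h)]
    simp [writhe, ho]
  · rw [ho] at h
    rw [if_neg (by simpa using h.asymm (end_ne a true))]
    simp [writhe, ho]

theorem totalWrithe_insert (s : α → ℤˣ) (ov : α → Bool) {S : Finset α} {a : α} (ha : a ∉ S) :
    totalWrithe s ov S = writhe s ov a + totalWrithe s ov (insert a S) := by
  unfold totalWrithe
  have : Sᶜ = insert a (insert a S)ᶜ := by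
    ext b
    by_cases hb : b = a
    · subst hb; simp [ha]
    · simp [hb]
  rw [this, Finset.sum_insert (by simp)]

theorem totalWrithe_changeCrossing (s : α → ℤˣ) (ov : α → Bool) {S : Finset α} {a : α}
    (ha : a ∉ S) :
    totalWrithe s (changeCrossing ov a) S = totalWrithe s ov S - 2 * writhe s ov a := by
  rw [totalWrithe_insert s ov ha, totalWrithe_insert s _ ha, writhe_changeCrossing_self]
  have : totalWrithe s (changeCrossing ov a) (insert a S) = totalWrithe s ov (insert a S) :=
    Finset.sum_congr rfl fun b hb => writhe_changeCrossing_of_ne s ov (by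
      rintro rfl
      simp at hb)
  rw [this]
  ring

/-- The Alexander determinant as a state sum. -/
theorem det_alexanderMatrix_eq_stateSum (B : BasedArrowDiagram m α) (s : α → ℤˣ) {τ : ℝ}
    (hτ : 0 < τ) {δ : ℝ} (hδ : ∀ S, B.Feasible S → (-1 : ℝ) ^ S.card = δ) {Q : ℤ}
    (hQ : ∀ S, B.Feasible S → B.layeredWrithe s S = Q)
    (h0 : ∀ ov S, B.IsLayered ov S → ¬ B.Feasible S → (B.alexanderMatrix s τ ov S).det = 0)
    (ov : α → Bool) (S : Finset α) :
    (B.alexanderMatrix s τ ov S).det =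
      δ * τ ^ (totalWrithe s ov S + Q) * B.stateSum s (τ⁻¹ - τ) ov S := by
  classical
  -- The outer induction is on the number of unsmoothed crossings, the inner one on the number of
  -- those that are visited first on the underpass. Smoothing such a crossing lowers the first
  -- number. Changing it keeps the passage and lowers the second.
  induction hn : Sᶜ.card using Nat.strong_induction_on generalizing ov S with
  | _ n ihn =>
  induction hk : (Finset.univ.filter fun a => a ∉ S ∧
      VisitsFirst (B.smoothTrace S) (some (a, !ov a)) (some (a, ov a))).card
      using Nat.strong_induction_on generalizing ov with
  | _ k ihk =>
  by_cases hl : B.IsLayered ov S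
  · rw [B.stateSum_of_isLayered s _ hl]
    by_cases hF : B.Feasible S
    -- Here the exponent is twice the total writhe, and one of the two copies is replaced by `Q`. In
    -- this form the statement is compatible with the skein relations.
    · rw [if_pos hF, B.det_alexanderMatrix_of_isLayered s τ hl hF, hδ S hF, mul_one,
        ← hQ S hF, ← B.totalWrithe_eq_layeredWrithe s hl hF, zpow_add₀ hτ.ne', totalWrithe,
        Finset.prod_pow, sq]
      have : ∀ U : Finset α, ∏ a ∈ U, τ ^ writhe s ov a = τ ^ ∑ a ∈ U, writhe s ov a := fun U => by
        induction U using Finset.induction_on with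
        | empty => simp
        | insert a U ha ih => rw [Finset.prod_insert ha, Finset.sum_insert ha, zpow_add₀ hτ.ne', ih]
      rw [this]
    · rw [if_neg hF, h0 ov S hl hF, mul_zero]
  · unfold IsLayered at hl
    push Not at hl
    obtain ⟨a, ha, hV⟩ := hl
    have h1 := ihn (insert a S)ᶜ.card (by
      rw [← hn]
      refine Finset.card_lt_card ⟨by simpa using Finset.erase_subset a Sᶜ, fun h => ?_⟩
      have := h (Finset.mem_compl.mpr ha)
      simp at this) ov (insert a S) rfl
    have h2 := ihk _ (by
      rw [← hk]
      refine Finset.card_lt_card (Finset.ssubset_iff_of_subset ?_ |>.mpr ⟨a, ?_, ?_⟩)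
      · intro b hb
        simp only [Finset.mem_filter, Finset.mem_univ, true_and] at hb ⊢
        refine ⟨hb.1, ?_⟩
        by_cases hba : b = a
        · subst hba; exact hV
        · rw [changeCrossing_of_ne ov hba] at hb
          exact hb.2
      · simpa using ⟨ha, hV⟩
      · simp only [Finset.mem_filter, Finset.mem_univ, true_and, not_and]
        intro _
        have hc : changeCrossing ov a a = !ov a := by simp [changeCrossing]
        rw [hc, Bool.not_not]
        exact hV.asymm (end_ne a (ov a)).symm) (changeCrossing ov a) rfl
    have h3 := B.det_alexanderMatrix_skein s hτ ov S ha
    have hv : τ ^ writhe s ov a ≠ 0 := (zpow_pos hτ _).ne'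
    rw [inv_mul_eq_iff_eq_mul₀ hv] at h3
    rw [h3, h1, h2, B.stateSum_skein s _ ov S ha, totalWrithe_changeCrossing s ov ha,
      show totalWrithe s ov (insert a S) = totalWrithe s ov S - writhe s ov a by
        rw [totalWrithe_insert s ov ha]; ring,
      show totalWrithe s ov S - 2 * writhe s ov a + Q =
        (totalWrithe s ov S + Q) - writhe s ov a - writhe s ov a by ring,
      show totalWrithe s ov S - writhe s ov a + Q =
        (totalWrithe s ov S + Q) - writhe s ov a by ring]
    simp only [zpow_sub₀ hτ.ne' _ (writhe s ov a)]
    field_simp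

end BasedArrowDiagram
end GaussLink

/-! ### Planar angles and the writhe of layered diagrams -/

namespace GaussLink

open Equiv

namespace BasedArrowDiagram

variable {m : ℕ} {α : Type*} [Fintype α] [DecidableEq α]

/-- The angles that describe a planar immersion of the circles of `B`: the arc from a marked point
`p` to the next one is seen under the angle `angle p q` from the marked point `q`.  The intersection
number of two arcs, which is given by these angles, is the sum of contributions `corner` and
`cocorner` of the crossings where the arcs begin or end. -/
structure PlanarAngles (B : BasedArrowDiagram m α) (s : α → ℤˣ) where
  angle : Pt α → Pt α → ℝ
  angle_opp : ∀ p q, angle p (Pt.opp q) = angle p q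
  corner : Pt α → ℝ
  cocorner : Pt α → ℝ
  corner_opp : ∀ p, corner (Pt.opp p) = -corner p
  cocorner_opp : ∀ p, cocorner (Pt.opp p) = -cocorner p
  corner_add_cocorner : ∀ a, corner (some (a, false)) + cocorner (some (a, false)) = (s a : ℤ) / 2
  intersection : ∀ p q,
    angle p (B.next q) - angle p q + (angle q p - angle q (B.next p)) =
      (if Pt.opp p = q then corner p else 0) +
      (if Pt.opp (B.next p) = B.next q then corner (B.next p) else 0) +
      (if Pt.opp (B.next p) = q then cocorner (B.next p) else 0) +
      (if Pt.opp p = B.next q then cocorner p else 0)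

theorem smoothOpp_eq_or (S : Finset α) (p : Pt α) : smoothOpp S p = p ∨ smoothOpp S p = Pt.opp p := by
  rcases p with _ | ⟨a, b⟩
  · exact Or.inl rfl
  · by_cases h : a ∈ S
    · exact Or.inr (smoothOpp_of_mem h b)
    · exact Or.inl (smoothOpp_of_notMem h b)

theorem smoothOpp_opp (S : Finset α) (p : Pt α) :
    smoothOpp S (Pt.opp p) = Pt.opp (smoothOpp S p) := by
  rcases p with _ | ⟨a, b⟩
  · rfl
  · by_cases h : a ∈ S <;> simp [smoothOpp, Pt.opp, h]

theorem opp_some (a : α) (b : Bool) : Pt.opp (some (a, b)) = some (a, !b) := rfl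

namespace PlanarAngles

variable {B : BasedArrowDiagram m α} {s : α → ℤˣ} (D : B.PlanarAngles s)

theorem angle_smoothOpp (S : Finset α) (p q : Pt α) :
    D.angle p (smoothOpp S q) = D.angle p q := by
  rcases smoothOpp_eq_or S q with h | h
  · rw [h]
  · rw [h, D.angle_opp]

theorem corner_none : D.corner none = 0 := by
  have h : D.corner none = -D.corner none := D.corner_opp none
  linarith

theorem cocorner_none : D.cocorner none = 0 := by
  have h : D.cocorner none = -D.cocorner none := D.cocorner_opp none
  linarith

theorem corner_true (a : α) : D.corner (some (a, true)) = -D.corner (some (a, false)) :=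
  D.corner_opp (some (a, false))

theorem cocorner_true (a : α) : D.cocorner (some (a, true)) = -D.cocorner (some (a, false)) :=
  D.cocorner_opp (some (a, false))

theorem corner_add_cocorner_over (ov : α → Bool) (a : α) :
    D.corner (some (a, ov a)) + D.cocorner (some (a, ov a)) = writhe s ov a / 2 := by
  have h := D.corner_add_cocorner a
  cases ho : ov a
  · rw [h]
    simp [writhe, ho]
  · rw [D.corner_true, D.cocorner_true]
    simp only [writhe, ho, if_true]
    push_cast
    linarith

/-- The self-intersections at the kinks. -/
noncomputable def kinks (a : α) : ℝ :=
  (if B.next (some (a, true)) = some (a, false) then D.cocorner (some (a, false)) else 0) -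
    if B.next (some (a, false)) = some (a, true) then D.cocorner (some (a, false)) else 0

/-- For a fixed arc the terms of all later arcs telescope, and so do those of all earlier arcs; what
remains are angles at the base point and at the ends of the arc itself. After reindexing by
`smoothOpp S` nothing depends on `S`. -/
theorem sum_intersection {S : Finset α} (hF : B.Feasible S) :
    ∑ p, ∑ q, (if visitTime (B.smoothTrace S) p < visitTime (B.smoothTrace S) q then
      D.angle (smoothOpp S p) (B.next (smoothOpp S q)) - D.angle (smoothOpp S p) (smoothOpp S q) +
      (D.angle (smoothOpp S q) (smoothOpp S p) -
        D.angle (smoothOpp S q) (B.next (smoothOpp S p))) else 0) =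
    ∑ p, (2 * D.angle p none - D.angle p (B.next p) - D.angle p p) := by
  have h1 : ∀ p q, (if visitTime (B.smoothTrace S) p < visitTime (B.smoothTrace S) q then
      D.angle (smoothOpp S p) (B.next (smoothOpp S q)) - D.angle (smoothOpp S p) (smoothOpp S q) +
      (D.angle (smoothOpp S q) (smoothOpp S p) -
        D.angle (smoothOpp S q) (B.next (smoothOpp S p))) else 0) =
      (if visitTime (B.smoothTrace S) p < visitTime (B.smoothTrace S) q then
        D.angle (smoothOpp S p) (B.smoothTrace S q) - D.angle (smoothOpp S p) q else 0) +
      (if visitTime (B.smoothTrace S) p < visitTime (B.smoothTrace S) q then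
        D.angle (smoothOpp S q) p - D.angle (smoothOpp S q) (B.smoothTrace S p) else 0) := by
    intro p q
    rw [D.angle_smoothOpp, D.angle_smoothOpp, smoothTrace_apply, smoothTrace_apply]
    split_ifs <;> simp
  simp only [h1, Finset.sum_add_distrib]
  rw [Finset.sum_comm (f := fun p q =>
    if visitTime (B.smoothTrace S) p < visitTime (B.smoothTrace S) q then
        D.angle (smoothOpp S q) p - D.angle (smoothOpp S q) (B.smoothTrace S p) else 0)]
  have h2 : ∀ p, ∑ q, (if visitTime (B.smoothTrace S) p < visitTime (B.smoothTrace S) q then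
      D.angle (smoothOpp S p) (B.smoothTrace S q) - D.angle (smoothOpp S p) q else 0) =
      D.angle (smoothOpp S p) none - D.angle (smoothOpp S p) (B.smoothTrace S p) :=
    fun p => sum_visitTime_gt hF (D.angle (smoothOpp S p)) p
  have h3 : ∀ q, ∑ p, (if visitTime (B.smoothTrace S) p < visitTime (B.smoothTrace S) q then
      D.angle (smoothOpp S q) p - D.angle (smoothOpp S q) (B.smoothTrace S p) else 0) =
      D.angle (smoothOpp S q) none - D.angle (smoothOpp S q) q :=
    fun q => sum_visitTime_lt hF (D.angle (smoothOpp S q)) q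
  rw [Finset.sum_congr rfl fun p _ => h2 p, Finset.sum_congr rfl fun q _ => h3 q,
    ← Finset.sum_add_distrib,
    ← Equiv.sum_comp (smoothOpp_involutive S).toPerm
      (fun p => 2 * D.angle p none - D.angle p (B.next p) - D.angle p p)]
  refine Finset.sum_congr rfl fun p _ => ?_
  rw [Function.Involutive.coe_toPerm, D.angle_smoothOpp S (smoothOpp S p) p, smoothTrace_apply]
  ring

/-- The same sum, evaluated crossing by crossing. The sign of a contribution is decided by which end
is visited first, just as the writhe of the layered diagram is. -/
theorem sum_corners {S : Finset α} (hF : B.Feasible S) :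
    ∑ p, ∑ q, (if visitTime (B.smoothTrace S) p < visitTime (B.smoothTrace S) q then
      (if Pt.opp (smoothOpp S p) = smoothOpp S q then D.corner (smoothOpp S p) else 0) +
      (if Pt.opp (B.next (smoothOpp S p)) = B.next (smoothOpp S q) then
        D.corner (B.next (smoothOpp S p)) else 0) +
      (if Pt.opp (B.next (smoothOpp S p)) = smoothOpp S q then
        D.cocorner (B.next (smoothOpp S p)) else 0) +
      (if Pt.opp (smoothOpp S p) = B.next (smoothOpp S q) then
        D.cocorner (smoothOpp S p) else 0) else 0) =
    B.layeredWrithe s S + ∑ a, D.kinks a := by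
  set σ := B.smoothTrace S with hσ
  have hop : ∀ p, smoothOpp S (smoothOpp S p) = p := smoothOpp_involutive S
  have hoo : ∀ p : Pt α, Pt.opp (Pt.opp p) = p := Pt.opp_involutive
  have e1 : ∀ p q, (if visitTime σ p < visitTime σ q then
      (if Pt.opp (smoothOpp S p) = smoothOpp S q then D.corner (smoothOpp S p) else 0) +
      (if Pt.opp (B.next (smoothOpp S p)) = B.next (smoothOpp S q) then
        D.corner (B.next (smoothOpp S p)) else 0) +
      (if Pt.opp (B.next (smoothOpp S p)) = smoothOpp S q then
        D.cocorner (B.next (smoothOpp S p)) else 0) +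
      (if Pt.opp (smoothOpp S p) = B.next (smoothOpp S q) then
        D.cocorner (smoothOpp S p) else 0) else 0) =
      (if Pt.opp p = q then (if visitTime σ p < visitTime σ q then
        D.corner (smoothOpp S p) else 0) else 0) +
      (if σ⁻¹ (Pt.opp (σ p)) = q then (if visitTime σ p < visitTime σ q then
        D.corner (σ p) else 0) else 0) +
      (if smoothOpp S (Pt.opp (σ p)) = q then (if visitTime σ p < visitTime σ q then
        D.cocorner (σ p) else 0) else 0) +
      (if σ⁻¹ (Pt.opp (smoothOpp S p)) = q then (if visitTime σ p < visitTime σ q then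
        D.cocorner (smoothOpp S p) else 0) else 0) := by
    intro p q
    have c1 : Pt.opp (smoothOpp S p) = smoothOpp S q ↔ Pt.opp p = q := by
      rw [← smoothOpp_opp, (smoothOpp_involutive S).injective.eq_iff]
    have c2 : Pt.opp (B.next (smoothOpp S p)) = B.next (smoothOpp S q) ↔
        σ⁻¹ (Pt.opp (σ p)) = q := by
      rw [Perm.inv_eq_iff_eq]; rfl
    have c3 : Pt.opp (B.next (smoothOpp S p)) = smoothOpp S q ↔
        smoothOpp S (Pt.opp (σ p)) = q := by
      rw [(smoothOpp_involutive S).eq_iff]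
      rfl
    have c4 : Pt.opp (smoothOpp S p) = B.next (smoothOpp S q) ↔
        σ⁻¹ (Pt.opp (smoothOpp S p)) = q := by
      rw [Perm.inv_eq_iff_eq]; rfl
    simp only [c1, c2, c3, c4]
    change _ = _ + (if _ then (if _ then D.corner (B.next (smoothOpp S p)) else 0) else 0) +
      (if _ then (if _ then D.cocorner (B.next (smoothOpp S p)) else 0) else 0) + _
    by_cases hlt : visitTime σ p < visitTime σ q <;> simp [hlt]
  simp only [e1, Finset.sum_add_distrib, Finset.sum_ite_eq, Finset.mem_univ, if_true]
  have r2 := Equiv.sum_comp σ fun r =>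
    if visitTime σ (σ⁻¹ r) < visitTime σ (σ⁻¹ (Pt.opp r)) then D.corner r else 0
  have r3 := Equiv.sum_comp σ fun r =>
    if visitTime σ (σ⁻¹ r) < visitTime σ (smoothOpp S (Pt.opp r)) then D.cocorner r else 0
  have hinv : ∀ p, σ⁻¹ (σ p) = p := σ.symm_apply_apply
  have hinv' : ∀ p, σ (σ⁻¹ p) = p := σ.apply_symm_apply
  simp only [hinv] at r2 r3
  rw [r2, r3]
  simp only [Fintype.sum_option, D.corner_none, D.cocorner_none, ite_self, zero_add,
    smoothOpp_none, Fintype.sum_prod_type, Fintype.sum_bool, opp_some, Bool.not_true,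
    Bool.not_false]
  have hW : (B.layeredWrithe s S : ℝ) = ∑ a, if a ∈ S then 0 else
      if visitTime σ (some (a, false)) < visitTime σ (some (a, true)) then ((s a : ℤ) : ℝ)
      else -((s a : ℤ) : ℝ) := by
    rw [layeredWrithe, show Sᶜ = Finset.univ.filter (fun a => a ∉ S) by ext; simp,
      Finset.sum_filter]
    push_cast
    refine Finset.sum_congr rfl fun a _ => ?_
    by_cases ha : a ∈ S
    · simp [ha]
    · simp only [ha, not_false_eq_true, if_true, if_false]
      have hv := visitsFirst_iff hF (show (some (a, false) : Pt α) ≠ some (a, true) from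
        end_ne a false)
      by_cases h : visitTime σ (some (a, false)) < visitTime σ (some (a, true))
      · rw [if_pos (hv.mpr h), if_pos h]
      · rw [if_neg (mt hv.mp h), if_neg h]
  rw [hW, ← Finset.sum_add_distrib, ← Finset.sum_add_distrib, ← Finset.sum_add_distrib,
    ← Finset.sum_add_distrib]
  refine Finset.sum_congr rfl fun a _ => ?_
  have htime : ∀ b, visitTime σ (some (a, b)) = visitTime σ (σ⁻¹ (some (a, b))) + 1 := fun b => by
    have := visitTime_apply hF (q := σ⁻¹ (some (a, b))) (by rw [← hσ, hinv']; simp)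
    rwa [← hσ, hinv'] at this
  have hprev : ∀ b c, visitTime σ (σ⁻¹ (some (a, b))) = visitTime σ (some (a, c)) ↔
      σ (some (a, c)) = some (a, b) := fun b c => by
    rw [(visitTime_injective hF).eq_iff, Perm.inv_eq_iff_eq, eq_comm]
  have hij : visitTime σ (some (a, false)) ≠ visitTime σ (some (a, true)) :=
    (visitTime_injective hF).ne (by simp)
  have h1 := htime false
  have h2 := htime true
  have h3 := hprev true false
  have h4 := hprev false true
  have h5 := hprev true true
  have h6 := hprev false false
  have hxy := D.corner_add_cocorner a
  rw [kinks, D.corner_true, D.cocorner_true]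
  by_cases ha : a ∈ S
  · simp only [smoothOpp_of_mem ha, opp_some, Bool.not_true, Bool.not_false, D.corner_true,
      D.cocorner_true]
    have k1 : σ (some (a, true)) = B.next (some (a, false)) := by
      rw [hσ, smoothTrace_apply, smoothOpp_of_mem ha]; rfl
    have k2 : σ (some (a, false)) = B.next (some (a, true)) := by
      rw [hσ, smoothTrace_apply, smoothOpp_of_mem ha]; rfl
    rw [k1] at h4 h5
    rw [k2] at h3 h6
    -- A kink at a smoothed crossing would split off as a closed curve of its own, which
    -- connectedness excludes. The corners of a smoothed crossing cancel.
    have n1 : ¬ B.next (some (a, false)) = some (a, true) := fun h => by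
      have := h5.mpr h; omega
    have n2 : ¬ B.next (some (a, true)) = some (a, false) := fun h => by
      have := h6.mpr h; omega
    rw [if_neg n1, if_neg n2, if_pos ha]
    rcases lt_or_gt_of_ne hij with h | h
    · rw [if_neg (by omega), if_pos (by omega), if_neg (by omega), if_pos (by omega),
        if_pos (by omega), if_pos (by omega), if_neg (by omega), if_neg (by omega)]
      ring
    · rw [if_pos (by omega), if_neg (by omega), if_pos (by omega), if_neg (by omega),
        if_pos (by omega), if_pos (by omega), if_neg (by omega), if_neg (by omega)]
      ring
  · simp only [smoothOpp_of_notMem ha, opp_some, Bool.not_true, Bool.not_false, D.corner_true,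
      D.cocorner_true]
    have k1 : σ (some (a, true)) = B.next (some (a, true)) := by
      rw [hσ, smoothTrace_apply, smoothOpp_of_notMem ha]
    have k2 : σ (some (a, false)) = B.next (some (a, false)) := by
      rw [hσ, smoothTrace_apply, smoothOpp_of_notMem ha]
    rw [k1] at h4
    rw [k2] at h3
    rw [if_neg ha]
    -- At an unsmoothed crossing the corner and the cocorner of the end visited first occur twice
    -- each, and together they give the writhe. At a kink one cocorner is missing, since an arc is
    -- not paired with itself; this is what `kinks` records.
    rcases lt_or_gt_of_ne hij with h | h
    · have n2 : ¬ B.next (some (a, true)) = some (a, false) := fun h' => by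
        have := h4.mpr h'; omega
      rw [if_neg (by omega), if_pos (by omega), if_neg (by omega), if_pos (by omega),
        if_neg n2, if_pos h, if_neg (by omega), if_pos (by omega), if_neg (by omega)]
      by_cases hn : B.next (some (a, false)) = some (a, true)
      · have := h3.mpr hn
        rw [if_pos hn, if_neg (by omega)]
        linarith
      · have : visitTime σ (σ⁻¹ (some (a, true))) ≠ visitTime σ (some (a, false)) :=
          fun h' => hn (h3.mp h')
        rw [if_neg hn, if_pos (by omega)]
        linarith
    · have n2 : ¬ B.next (some (a, false)) = some (a, true) := fun h' => by
        have := h3.mpr h'; omega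
      rw [if_pos (by omega), if_neg (by omega), if_pos (by omega), if_neg (by omega),
        if_neg n2, if_neg h.not_gt, if_pos (by omega), if_neg (by omega)]
      by_cases hn : B.next (some (a, true)) = some (a, false)
      · have := h4.mpr hn
        rw [if_pos hn, if_neg (by omega), if_neg (by omega)]
        linarith
      · have : visitTime σ (σ⁻¹ (some (a, false))) ≠ visitTime σ (some (a, true)) :=
          fun h' => hn (h4.mp h')
        rw [if_neg hn, if_pos (by omega), if_neg (by omega)]
        linarith

/-- The total writhe of the layered diagrams is the same for all connected smoothings. -/
theorem layeredWrithe_eq (D : B.PlanarAngles s) {S T : Finset α} (hS : B.Feasible S)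
    (hT : B.Feasible T) :
    B.layeredWrithe s S = B.layeredWrithe s T := by
  have key : ∀ U : Finset α, B.Feasible U → (B.layeredWrithe s U : ℝ) + ∑ a, D.kinks a =
      ∑ p, (2 * D.angle p none - D.angle p (B.next p) - D.angle p p) := by
    intro U hU
    rw [← D.sum_corners hU, ← D.sum_intersection hU]
    refine Finset.sum_congr rfl fun p _ => Finset.sum_congr rfl fun q _ => ?_
    rw [D.intersection]
  have := (key S hS).trans (key T hT).symm
  exact_mod_cast add_right_cancel this

end PlanarAngles
end BasedArrowDiagram
end GaussLink

/-! ### Winding numbers and the determinant of disconnected layered diagrams -/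

namespace GaussLink

open Equiv Matrix

namespace BasedArrowDiagram

variable {m : ℕ} {α : Type*} [Fintype α] [DecidableEq α]

namespace PlanarAngles

variable {B : BasedArrowDiagram m α} {s : α → ℤˣ} (D : B.PlanarAngles s)

/-- The angle under which the arcs, counted with the multiplicities `χ`, are seen. -/
noncomputable def totalAngle (χ : Pt α → ℝ) (q : Pt α) : ℝ := ∑ p, χ p * D.angle p q

theorem totalAngle_opp (χ : Pt α → ℝ) (q : Pt α) :
    D.totalAngle χ (Pt.opp q) = D.totalAngle χ q := by
  simp only [totalAngle, D.angle_opp]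

/-- The index of the arc that starts at `q` with respect to the arcs counted with the
multiplicities `χ`. -/
noncomputable def index (χ : Pt α → ℝ) (q : Pt α) : ℝ :=
  D.totalAngle χ q + χ (Pt.opp q) * D.corner (Pt.opp q) +
    χ (B.next⁻¹ (Pt.opp q)) * D.cocorner (Pt.opp q)

/-- The multiplicities `χ` define a cycle in the diagram. -/
def IsClosed (B : BasedArrowDiagram m α) (χ : Pt α → ℝ) : Prop :=
  ∀ F : Pt α → ℝ, (∀ p, F (Pt.opp p) = F p) → ∑ p, χ p * (F p - F (B.next p)) = 0

/-- The index, defined with the crossing where an arc starts, is expressed here by the crossing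
where it ends. In the sum of `intersection` over the cycle, the angles under which the fixed arc is
seen drop out because `χ` is closed. -/
theorem index_prev {χ : Pt α → ℝ} (hχ : IsClosed B χ) (e : Pt α) :
    D.index χ (B.next⁻¹ e) = D.totalAngle χ e -
      χ (B.next⁻¹ (Pt.opp e)) * D.corner (Pt.opp e) - χ (Pt.opp e) * D.cocorner (Pt.opp e) := by
  have hinv : ∀ p, B.next (B.next⁻¹ p) = p := B.next.apply_symm_apply
  have hoo : ∀ p : Pt α, Pt.opp (Pt.opp p) = p := Pt.opp_involutive
  have hopp : ∀ p q : Pt α, Pt.opp p = q ↔ p = Pt.opp q := fun p q => by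
    rw [← Pt.opp_involutive.eq_iff]
  have hnext : ∀ p q : Pt α, B.next p = q ↔ p = B.next⁻¹ q := fun p q =>
    (Perm.eq_inv_iff_eq (f := B.next)).symm
  have h := hχ (D.angle (B.next⁻¹ e)) (D.angle_opp _)
  have h2 : D.totalAngle χ e - D.totalAngle χ (B.next⁻¹ e) +
      ∑ p, χ p * (D.angle (B.next⁻¹ e) p - D.angle (B.next⁻¹ e) (B.next p)) =
      ∑ p, χ p * ((if Pt.opp p = B.next⁻¹ e then D.corner p else 0) +
      (if Pt.opp (B.next p) = e then D.corner (B.next p) else 0) +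
      (if Pt.opp (B.next p) = B.next⁻¹ e then D.cocorner (B.next p) else 0) +
      (if Pt.opp p = e then D.cocorner p else 0)) := by
    rw [totalAngle, totalAngle, ← Finset.sum_sub_distrib, ← Finset.sum_add_distrib]
    refine Finset.sum_congr rfl fun p _ => ?_
    have := D.intersection p (B.next⁻¹ e)
    rw [hinv] at this
    rw [← this]
    ring
  rw [h, add_zero] at h2
  simp only [hopp, hnext, mul_add, mul_ite, mul_zero, Finset.sum_add_distrib, Finset.sum_ite_eq',
    Finset.mem_univ, if_true, hinv] at h2
  rw [index]
  linarith

theorem isClosed_one : IsClosed B fun _ => 1 := fun F _ => by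
  simp only [one_mul, Finset.sum_sub_distrib]
  rw [Equiv.sum_comp B.next F, sub_self]

end PlanarAngles

theorem sum_arcRow_mul (B : BasedArrowDiagram m α) (e : α × Bool) (g : Pt α → ℝ) (hg : g none = 0) :
    ∑ f, B.arcRow e f * g (some f) = g (B.next⁻¹ (some e)) := by
  have hnext : ∀ p : Pt α, B.next p = some e ↔ p = B.next⁻¹ (some e) := fun p =>
    (Perm.eq_inv_iff_eq (f := B.next)).symm
  have : ∑ p : Pt α, (if B.next p = some e then (1 : ℝ) else 0) * g p = g (B.next⁻¹ (some e)) := by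
    simp only [hnext, ite_mul, one_mul, zero_mul, Finset.sum_ite_eq', Finset.mem_univ, if_true]
  rw [← this, Fintype.sum_option, hg, mul_zero, zero_add]
  rfl

theorem sum_crossingRow_mul (s : α → ℤˣ) (τ : ℝ) (ov : α → Bool) (S : Finset α) (a : α) (b : Bool)
    (g : α × Bool → ℝ) :
    ∑ f, crossingRow s τ ov S (a, b) f * g f =
      if a ∈ S then g (a, !b) else if b = ov a then g (a, b) else
        (τ ^ writhe s ov a) ^ 2 * g (a, b) + (1 - (τ ^ writhe s ov a) ^ 2) * g (a, !b) := by
  have hs : ∀ e : α × Bool, ∑ f, (Pi.single e 1 : α × Bool → ℝ) f * g f = g e := fun e => by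
    simp [Pi.single_apply]
  unfold crossingRow
  split_ifs
  · exact hs _
  · exact hs _
  · simp only [Pi.add_apply, Pi.smul_apply, smul_eq_mul, add_mul, mul_assoc,
      Finset.sum_add_distrib, ← Finset.mul_sum, hs]

open Classical in
/-- The multiplicities of the arcs of the component of the base point. -/
noncomputable def baseComponent (B : BasedArrowDiagram m α) (S : Finset α) (p : Pt α) : ℝ :=
  if (B.smoothTrace S).SameCycle none (smoothOpp S p) then 1 else 0

/-- The arc from `p` is traversed right after the visit to `smoothOpp S p`. With this substitution
the sum becomes a difference of two sums over the same passage, shifted by one step. -/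
theorem isClosed_baseComponent (B : BasedArrowDiagram m α) (S : Finset α) :
    PlanarAngles.IsClosed B (B.baseComponent S) := by
  intro F hF
  have hFS : ∀ p, F (smoothOpp S p) = F p := fun p => by
    rcases smoothOpp_eq_or S p with h | h
    · rw [h]
    · rw [h, hF]
  rw [← Equiv.sum_comp (smoothOpp_involutive S).toPerm]
  have h1 : ∀ p, B.baseComponent S (smoothOpp S p) *
      (F (smoothOpp S p) - F (B.next (smoothOpp S p))) =
      B.baseComponent S (smoothOpp S p) * F p -
      B.baseComponent S (smoothOpp S (B.smoothTrace S p)) * F (B.smoothTrace S p) := by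
    intro p
    rw [hFS, ← smoothTrace_apply, mul_sub]
    congr 2
    unfold baseComponent
    rw [smoothOpp_involutive S p, smoothOpp_involutive S (B.smoothTrace S p)]
    simp only [Perm.sameCycle_apply_right]
  simp only [Function.Involutive.coe_toPerm]
  rw [Finset.sum_congr rfl fun p _ => h1 p, Finset.sum_sub_distrib,
    Equiv.sum_comp (B.smoothTrace S) (fun p => B.baseComponent S (smoothOpp S p) * F p), sub_self]

/-- A kernel vector is given that vanishes exactly on the curve through the base point; it is not
zero because the diagram is disconnected. On the other curves it is a power of `τ` whose exponent is
-2 times the index with respect to the first curve. As the diagram is layered, the first curve runs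
above the others, and the factor in the row of an underpass below it compensates the jump of the
index. -/
theorem PlanarAngles.det_eq_zero {B : BasedArrowDiagram m α} {s : α → ℤˣ} (D : B.PlanarAngles s)
    {τ : ℝ} (hτ : 0 < τ) {ov : α → Bool} {S : Finset α} (hl : B.IsLayered ov S)
    (hF : ¬ B.Feasible S) : (B.alexanderMatrix s τ ov S).det = 0 := by
  classical
  set σ := B.smoothTrace S with hσ
  set χ := B.baseComponent S with hχ
  have hc : PlanarAngles.IsClosed B χ := B.isClosed_baseComponent S
  have hop : ∀ p, smoothOpp S (smoothOpp S p) = p := smoothOpp_involutive S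
  have hinv : ∀ p, σ (σ⁻¹ p) = p := σ.apply_symm_apply
  set v : Pt α → ℝ := fun p =>
    if σ.SameCycle none (smoothOpp S p) then 0 else τ ^ (-2 * D.index χ p) with hv
  have hv0 : v none = 0 := if_pos (Perm.SameCycle.refl _ _)
  have hsame : ∀ e, σ.SameCycle none (σ⁻¹ e) ↔ σ.SameCycle none e := fun e => by
    conv_rhs => rw [← hinv e]
    exact Perm.sameCycle_apply_right.symm
  have hprev : ∀ e, smoothOpp S (B.next⁻¹ e) = σ⁻¹ e := fun e => by
    rw [Perm.eq_inv_iff_eq, hσ, smoothTrace_apply, hop]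
    exact B.next.apply_symm_apply e
  have hχprev : ∀ e, χ (B.next⁻¹ e) = if σ.SameCycle none e then 1 else 0 := fun e => by
    rw [hχ, baseComponent, hprev, ← hσ]
    simp only [hsame]
  have hvprev : ∀ e, v (B.next⁻¹ e) =
      if σ.SameCycle none e then 0 else τ ^ (-2 * D.index χ (B.next⁻¹ e)) := fun e => by
    simp only [hv, hprev, hsame]
  rw [← Matrix.exists_mulVec_eq_zero_iff]
  refine ⟨fun f => v (some f), ?_, ?_⟩
  · intro h
    apply hF
    intro q
    by_contra hq
    rcases hq' : smoothOpp S q with _ | f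
    · have : q = none := by rw [← hop q, hq']; rfl
      exact hq (this ▸ Perm.SameCycle.refl _ _)
    · have h1 := congrFun h f
      have h2 : v (some f) = τ ^ (-2 * D.index χ (some f)) :=
        if_neg (by rw [← hq', hop]; exact hq)
      have h3 := Real.rpow_pos_of_pos hτ (-2 * D.index χ (some f))
      simp only [Pi.zero_apply] at h1
      linarith
  · funext e
    obtain ⟨a, b⟩ := e
    have hrow : (B.alexanderMatrix s τ ov S *ᵥ fun f => v (some f)) (a, b) =
        ∑ f, crossingRow s τ ov S (a, b) f * v (some f) -
          ∑ f, B.arcRow (a, b) f * v (some f) := by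
      rw [← Finset.sum_sub_distrib]
      refine Finset.sum_congr rfl fun f _ => ?_
      rw [← sub_mul]
      rfl
    rw [hrow, sum_arcRow_mul B _ v hv0, sum_crossingRow_mul s τ ov S a b fun f => v (some f),
      Pi.zero_apply, sub_eq_zero, hvprev]
    have hprev_index := D.index_prev hc (some (a, b))
    rw [opp_some, hχprev] at hprev_index
    by_cases ha : a ∈ S
    · rw [if_pos ha]
      have hve : v (some (a, !b)) =
          if σ.SameCycle none (some (a, b)) then 0 else τ ^ (-2 * D.index χ (some (a, !b))) := by
        simp only [hv, smoothOpp_of_mem ha, Bool.not_not]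
      rw [hve]
      by_cases hvis : σ.SameCycle none (some (a, b))
      · rw [if_pos hvis, if_pos hvis]
      · rw [if_neg hvis, if_neg hvis, hprev_index]
        have h1 : χ (some (a, !b)) = 0 := by
          rw [hχ, baseComponent, smoothOpp_of_mem ha, Bool.not_not]; exact if_neg hvis
        have h2 : χ (some (a, b)) = if σ.SameCycle none (some (a, !b)) then 1 else 0 := by
          rw [hχ, baseComponent, smoothOpp_of_mem ha]
        have h3 := D.totalAngle_opp χ (some (a, b))
        have h4 := D.corner_opp (some (a, b))
        rw [opp_some] at h3 h4
        rw [PlanarAngles.index, opp_some, Bool.not_not, h1, hχprev, if_neg hvis, h3, h2, h4]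
        congr 2
        ring
    · rw [if_neg ha]
      have hve : ∀ b, v (some (a, b)) =
          if σ.SameCycle none (some (a, b)) then 0 else τ ^ (-2 * D.index χ (some (a, b))) := by
        intro b
        simp only [hv, smoothOpp_of_notMem ha]
      have hχe : ∀ b, χ (some (a, b)) = if σ.SameCycle none (some (a, b)) then 1 else 0 := by
        intro b
        rw [hχ, baseComponent, smoothOpp_of_notMem ha]
      -- Otherwise the underpass would be visited and the overpass never, against layeredness.
      have hlay : σ.SameCycle none (some (a, !ov a)) → σ.SameCycle none (some (a, ov a)) := by
        intro h
        by_contra hno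
        obtain ⟨k, hk⟩ := h.exists_nat_pow_eq
        exact hl a ha ⟨k, hk, fun j _ hj => hno ⟨j, by rw [zpow_natCast]; exact hj⟩⟩
      have hidx : D.index χ (some (a, b)) = D.totalAngle χ (some (a, b)) +
          (if σ.SameCycle none (some (a, !b)) then 1 else 0) *
            (D.corner (some (a, !b)) + D.cocorner (some (a, !b))) := by
        rw [PlanarAngles.index, opp_some, hχprev, hχe]
        ring
      rw [hχe] at hprev_index
      by_cases hb : b = ov a
      · rw [if_pos hb, hve]
        by_cases hvis : σ.SameCycle none (some (a, b))
        · rw [if_pos hvis, if_pos hvis]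
        · have hno : ¬ σ.SameCycle none (some (a, !b)) := fun h => hvis (by
            rw [hb] at h ⊢; exact hlay h)
          rw [if_neg hvis, if_neg hvis, hprev_index, hidx, if_neg hno]
          congr 2
          ring
      · rw [if_neg hb, hve, hve]
        have hb' : b = !ov a := (by decide : ∀ x y : Bool, x ≠ y → x = !y) _ _ hb
        by_cases hvis : σ.SameCycle none (some (a, b))
        · have hvis' : σ.SameCycle none (some (a, !b)) := by
            rw [hb', Bool.not_not]; exact hlay (hb' ▸ hvis)
          rw [if_pos hvis, if_pos hvis, if_pos hvis']
          ring
        · rw [if_neg hvis, if_neg hvis, hprev_index, hidx]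
          by_cases hvis' : σ.SameCycle none (some (a, !b))
          · rw [if_pos hvis', if_pos hvis']
            have hw := D.corner_add_cocorner_over ov a
            have hbb : (!b) = ov a := by rw [hb', Bool.not_not]
            rw [hbb, one_mul, hw, mul_zero, add_zero, ← Real.rpow_intCast, ← Real.rpow_natCast,
              ← Real.rpow_mul hτ.le, ← Real.rpow_add hτ]
            congr 1
            push_cast
            linarith
          · have h3 := D.totalAngle_opp χ (some (a, b))
            rw [opp_some] at h3
            have hidx' : D.index χ (some (a, !b)) = D.totalAngle χ (some (a, b)) := by
              rw [PlanarAngles.index, opp_some, Bool.not_not, hχprev, hχe, if_neg hvis, h3]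
              ring
            rw [if_neg hvis', if_neg hvis', hidx', zero_mul, zero_mul, zero_mul, add_zero, sub_zero,
              sub_zero]
            ring

end BasedArrowDiagram
end GaussLink

/-! ### Adjugates and the change of the base point -/

namespace GaussLink

open Equiv Matrix

namespace BasedArrowDiagram

theorem rowPairDet_sum_right {ι κ : Type*} [Fintype ι] [DecidableEq ι] (M : Matrix ι ι ℝ)
    {i j : ι} (x : ι → ℝ) (K : Finset κ) (y : κ → ι → ℝ) :
    rowPairDet M i j x (∑ k ∈ K, y k) = ∑ k ∈ K, rowPairDet M i j x (y k) := by
  classical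
  induction K using Finset.induction_on with
  | empty =>
    simp only [Finset.sum_empty]
    have := rowPairDet_smul_right M (i := i) (j := j) x 0 0
    simpa using this
  | insert k K hk ih => rw [Finset.sum_insert hk, Finset.sum_insert hk, rowPairDet_add_right, ih]

/-- The adjugate of a matrix with the kernel vectors `1` on the right and `u` on the left. -/
theorem adjugate_mul_comm_of_kernel {ι : Type*} [Fintype ι] [DecidableEq ι] (M : Matrix ι ι ℝ)
    (h1 : M *ᵥ (fun _ => 1) = 0) (u : ι → ℝ) (hu : u ᵥ* M = 0) (g g' e e' : ι) :
    M.adjugate g e * u e' = M.adjugate g' e' * u e := by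
  -- A row `Pi.single g 1 - Pi.single g' 1` is orthogonal to the constant vector, so after this
  -- replacement the constant vector is still in the kernel.
  have hg : M.adjugate g e = M.adjugate g' e := by
    rw [← sub_eq_zero, adjugate_apply, adjugate_apply]
    have : (M.updateRow e (Pi.single g 1 - Pi.single g' 1)).det = 0 := by
      rw [← Matrix.exists_mulVec_eq_zero_iff]
      refine ⟨fun _ => 1, fun h => by simpa using congrFun h g, ?_⟩
      funext k
      by_cases hk : k = e
      · subst hk
        simp [mulVec, dotProduct]
      · have := congrFun h1 k
        simpa [mulVec, dotProduct, updateRow_ne hk] using this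
    rw [sub_eq_add_neg, det_updateRow_add, ← neg_one_smul ℝ, det_updateRow_smul] at this
    linarith
  rw [hg]
  by_cases hee : e = e'
  · rw [hee]
  have hW1 : M.adjugate g' e = rowPairDet M e e' (Pi.single g' 1) (M e') := by
    rw [adjugate_apply, rowPairDet]
    congr 1
    ext k l
    by_cases hk : k = e'
    · subst hk; rw [updateRow_self, updateRow_ne (Ne.symm hee)]
    · rw [updateRow_ne hk]
  have hW2 : M.adjugate g' e' = rowPairDet M e e' (M e) (Pi.single g' 1) := by
    rw [adjugate_apply, rowPairDet]
    congr 2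
    exact (updateRow_eq_self M e).symm
  have hsum : ∑ k, u k • M k = 0 := by
    rw [← hu]
    ext l
    simp [vecMul, dotProduct]
  -- The linear relation between the rows is put in place of row `e'`, with `Pi.single g' 1` in row
  -- `e`. Only the summands `e` and `e'` survive, and they give the two adjugate entries.
  have hz : ∑ k, u k * rowPairDet M e e' (Pi.single g' 1) (M k) = 0 := by
    simp only [← rowPairDet_smul_right]
    rw [← rowPairDet_sum_right, hsum]
    have := rowPairDet_smul_right M (i := e) (j := e') (Pi.single g' 1) 0 0
    simpa using this
  have hzero : ∀ k, k ≠ e → k ≠ e' → rowPairDet M e e' (Pi.single g' 1) (M k) = 0 := by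
    intro k hk hk'
    refine det_zero_of_row_eq hk' ?_
    rw [updateRow_ne hk', updateRow_ne hk, updateRow_self]
  have h2 : ∑ k, u k * rowPairDet M e e' (Pi.single g' 1) (M k) =
      u e * rowPairDet M e e' (Pi.single g' 1) (M e) +
      u e' * rowPairDet M e e' (Pi.single g' 1) (M e') := by
    refine Fintype.sum_eq_add e e' hee fun k hk => ?_
    rw [hzero k hk.1 hk.2, mul_zero]
  rw [hW1, hW2]
  rw [hz, rowPairDet_swap M hee (Pi.single g' 1) (M e)] at h2
  linarith

end BasedArrowDiagram

open BasedArrowDiagram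

section Basing

variable {m : ℕ} {α : Type*} [Fintype α] [DecidableEq α] {G : GaussDiagram m α}

/-- The Alexander matrix of a Gauss diagram without base point. -/
noncomputable def GaussDiagram.alexanderMatrix (G : GaussDiagram m α) (τ : ℝ) (ov : α → Bool) :
    Matrix (α × Bool) (α × Bool) ℝ :=
  fun e => crossingRow G.sign τ ov ∅ e - fun f => if G.next f = e then 1 else 0

theorem GaussDiagram.alexanderMatrix_mulVec_one (G : GaussDiagram m α) (τ : ℝ) (ov : α → Bool) :
    G.alexanderMatrix τ ov *ᵥ (fun _ => 1) = 0 := by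
  funext e
  obtain ⟨a, b⟩ := e
  have h1 := sum_crossingRow_mul G.sign τ ov ∅ a b fun _ => 1
  have h2 : ∑ f, (if G.next f = (a, b) then (1 : ℝ) else 0) = 1 := by
    have : ∀ f, G.next f = (a, b) ↔ f = G.next⁻¹ (a, b) := fun f =>
      (Perm.eq_inv_iff_eq (f := G.next)).symm
    simp only [this, Finset.sum_ite_eq', Finset.mem_univ, if_true]
  simp only [mul_one, Finset.notMem_empty, if_false] at h1
  simp only [mulVec, dotProduct, GaussDiagram.alexanderMatrix, Pi.sub_apply, mul_one,
    Finset.sum_sub_distrib, h1, h2, Pi.zero_apply]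
  split_ifs <;> ring

theorem next_of_some (G : GaussDiagram m α) {B : BasedGaussDiagram m α} (hB : B.IsBasingOf G)
    {f x : α × Bool} (h : B.next (some f) = some x) : G.next f = x := by
  have := Equiv.removeNone_some B.next ⟨x, h⟩
  rw [h, hB.2.1] at this
  exact Option.some_injective _ this

theorem next_of_none (G : GaussDiagram m α) {B : BasedGaussDiagram m α} (hB : B.IsBasingOf G)
    {f : α × Bool} (h : B.next (some f) = none) : some (G.next f) = B.next none := by
  have := Equiv.removeNone_none B.next h
  rwa [hB.2.1] at this

/-- The base point cuts the arc from `g` to `e`, which removes one entry from row `e`. The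
determinant is linear in this row, and the uncut matrix is singular. -/
theorem det_alexanderMatrix_eq_adjugate {B : BasedGaussDiagram m α} (hB : B.IsBasingOf G) (τ : ℝ)
    (ov : α → Bool) {g e : α × Bool} (hg : B.next (some g) = none) (he : B.next none = some e) :
    (B.toBasedArrowDiagram.alexanderMatrix G.sign τ ov ∅).det =
      (G.alexanderMatrix τ ov).adjugate g e := by
  have hrow : B.toBasedArrowDiagram.alexanderMatrix G.sign τ ov ∅ =
      (G.alexanderMatrix τ ov).updateRow e (G.alexanderMatrix τ ov e + Pi.single g 1) := by
    ext k f
    have harc : B.toBasedArrowDiagram.arcRow k f = (if G.next f = k then 1 else 0) -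
        if f = g ∧ k = e then 1 else 0 := by
      by_cases hf : f = g
      · subst hf
        have h1 : G.next f = e := Option.some_injective _ ((next_of_none G hB hg).trans he)
        rw [arcRow, if_neg (by rw [hg]; simp), h1]
        by_cases hk : k = e
        · simp [hk]
        · simp [hk, Ne.symm hk]
      · obtain ⟨x, hx⟩ : ∃ x, B.next (some f) = some x := by
          rcases h : B.next (some f) with _ | x
          · exact absurd (Option.some_injective _ (B.next.injective (h.trans hg.symm))) hf
          · exact ⟨x, rfl⟩
        simp [arcRow, hx, next_of_some G hB hx, hf]
    by_cases hk : k = e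
    · subst hk
      rw [updateRow_self]
      simp only [BasedArrowDiagram.alexanderMatrix, GaussDiagram.alexanderMatrix, Pi.sub_apply,
        Pi.add_apply, harc, Pi.single_apply, and_true]
      ring
    · rw [updateRow_ne hk]
      simp only [BasedArrowDiagram.alexanderMatrix, GaussDiagram.alexanderMatrix, Pi.sub_apply,
        harc, hk, and_false, if_false, sub_zero]
  have hdet : (G.alexanderMatrix τ ov).det = 0 := by
    rw [← Matrix.exists_mulVec_eq_zero_iff]
    exact ⟨fun _ => 1, fun h => by simpa using congrFun h g, G.alexanderMatrix_mulVec_one τ ov⟩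
  rw [hrow, det_updateRow_add, updateRow_eq_self, hdet, zero_add, adjugate_apply]

/-- The exponent is twice the index, with respect to the whole diagram, of the arc that arrives at
`e`. Along a strand the index jumps at a crossing by the writhe, up to sign, which balances the
weights of the column. -/
theorem vecMul_alexanderMatrix {B : BasedGaussDiagram m α} (hB : B.IsBasingOf G)
    (D : B.toBasedArrowDiagram.PlanarAngles G.sign) {τ : ℝ} (hτ : 0 < τ) (ov : α → Bool) :
    (fun e => τ ^ (2 * D.index (fun _ => 1) (B.next⁻¹ (some e)))) ᵥ* G.alexanderMatrix τ ov = 0 := by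
  set n := D.index fun _ => 1 with hn
  set θ := D.totalAngle fun _ => 1 with hθ
  have hin : ∀ e, n (B.next⁻¹ e) = θ e - D.corner (Pt.opp e) - D.cocorner (Pt.opp e) := fun e => by
    rw [hn, D.index_prev PlanarAngles.isClosed_one, one_mul, one_mul]
  have hout : ∀ e, n e = θ e + D.corner (Pt.opp e) + D.cocorner (Pt.opp e) := fun e => by
    rw [hn, PlanarAngles.index, one_mul, one_mul]
  -- The base point divides an arc into two marked arcs, but the index is the same on both.
  have hnext : ∀ f, n (B.next⁻¹ (some (G.next f))) = n (some f) := by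
    intro f
    rcases hf : B.next (some f) with _ | x
    · rw [next_of_none G hB hf]
      have h1 := hin none
      have h2 := hout none
      have h3 : B.next⁻¹ none = some f := by rw [Perm.inv_eq_iff_eq, hf]
      have h4 : B.next⁻¹ (B.next none) = none := B.next.symm_apply_apply none
      rw [h3, show Pt.opp (none : Pt α) = none from rfl, D.corner_none, D.cocorner_none] at h1
      rw [show Pt.opp (none : Pt α) = none from rfl, D.corner_none, D.cocorner_none] at h2
      rw [h4, h1, h2]
      ring
    · rw [next_of_some G hB hf, ← hf]
      congr 1
      exact B.next.symm_apply_apply _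
  funext f
  obtain ⟨a, b⟩ := f
  set u : α × Bool → ℝ := fun e => τ ^ (2 * n (B.next⁻¹ (some e))) with hu
  have h2 : ∑ e, u e * (if G.next (a, b) = e then (1 : ℝ) else 0) = τ ^ (2 * n (some (a, b))) := by
    simp only [mul_ite, mul_one, mul_zero, Finset.sum_ite_eq, Finset.mem_univ, if_true, hu, hnext]
  have h1 : ∑ e, u e * crossingRow G.sign τ ov ∅ e (a, b) =
      u (a, b) * crossingRow G.sign τ ov ∅ (a, b) (a, b) +
      u (a, !b) * crossingRow G.sign τ ov ∅ (a, !b) (a, b) := by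
    refine Fintype.sum_eq_add (a, b) (a, !b) (by simp) ?_
    rintro ⟨a', b'⟩ ⟨h, h'⟩
    have haa : a ≠ a' := by
      rintro rfl
      cases b <;> cases b' <;> simp_all
    have hx : ∀ c : Bool, ((a, b) : α × Bool) ≠ (a', c) := fun c h => haa (congrArg Prod.fst h)
    unfold crossingRow
    simp only [mul_eq_zero]
    right
    split_ifs <;> simp [hx]
  have hw := D.corner_add_cocorner_over ov a
  have hθ' : ∀ b, θ (some (a, !b)) = θ (some (a, b)) := fun b => by
    rw [hθ, ← opp_some, D.totalAngle_opp]
  have hc : ∀ b, D.corner (some (a, !b)) = -D.corner (some (a, b)) := fun b => by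
    rw [← opp_some, D.corner_opp]
  have hc' : ∀ b, D.cocorner (some (a, !b)) = -D.cocorner (some (a, b)) := fun b => by
    rw [← opp_some, D.cocorner_opp]
  have hpow : (τ ^ writhe G.sign ov a) ^ 2 = τ ^ (2 * (writhe G.sign ov a : ℝ)) := by
    rw [← Real.rpow_intCast, ← Real.rpow_natCast, ← Real.rpow_mul hτ.le]
    congr 1
    push_cast
    ring
  have hsplit : (fun e => τ ^ (2 * n (B.next⁻¹ (some e)))) ᵥ* G.alexanderMatrix τ ov =
      fun f => ∑ e, u e * crossingRow G.sign τ ov ∅ e f -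
        ∑ e, u e * (if G.next f = e then (1 : ℝ) else 0) := by
    funext f
    simp only [vecMul, dotProduct, GaussDiagram.alexanderMatrix, Pi.sub_apply, mul_sub,
      Finset.sum_sub_distrib, hu]
  rw [hsplit]
  simp only [Pi.zero_apply]
  rw [h1, h2, sub_eq_zero]
  simp only [hu, hin, hout, opp_some, Bool.not_not, hc, hc', hθ']
  by_cases hb : b = ov a
  · subst hb
    have hov : (!ov a) ≠ ov a := by cases ov a <;> simp
    simp only [crossingRow, Finset.notMem_empty, if_false, if_true, hov, Pi.add_apply,
      Pi.smul_apply, smul_eq_mul, Pi.single_eq_same, Bool.not_not, mul_one]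
    rw [hpow]
    set x := D.corner (some (a, ov a))
    set y := D.cocorner (some (a, ov a))
    set w : ℝ := 2 * (writhe G.sign ov a : ℝ) with hw'
    have e1 : τ ^ (2 * (θ (some (a, ov a)) - -x - -y)) =
        τ ^ (2 * (θ (some (a, ov a)) - x - y)) * τ ^ w := by
      rw [← Real.rpow_add hτ]
      congr 1
      linarith
    have e2 : 2 * (θ (some (a, ov a)) + -x + -y) = 2 * (θ (some (a, ov a)) - x - y) := by
      ring
    rw [e1, e2]
    simp
    ring
  · have hb' : b = !ov a := (by decide : ∀ x y : Bool, x ≠ y → x = !y) _ _ hb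
    subst hb'
    have hov : (!ov a) ≠ ov a := by cases ov a <;> simp
    simp only [crossingRow, Finset.notMem_empty, if_false, if_true, hov, Pi.add_apply,
      Pi.smul_apply, smul_eq_mul, Pi.single_eq_same, Bool.not_not, mul_one]
    simp
    rw [hpow, ← Real.rpow_add hτ]
    congr 1
    simp only [hc, hc']
    linarith

end Basing
end GaussLink

/-! ### Independence of the base point, given planar angles -/

namespace GaussLink

open Equiv Matrix BasedArrowDiagram

theorem exists_prev_none {m : ℕ} {α : Type*} {B : BasedGaussDiagram m α}
    (hB : B.next none ≠ none) :
    ∃ g e, B.next (some g) = none ∧ B.next none = some e := by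
  obtain ⟨e, he⟩ := Option.ne_none_iff_exists'.1 hB
  obtain ⟨q, hq⟩ := B.next.surjective none
  rcases q with _ | g
  · exact absurd hq hB
  · exact ⟨g, e, hq, he⟩

section

variable {m : ℕ} {α : Type*} [Fintype α] [DecidableEq α]

theorem stateWeight_neg (B : BasedArrowDiagram m α) (s : α → ℤˣ) (z : ℝ) (ov : α → Bool)
    (T : Finset α) :
    B.stateWeight s (-z) ov ∅ T = (-1) ^ T.card * B.stateWeight s z ov ∅ T := by
  unfold stateWeight
  split_ifs
  · rw [Finset.sdiff_empty, ← Finset.prod_const, ← Finset.prod_mul_distrib]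
    exact Finset.prod_congr rfl fun a _ => by ring
  · simp

/-- Only connected states contribute, and their numbers of arrows all have the same parity. -/
theorem stateSum_neg (B : BasedArrowDiagram m α) (s : α → ℤˣ) {δ : ℝ}
    (hδ : ∀ S, B.Feasible S → (-1 : ℝ) ^ S.card = δ) (z : ℝ) (ov : α → Bool) :
    B.stateSum s (-z) ov ∅ = δ * B.stateSum s z ov ∅ := by
  rw [stateSum, stateSum, Finset.mul_sum]
  refine Finset.sum_congr rfl fun T _ => ?_
  rw [stateWeight_neg]
  by_cases hT : B.Feasible T
  · rw [hδ T hT]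
  · simp [stateWeight, hT]

theorem BasedArrowDiagram.PlanarAngles.exists_det_eq {B : BasedArrowDiagram m α} {s : α → ℤˣ}
    (D : B.PlanarAngles s) (ov : α → Bool) :
    ∃ (δ : ℝ) (k : ℤ), (δ = 1 ∨ δ = -1) ∧
      (∀ z, B.stateSum s (-z) ov ∅ = δ * B.stateSum s z ov ∅) ∧
      ∀ τ : ℝ, 0 < τ →
        (B.alexanderMatrix s τ ov ∅).det = δ * τ ^ k * B.stateSum s (τ⁻¹ - τ) ov ∅ := by
  obtain ⟨δ, Q, h1, hδ, hQ⟩ : ∃ (δ : ℝ) (Q : ℤ), (δ = 1 ∨ δ = -1) ∧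
      (∀ S, B.Feasible S → (-1 : ℝ) ^ S.card = δ) ∧
      ∀ S, B.Feasible S → B.layeredWrithe s S = Q := by
    by_cases h : ∃ S, B.Feasible S
    · obtain ⟨S₀, hS₀⟩ := h
      refine ⟨(-1) ^ S₀.card, B.layeredWrithe s S₀, neg_one_pow_eq_or ℝ _, fun S hS => ?_,
        fun S hS => D.layeredWrithe_eq hS hS₀⟩
      have := congrArg (fun x : ℤˣ => ((x : ℤ) : ℝ)) (hS.neg_one_pow_card_eq hS₀)
      simpa using this
    -- Without connected smoothings the conditions on `δ` and `Q` are empty.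
    · exact ⟨1, 0, Or.inl rfl, fun S hS => absurd ⟨S, hS⟩ h, fun S hS => absurd ⟨S, hS⟩ h⟩
  exact ⟨δ, totalWrithe s ov ∅ + Q, h1, fun z => stateSum_neg B s hδ z ov, fun τ hτ =>
    det_alexanderMatrix_eq_stateSum B s hτ hδ hQ (fun _ _ hl hF => D.det_eq_zero hτ hl hF) ov ∅⟩

variable {G : GaussDiagram m α} {B B' : BasedGaussDiagram m α}

/-- Comparing adjugate entries gives `δ * t ^ r * N = δ' * N'` with one exponent `r` for all
positive `t`. At `t = τ⁻¹` the argument of the state sums changes sign, hence `N` and `N'` are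
multiplied by `δ` and `δ'`. Both relations together force `τ ^ r = 1` or that the state sums vanish.
-/
theorem stateSum_eq_of_isBasingOf (hB : B.IsBasingOf G) (hB' : B'.IsBasingOf G)
    (D : B.toBasedArrowDiagram.PlanarAngles G.sign)
    (D' : B'.toBasedArrowDiagram.PlanarAngles G.sign)
    (hn : B.next none ≠ none) (hn' : B'.next none ≠ none) (ov : α → Bool) {τ : ℝ} (hτ : 0 < τ) :
    B.toBasedArrowDiagram.stateSum G.sign (τ⁻¹ - τ) ov ∅ =
      B'.toBasedArrowDiagram.stateSum G.sign (τ⁻¹ - τ) ov ∅ := by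
  obtain ⟨g, e, hg, he⟩ := exists_prev_none hn
  obtain ⟨g', e', hg', he'⟩ := exists_prev_none hn'
  obtain ⟨δ, k, hδ, hneg, hdet⟩ := D.exists_det_eq ov
  obtain ⟨δ', k', hδ', hneg', hdet'⟩ := D'.exists_det_eq ov
  obtain ⟨r, hr⟩ : ∃ r : ℝ, ∀ t : ℝ, 0 < t →
      δ * t ^ r * B.toBasedArrowDiagram.stateSum G.sign (t⁻¹ - t) ov ∅ =
        δ' * B'.toBasedArrowDiagram.stateSum G.sign (t⁻¹ - t) ov ∅ := by
    refine ⟨k + 2 * D.index (fun _ => 1) (B.next⁻¹ (some e')) -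
      (k' + 2 * D.index (fun _ => 1) (B.next⁻¹ (some e))), fun t ht => ?_⟩
    have h := adjugate_mul_comm_of_kernel _ (G.alexanderMatrix_mulVec_one t ov) _
      (vecMul_alexanderMatrix hB D ht ov) g g' e e'
    rw [← det_alexanderMatrix_eq_adjugate hB t ov hg he,
      ← det_alexanderMatrix_eq_adjugate hB' t ov hg' he', hdet t ht, hdet' t ht] at h
    rw [Real.rpow_sub ht, Real.rpow_add ht, Real.rpow_add ht, Real.rpow_intCast,
      Real.rpow_intCast]
    have h1 := (Real.rpow_pos_of_pos ht
      (2 * D.index (fun _ => 1) (B.next⁻¹ (some e)))).ne'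
    have h2 := (zpow_pos ht k').ne'
    generalize B.toBasedArrowDiagram.stateSum G.sign (t⁻¹ - t) ov ∅ = N at h ⊢
    generalize B'.toBasedArrowDiagram.stateSum G.sign (t⁻¹ - t) ov ∅ = N' at h ⊢
    field_simp
    linear_combination h
  set N := B.toBasedArrowDiagram.stateSum G.sign (τ⁻¹ - τ) ov ∅ with hN
  set N' := B'.toBasedArrowDiagram.stateSum G.sign (τ⁻¹ - τ) ov ∅ with hN'
  have h1 := hr τ hτ
  have h2 := hr τ⁻¹ (inv_pos.2 hτ)
  rw [inv_inv, ← neg_sub, hneg, hneg', ← hN, ← hN', Real.inv_rpow hτ.le] at h2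
  rw [← hN, ← hN'] at h1
  have hX := Real.rpow_pos_of_pos hτ r
  set X := τ ^ r
  have hδ2 : δ * δ = 1 := by rcases hδ with rfl | rfl <;> norm_num
  have hδ2' : δ' * δ' = 1 := by rcases hδ' with rfl | rfl <;> norm_num
  have h3 : N = X * N' := by
    have : X⁻¹ * N = N' := by linear_combination h2 - X⁻¹ * N * hδ2 + N' * hδ2'
    rw [← this]
    field_simp
  have h4 : (δ * X * X - δ') * N' = 0 := by
    rw [h3] at h1
    linear_combination h1
  rcases mul_eq_zero.1 h4 with h | h
  · have : X = 1 := by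
      rcases hδ with rfl | rfl <;> rcases hδ' with rfl | rfl <;> nlinarith
    rw [h3, this, one_mul]
  · rw [h3, h, mul_zero]

/-- The positive root of `τ ^ 2 + z * τ = 1`. -/
theorem exists_inv_sub_eq (z : ℝ) : ∃ τ : ℝ, 0 < τ ∧ τ⁻¹ - τ = z := by
  have h0 : 0 < z ^ 2 + 4 := by positivity
  have hs := Real.sq_sqrt h0.le
  have hp := Real.sqrt_pos.2 h0
  have hlt : z < √(z ^ 2 + 4) := by
    rcases le_or_gt z 0 with h | h
    · linarith
    · exact Real.lt_sqrt_of_sq_lt (by linarith)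
  refine ⟨(√(z ^ 2 + 4) - z) / 2, by linarith, ?_⟩
  rw [sub_eq_iff_eq_add, inv_eq_iff_eq_inv, eq_comm, inv_eq_of_mul_eq_one_right]
  linear_combination hs / 4

/-- The value of the polynomial that counts the monotone states, as a sum over states. -/
theorem aeval_eq_stateSum (B : BasedArrowDiagram m α) (s : α → ℤˣ) (c : Bool) {P : Polynomial ℤ}
    (hP : ∀ n, P.coeff n = ∑ S : Finset α,
      open Classical in if S.card = n ∧ B.IsMonotoneState c S then ∏ a ∈ S, (s a : ℤ) else 0)
    (z : ℝ) :
    open Classical in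
    Polynomial.aeval z P = if Function.Surjective B.circle then
      B.stateSum s (if c then z else -z) (fun _ => !c) ∅ else 0 := by
  classical
  have hdeg : P.natDegree < Fintype.card α + 1 := by
    rw [Nat.lt_succ_iff, Polynomial.natDegree_le_iff_coeff_eq_zero]
    intro n hn
    rw [hP]
    refine Finset.sum_eq_zero fun S _ => if_neg fun h => ?_
    have := S.card_le_univ
    omega
  rw [Polynomial.aeval_eq_sum_range' hdeg]
  have h1 : ∀ S : Finset α, ∑ n ∈ Finset.range (Fintype.card α + 1),
      (if S.card = n ∧ B.IsMonotoneState c S then ∏ a ∈ S, (s a : ℤ) else 0) • z ^ n =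
      if B.IsMonotoneState c S then ∏ a ∈ S, (((s a : ℤ) : ℝ) * z) else 0 := by
    intro S
    rw [Finset.sum_eq_single S.card]
    · by_cases h : B.IsMonotoneState c S
      · simp [h, Finset.prod_mul_distrib]
      · simp [h]
    · intro n _ hn
      simp [hn.symm]
    · intro h
      have := S.card_le_univ
      simp at h
      omega
  simp only [hP, Finset.sum_smul]
  rw [Finset.sum_comm]
  simp only [h1]
  split_ifs with hs hc
  all_goals try (subst hc)
  · refine Finset.sum_congr rfl fun T _ => ?_
    simp [stateWeight, IsMonotoneState, hs, writhe]
  -- For descending states the heads are declared overpasses, so all writhes are `-(s a)`; the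
  -- argument `-z` restores the signs.
  · rw [Bool.not_eq_true] at hc
    subst hc
    refine Finset.sum_congr rfl fun T _ => ?_
    simp [stateWeight, IsMonotoneState, hs, writhe]
  · refine Finset.sum_eq_zero fun T _ => if_neg fun h => hs h.1

theorem not_feasible_of_next_none [Nonempty α] {B : BasedArrowDiagram m α}
    (h : B.next none = none) (S : Finset α) : ¬ B.Feasible S := by
  intro hF
  obtain ⟨a⟩ := ‹Nonempty α›
  have h1 : B.smoothTrace S none = none := by
    rw [smoothTrace_apply]
    exact h
  have h2 := (hF (some (a, false))).eq_of_left h1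
  simp at h2

theorem surjective_circle_iff (hB : B.IsBasingOf G) (hn : B.next none ≠ none) :
    Function.Surjective B.circle ↔ Function.Surjective G.circle := by
  obtain ⟨e, he⟩ := Option.ne_none_iff_exists'.1 hn
  have h : B.circle none = G.circle e := by
    rw [← hB.1, ← he, ← B.sameCycle_iff]
    exact Perm.sameCycle_apply_right.2 (Perm.SameCycle.refl _ _)
  constructor
  · intro hs i
    obtain ⟨_ | f, rfl⟩ := hs i
    · exact ⟨e, h.symm⟩
    · exact ⟨f, (hB.1 f).symm⟩
  · intro hs i
    obtain ⟨f, rfl⟩ := hs i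
    exact ⟨some f, hB.1 f⟩

theorem not_surjective_circle (hB : B.IsBasingOf G) (hn : B.next none = none) :
    ¬ Function.Surjective G.circle := by
  intro hs
  obtain ⟨e, he⟩ := hs (B.circle none)
  rw [← hB.1, ← B.sameCycle_iff] at he
  have := he.symm.eq_of_left hn
  simp at this

theorem nabla_eq_of_planarAngles (hB : B.IsBasingOf G) (hB' : B'.IsBasingOf G)
    (D : B.toBasedArrowDiagram.PlanarAngles G.sign)
    (D' : B'.toBasedArrowDiagram.PlanarAngles G.sign) (c : Bool) {P P' : Polynomial ℤ}
    (hP : ∀ n, P.coeff n = ∑ S : Finset α, open Classical in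
      if S.card = n ∧ B.IsMonotoneState c S then ∏ a ∈ S, (B.sign a : ℤ) else 0)
    (hP' : ∀ n, P'.coeff n = ∑ S : Finset α, open Classical in
      if S.card = n ∧ B'.IsMonotoneState c S then ∏ a ∈ S, (B'.sign a : ℤ) else 0) :
    P = P' := by
  classical
  have hinj : Function.Injective (algebraMap ℤ ℝ) := (algebraMap ℤ ℝ).injective_int
  refine Polynomial.map_injective _ hinj (Polynomial.funext fun z => ?_)
  rw [Polynomial.eval_map_algebraMap, Polynomial.eval_map_algebraMap,
    aeval_eq_stateSum _ _ c hP, aeval_eq_stateSum _ _ c hP', hB.2.2, hB'.2.2]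
  set x := if c then z else -z
  -- Without arrows the polynomial only tells whether there is a single circle, wherever the base
  -- point is.
  rcases isEmpty_or_nonempty α with hα | hα
  · have h1 : ∀ A : BasedArrowDiagram m α, A.stateSum G.sign x (fun _ => !c) ∅ = 1 := by
      intro A
      have : A.Feasible ∅ := by
        rintro (_ | ⟨a, -⟩)
        · exact Perm.SameCycle.refl _ _
        · exact isEmptyElim a
      rw [stateSum_of_isLayered _ _ _ fun a => isEmptyElim a, if_pos this]
    have h2 : ∀ A : BasedArrowDiagram m α,
        Function.Surjective A.circle ↔ Subsingleton (Fin m) := by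
      intro A
      refine ⟨fun h => h.subsingleton, fun h i => ⟨none, Subsingleton.elim _ _⟩⟩
    rw [h1, h1]
    simp only [h2]
  have h0 : ∀ A : BasedGaussDiagram m α, A.IsBasingOf G → A.next none = none →
      A.toBasedArrowDiagram.stateSum G.sign x (fun _ => !c) ∅ = 0 := fun A hA hn =>
    Finset.sum_eq_zero fun T _ => by simp [stateWeight, not_feasible_of_next_none hn T]
  -- A base point alone on its circle cuts no arc, so it has no adjugate entry. As there are arrows,
  -- no smoothing is connected for it; and for a base point on a circle with arrows the polynomial
  -- vanishes too, because the arrows miss a circle.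
  by_cases hn : B.next none = none
  · rw [h0 B hB hn, ite_self]
    by_cases hn' : B'.next none = none
    · rw [h0 B' hB' hn', ite_self]
    · rw [if_neg]
      rw [surjective_circle_iff hB' hn']
      exact not_surjective_circle hB hn
  by_cases hn' : B'.next none = none
  · rw [h0 B' hB' hn', ite_self, if_neg]
    rw [surjective_circle_iff hB hn]
    exact not_surjective_circle hB' hn'
  obtain ⟨τ, hτ, hx⟩ := exists_inv_sub_eq x
  rw [← hx, stateSum_eq_of_isBasingOf hB hB' D D' hn hn' _ hτ]
  simp only [surjective_circle_iff hB hn, surjective_circle_iff hB' hn']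

end
end GaussLink

/-! ### Combinatorial angles and intersection numbers of segments -/

namespace GaussLink

namespace Plane

/-- The sign of a vector of the plane with respect to the lexicographic order. -/
noncomputable def lexSign (U : ℝ × ℝ) : ℝ :=
  if 0 < U.2 ∨ U.2 = 0 ∧ 0 < U.1 then 1 else if U.2 < 0 ∨ U.2 = 0 ∧ U.1 < 0 then -1 else 0

/-- The determinant of two vectors of the plane. -/
def cross (U V : ℝ × ℝ) : ℝ := U.1 * V.2 - U.2 * V.1

/-- The combinatorial angle, in full turns, from `U` to `V`: half a turn if the shorter way from `U`
to `V` crosses the horizontal axis, and no turn otherwise. -/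
noncomputable def turn (U V : ℝ × ℝ) : ℝ :=
  (1 - lexSign U * lexSign V) * (SignType.sign (cross U V) : ℝ) / 4

theorem lexSign_eq_one_iff {U : ℝ × ℝ} : lexSign U = 1 ↔ 0 < U.2 ∨ U.2 = 0 ∧ 0 < U.1 := by
  unfold lexSign
  split_ifs with h h'
  · simp [h]
  · norm_num [h]
  · simp [h]

theorem lexSign_neg (U : ℝ × ℝ) : lexSign (-U) = -lexSign U := by
  unfold lexSign
  simp only [Prod.fst_neg, Prod.snd_neg, neg_eq_zero, Left.neg_pos_iff, Left.neg_neg_iff]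
  split_ifs <;> grind

theorem lexSign_smul {c : ℝ} (hc : 0 < c) (U : ℝ × ℝ) : lexSign (c • U) = lexSign U := by
  unfold lexSign
  simp [hc, hc.ne', mul_pos_iff_of_pos_left, mul_neg_iff, hc.not_gt]

theorem lexSign_eq_or {U : ℝ × ℝ} (hU : U ≠ 0) : lexSign U = 1 ∨ lexSign U = -1 := by
  unfold lexSign
  split_ifs with h h'
  · exact Or.inl rfl
  · exact Or.inr rfl
  · refine absurd ?_ hU
    push Not at h h'
    have h2 : U.2 = 0 := le_antisymm h.1 h'.1
    exact Prod.ext (le_antisymm (h.2 h2) (h'.2 h2)) h2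

theorem lexSign_add {U V : ℝ × ℝ} (hU : lexSign U = 1) (hV : lexSign V = 1) :
    lexSign (U + V) = 1 := by
  rw [lexSign_eq_one_iff] at *
  simp only [Prod.fst_add, Prod.snd_add]
  grind

theorem cross_swap (U V : ℝ × ℝ) : cross V U = -cross U V := by
  unfold cross; ring

theorem cross_neg_left (U V : ℝ × ℝ) : cross (-U) V = -cross U V := by
  simp only [cross, Prod.fst_neg, Prod.snd_neg]; ring

theorem cross_smul_smul (c d : ℝ) (U V : ℝ × ℝ) : cross (c • U) (d • V) = c * d * cross U V := by
  simp only [cross, Prod.smul_fst, Prod.smul_snd, smul_eq_mul]; ring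

theorem turn_swap (U V : ℝ × ℝ) : turn V U = -turn U V := by
  rw [turn, turn, cross_swap, Left.sign_neg, SignType.coe_neg]
  ring

theorem turn_neg_neg (U V : ℝ × ℝ) : turn (-U) (-V) = turn U V := by
  rw [turn, turn, lexSign_neg, lexSign_neg]
  have h : cross (-U) (-V) = cross U V := by
    simp only [cross, Prod.fst_neg, Prod.snd_neg]; ring
  rw [h, neg_mul_neg]

theorem turn_of_cross_eq_zero {U V : ℝ × ℝ} (h : cross U V = 0) : turn U V = 0 := by
  simp [turn, h]

theorem turn_zero_left (V : ℝ × ℝ) : turn 0 V = 0 := turn_of_cross_eq_zero (by simp [cross])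

theorem turn_zero_right (V : ℝ × ℝ) : turn V 0 = 0 := turn_of_cross_eq_zero (by simp [cross])

theorem turn_smul_smul {c d : ℝ} (hc : 0 < c) (hd : 0 < d) (U V : ℝ × ℝ) :
    turn (c • U) (d • V) = turn U V := by
  rw [turn, turn, lexSign_smul hc, lexSign_smul hd, cross_smul_smul, sign_mul,
    sign_pos (mul_pos hc hd), one_mul]

/-- The way from `-V` to `V` through `U` is half a turn, and its direction is that of `cross U V`.
-/
theorem turn_neg_add_turn (U V : ℝ × ℝ) :
    turn (-V) U + turn U V = (SignType.sign (cross U V) : ℝ) / 2 := by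
  rw [turn, turn, lexSign_neg, cross_neg_left, cross_swap, neg_neg]
  ring

/-- On an open half plane the angle is a coboundary. -/
theorem turn_eq_of_pos (a b : ℝ) {U V : ℝ × ℝ} (hU : 0 < a * U.1 + b * U.2)
    (hV : 0 < a * V.1 + b * V.2) :
    turn U V = (lexSign U - lexSign V) * lexSign (b, -a) / 4 := by
  have hU0 : U ≠ 0 := by rintro rfl; simp at hU
  have hV0 : V ≠ 0 := by rintro rfl; simp at hV
  have key : ∀ U V : ℝ × ℝ, 0 < a * U.1 + b * U.2 → 0 < a * V.1 + b * V.2 → lexSign U = 1 →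
      lexSign V = -1 → (SignType.sign (cross U V) : ℝ) = lexSign (b, -a) := by
    intro U V hU hV h1 h2
    -- The multiple `cross U V • (b, -a)` is a positive combination of `U` and `-V`, both
    -- lexicographically positive, so the sign of `cross U V` is that of `(b, -a)`.
    have h3 : lexSign (cross U V • ((b, -a) : ℝ × ℝ)) = 1 := by
      have : cross U V • ((b, -a) : ℝ × ℝ) =
          (a * V.1 + b * V.2) • U + (a * U.1 + b * U.2) • (-V) := by
        ext <;> simp [cross] <;> ring
      rw [this]
      refine lexSign_add ?_ ?_
      · rw [lexSign_smul hV, h1]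
      · rw [lexSign_smul hU, lexSign_neg, h2, neg_neg]
    rcases lt_trichotomy (cross U V) 0 with h | h | h
    · rw [← neg_neg (cross U V), neg_smul, lexSign_neg, lexSign_smul (neg_pos.2 h)] at h3
      rw [sign_neg h, SignType.coe_neg, SignType.coe_one]
      linarith
    · rw [h, zero_smul] at h3
      simp [lexSign] at h3
    · rw [lexSign_smul h] at h3
      rw [sign_pos h, h3, SignType.coe_one]
  rcases lexSign_eq_or hU0 with h1 | h1 <;> rcases lexSign_eq_or hV0 with h2 | h2
  · rw [turn, h1, h2]; ring
  · rw [turn, key U V hU hV h1 h2, h1, h2]; ring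
  · rw [← neg_neg (turn U V), ← turn_swap, turn, key V U hV hU h2 h1, h1, h2]; ring
  · rw [turn, h1, h2]; ring

theorem turn_add_turn (a b : ℝ) {U V W : ℝ × ℝ} (hU : 0 < a * U.1 + b * U.2)
    (hV : 0 < a * V.1 + b * V.2) (hW : 0 < a * W.1 + b * W.2) :
    turn U V + turn V W = turn U W := by
  rw [turn_eq_of_pos a b hU hV, turn_eq_of_pos a b hV hW, turn_eq_of_pos a b hU hW]
  ring

/-- The linear functional with value 1 on `U` and on `V` is positive on `U`, `U + V` and `V`. -/
theorem turn_add {U V : ℝ × ℝ} (h : cross U V ≠ 0) :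
    turn U (U + V) + turn (U + V) V = turn U V := by
  have hU : (V.2 - U.2) / cross U V * U.1 + (U.1 - V.1) / cross U V * U.2 = 1 := by
    field_simp
    rw [cross]
    ring
  have hV : (V.2 - U.2) / cross U V * V.1 + (U.1 - V.1) / cross U V * V.2 = 1 := by
    field_simp
    rw [cross]
    ring
  refine turn_add_turn ((V.2 - U.2) / cross U V) ((U.1 - V.1) / cross U V) ?_ ?_ ?_
  · rw [hU]; exact one_pos
  · simp only [Prod.fst_add, Prod.snd_add]
    linarith
  · rw [hV]; exact one_pos

/-- The intersection number of two segments, in terms of angles. -/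
noncomputable def segmentIntersection (P Q R S : ℝ × ℝ) : ℝ :=
  turn (P - S) (Q - S) - turn (P - R) (Q - R) + (turn (R - P) (S - P) - turn (R - Q) (S - Q))

/-- A line separates the segments, so all differences of their points lie in one open half plane.
There `turn` is a coboundary, and the four terms cancel. -/
theorem segmentIntersection_of_disjoint {P Q R S : ℝ × ℝ}
    (h : Disjoint (segment ℝ P Q) (segment ℝ R S)) : segmentIntersection P Q R S = 0 := by
  have hc : ∀ X Y : ℝ × ℝ, IsCompact (segment ℝ X Y) := fun X Y => by
    rw [← convexHull_pair]
    exact (Set.toFinite _).isCompact_convexHull ℝ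
  obtain ⟨f, u, v, h1, huv, h2⟩ := geometric_hahn_banach_compact_closed (convex_segment R S)
    (hc R S) (convex_segment P Q) (hc P Q).isClosed h.symm
  have hf : ∀ X : ℝ × ℝ, f X = f (1, 0) * X.1 + f (0, 1) * X.2 := by
    intro X
    have : X = X.1 • ((1, 0) : ℝ × ℝ) + X.2 • ((0, 1) : ℝ × ℝ) := by ext <;> simp
    conv_lhs => rw [this]
    simp only [map_add, map_smul, smul_eq_mul]
    ring
  have hpos : ∀ X ∈ segment ℝ P Q, ∀ Y ∈ segment ℝ R S,
      0 < f (1, 0) * (X - Y).1 + f (0, 1) * (X - Y).2 := by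
    intro X hX Y hY
    rw [← hf, map_sub]
    have := h1 Y hY
    have := h2 X hX
    linarith
  have hP := left_mem_segment ℝ P Q
  have hQ := right_mem_segment ℝ P Q
  have hR := left_mem_segment ℝ R S
  have hS := right_mem_segment ℝ R S
  rw [segmentIntersection, ← turn_neg_neg (R - P), ← turn_neg_neg (R - Q)]
  simp only [neg_sub]
  rw [turn_eq_of_pos _ _ (hpos P hP S hS) (hpos Q hQ S hS),
    turn_eq_of_pos _ _ (hpos P hP R hR) (hpos Q hQ R hR),
    turn_eq_of_pos _ _ (hpos P hP R hR) (hpos P hP S hS),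
    turn_eq_of_pos _ _ (hpos Q hQ R hR) (hpos Q hQ S hS)]
  ring

/-- The intersection number of two segments that lie on a common line, or meet transversally and at
most in their ends. -/
theorem segmentIntersection_eq {P Q R S : ℝ × ℝ} (hPQ : P ≠ Q) (hRS : R ≠ S)
    (h : (∃ X v : ℝ × ℝ, ∃ p q r s : ℝ,
        P = X + p • v ∧ Q = X + q • v ∧ R = X + r • v ∧ S = X + s • v) ∨
      ∀ X ∈ segment ℝ P Q, X ∈ segment ℝ R S →
        (X = P ∨ X = Q) ∧ (X = R ∨ X = S) ∧ cross (Q - P) (S - R) ≠ 0) :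
    segmentIntersection P Q R S =
      (if P = R then turn (-(S - R)) (Q - P) else 0) +
      (if Q = S then turn (-(S - R)) (Q - P) else 0) +
      (if Q = R then turn (Q - P) (S - R) else 0) +
      (if P = S then turn (Q - P) (S - R) else 0) := by
  rcases h with ⟨X, v, p, q, r, s, rfl, rfl, rfl, rfl⟩ | h
  · have h1 : ∀ a b : ℝ, turn (a • v) (b • v) = 0 := fun a b =>
      turn_of_cross_eq_zero (by rw [cross_smul_smul, cross]; ring)
    have h2 : ∀ a b : ℝ, X + a • v - (X + b • v) = (a - b) • v := fun a b => by
      rw [sub_smul]; abel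
    simp only [segmentIntersection, h2, ← neg_smul, h1, ite_self]
    norm_num
  · by_cases hd : Disjoint (segment ℝ P Q) (segment ℝ R S)
    · have hne : ∀ X ∈ segment ℝ P Q, ∀ Y ∈ segment ℝ R S, X ≠ Y := fun X hX Y hY hXY =>
        Set.disjoint_left.1 hd hX (hXY ▸ hY)
      have hP := left_mem_segment ℝ P Q
      have hQ := right_mem_segment ℝ P Q
      have hR := left_mem_segment ℝ R S
      have hS := right_mem_segment ℝ R S
      rw [segmentIntersection_of_disjoint hd, if_neg (hne P hP R hR), if_neg (hne Q hQ S hS),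
        if_neg (hne Q hQ R hR), if_neg (hne P hP S hS)]
      norm_num
    · obtain ⟨X, hX, hX'⟩ := Set.not_disjoint_iff.1 hd
      obtain ⟨h1, h2, h3⟩ := h X hX hX'
      set u := Q - P with hu
      set v := S - R with hv
      have hu0 : u ≠ 0 := sub_ne_zero.2 hPQ.symm
      have hv0 : v ≠ 0 := sub_ne_zero.2 hRS.symm
      have hQ : Q = P + u := by rw [hu]; abel
      have hS : S = R + v := by rw [hv]; abel
      -- Two triangle relations settle all four ways in which the segments can share an end: `u + v`
      -- lies between `u` and `v`, and `u - v` between `-v` and `u`.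
      have h4 := turn_add h3
      have h5 : turn (-v) (u - v) + turn (u - v) u = turn (-v) u := by
        have := @turn_add (-v) u (by rwa [cross_neg_left, cross_swap, neg_neg])
        rwa [neg_add_eq_sub] at this
      have huv : u ≠ v := by
        intro huv
        rw [huv] at h3
        exact h3 (by rw [cross]; ring)
      have huv' : u ≠ -v := by
        intro huv
        rw [huv, cross_neg_left] at h3
        exact h3 (by rw [cross]; ring)
      clear_value u v
      subst hQ hS
      rcases h1 with rfl | rfl <;> rcases h2 with h2 | h2
      · subst h2
        rw [if_pos rfl, if_neg (by simpa using huv), if_neg (by simpa using hu0),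
          if_neg (by simpa using hv0), segmentIntersection, ← turn_neg_neg (X - (X + u))]
        simp only [add_sub_add_left_eq_sub, sub_self, sub_add_cancel_left, add_sub_cancel_left,
          turn_zero_left, neg_neg, neg_sub]
        rw [turn_swap u (u - v)] at h5
        linarith
      · subst h2
        have e1 : R + v + u - R = u + v := by abel
        have e2 : R - (R + v + u) = -(u + v) := by abel
        have e3 : R + v - (R + v + u) = -u := by abel
        rw [if_neg (by simpa using hv0), if_neg (by simpa using hu0),
          if_neg (by rw [← sub_eq_zero, e1]; rwa [← eq_neg_iff_add_eq_zero]),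
          if_pos rfl, segmentIntersection, e1, e2, e3, turn_neg_neg]
        simp only [sub_self, add_sub_cancel_left, sub_add_cancel_left, turn_zero_left,
          turn_zero_right]
        rw [turn_swap (u + v) v, turn_swap u (u + v)]
        linarith
      · subst h2
        have e1 : P - (P + u + v) = -(u + v) := by abel
        have e2 : P + u - (P + u + v) = -v := by abel
        have e3 : P + u + v - P = u + v := by abel
        rw [if_neg (by simpa using hu0), if_neg (by simpa using hv0), if_pos rfl,
          if_neg (by rw [eq_comm, ← sub_eq_zero, e3]; rwa [← eq_neg_iff_add_eq_zero]),
          segmentIntersection, e1, e2, e3, turn_neg_neg]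
        simp only [sub_self, add_sub_cancel_left, turn_zero_left, turn_zero_right]
        linarith
      · have hR : R = P + u - v := by rw [h2]; abel
        subst hR
        have e1 : P - (P + u - v) = v - u := by abel
        have e2 : P + u - (P + u - v) = v := by abel
        have e3 : P + u - v - P = u - v := by abel
        have e4 : P + u - v - (P + u) = -v := by abel
        have e5 : P + u - v + v = P + u := by abel
        rw [e5, if_neg (by rw [← sub_eq_zero, e1]; exact sub_ne_zero.2 huv.symm), if_pos rfl,
          if_neg (by rw [← sub_eq_zero, e2]; exact hv0), if_neg (by simpa using hu0),
          segmentIntersection, e1, e2, e3, e4]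
        simp only [sub_self, add_sub_cancel_left, turn_zero_right]
        rw [← turn_neg_neg (v - u), neg_sub, turn_swap (-v) (u - v)]
        linarith

end Plane

end GaussLink

/-! ### Intersection numbers of polylines -/

namespace GaussLink

namespace Plane

/-- The angle under which the polyline `A 0, …, A n` is seen from `v`. -/
noncomputable def polylineTurn (A : ℕ → ℝ × ℝ) (n : ℕ) (v : ℝ × ℝ) : ℝ :=
  ∑ k ∈ Finset.range n, turn (A k - v) (A (k + 1) - v)

/-- In each half of the sum the viewpoint runs along one polyline, and the terms telescope to its
two ends. -/
theorem sum_segmentIntersection (A A' : ℕ → ℝ × ℝ) (n n' : ℕ) :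
    polylineTurn A n (A' n') - polylineTurn A n (A' 0) +
      (polylineTurn A' n' (A 0) - polylineTurn A' n' (A n)) =
    ∑ k ∈ Finset.range n, ∑ l ∈ Finset.range n',
      segmentIntersection (A k) (A (k + 1)) (A' l) (A' (l + 1)) := by
  simp only [segmentIntersection, Finset.sum_add_distrib]
  congr 1
  · rw [polylineTurn, polylineTurn, ← Finset.sum_sub_distrib]
    exact Finset.sum_congr rfl fun k _ =>
      (Finset.sum_range_sub (fun l => turn (A k - A' l) (A (k + 1) - A' l)) n').symm
  · rw [Finset.sum_comm, polylineTurn, polylineTurn, ← Finset.sum_sub_distrib]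
    exact Finset.sum_congr rfl fun l _ =>
      (Finset.sum_range_sub' (fun k => turn (A' l - A k) (A' (l + 1) - A k)) n).symm

theorem sum_range_sum_range_eq {n n' k₀ l₀ : ℕ} (hk₀ : k₀ < n) (hl₀ : l₀ < n') (f : ℕ → ℕ → ℝ)
    (h : ∀ k < n, ∀ l < n', f k l ≠ 0 → k = k₀ ∧ l = l₀) :
    ∑ k ∈ Finset.range n, ∑ l ∈ Finset.range n', f k l = f k₀ l₀ := by
  rw [Finset.sum_eq_single_of_mem k₀ (Finset.mem_range.2 hk₀),
    Finset.sum_eq_single_of_mem l₀ (Finset.mem_range.2 hl₀)]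
  · intro l hl hne
    by_contra hf
    exact hne (h k₀ hk₀ l (Finset.mem_range.1 hl) hf).2
  · intro k hk hne
    refine Finset.sum_eq_zero fun l hl => ?_
    by_contra hf
    exact hne (h k (Finset.mem_range.1 hk) l (Finset.mem_range.1 hl) hf).1

/-- The intersection number of two polylines that meet at most in their ends. -/
theorem polyline_intersection (A A' : ℕ → ℝ × ℝ) (r r' : ℕ)
    (hA : ∀ k ≤ r, A k ≠ A (k + 1)) (hA' : ∀ l ≤ r', A' l ≠ A' (l + 1))
    (hseg : ∀ k ≤ r, ∀ l ≤ r',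
      (∃ X v : ℝ × ℝ, ∃ p q r s : ℝ,
        A k = X + p • v ∧ A (k + 1) = X + q • v ∧ A' l = X + r • v ∧ A' (l + 1) = X + s • v) ∨
      ∀ X ∈ segment ℝ (A k) (A (k + 1)), X ∈ segment ℝ (A' l) (A' (l + 1)) →
        (X = A k ∨ X = A (k + 1)) ∧ (X = A' l ∨ X = A' (l + 1)) ∧
          cross (A (k + 1) - A k) (A' (l + 1) - A' l) ≠ 0)
    (hends : ∀ k ≤ r + 1, ∀ l ≤ r' + 1, A k = A' l → (k = 0 ∨ k = r + 1) ∧ (l = 0 ∨ l = r' + 1)) :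
    polylineTurn A (r + 1) (A' (r' + 1)) - polylineTurn A (r + 1) (A' 0) +
      (polylineTurn A' (r' + 1) (A 0) - polylineTurn A' (r' + 1) (A (r + 1))) =
    (if A 0 = A' 0 then turn (-(A' 1 - A' 0)) (A 1 - A 0) else 0) +
    (if A (r + 1) = A' (r' + 1) then turn (-(A' (r' + 1) - A' r')) (A (r + 1) - A r) else 0) +
    (if A (r + 1) = A' 0 then turn (A (r + 1) - A r) (A' 1 - A' 0) else 0) +
    (if A 0 = A' (r' + 1) then turn (A 1 - A 0) (A' (r' + 1) - A' r') else 0) := by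
  rw [sum_segmentIntersection]
  have h1 : ∀ k ∈ Finset.range (r + 1), ∀ l ∈ Finset.range (r' + 1),
      segmentIntersection (A k) (A (k + 1)) (A' l) (A' (l + 1)) = _ := fun k hk l hl =>
    segmentIntersection_eq (hA k (Nat.lt_succ_iff.1 (Finset.mem_range.1 hk)))
      (hA' l (Nat.lt_succ_iff.1 (Finset.mem_range.1 hl)))
      (hseg k (Nat.lt_succ_iff.1 (Finset.mem_range.1 hk)) l
        (Nat.lt_succ_iff.1 (Finset.mem_range.1 hl)))
  rw [Finset.sum_congr rfl fun k hk => Finset.sum_congr rfl (h1 k hk)]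
  simp only [Finset.sum_add_distrib]
  congr 1
  · congr 1
    · congr 1
      · refine sum_range_sum_range_eq (Nat.succ_pos r) (Nat.succ_pos r') _ fun k hk l hl hf => ?_
        have := hends k (by omega) l (by omega) (by by_contra h; exact hf (if_neg h))
        omega
      · refine sum_range_sum_range_eq (Nat.lt_succ_self r) (Nat.lt_succ_self r') _
          fun k hk l hl hf => ?_
        have := hends (k + 1) (by omega) (l + 1) (by omega) (by by_contra h; exact hf (if_neg h))
        omega
    · refine sum_range_sum_range_eq (Nat.lt_succ_self r) (Nat.succ_pos r') _ fun k hk l hl hf => ?_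
      have := hends (k + 1) (by omega) l (by omega) (by by_contra h; exact hf (if_neg h))
      omega
  · refine sum_range_sum_range_eq (Nat.succ_pos r) (Nat.lt_succ_self r') _ fun k hk l hl hf => ?_
    have := hends k (by omega) (l + 1) (by omega) (by by_contra h; exact hf (if_neg h))
    omega

end Plane

end GaussLink

/-! ### Periodic parametrization of polygons and subdivision into edges -/

namespace GaussLink

open Plane

namespace PolygonalCurves

variable {m : ℕ} (D : PolygonalCurves m)

theorem period_pos' (i : Fin m) : (0 : ℝ) < D.period i := Nat.cast_pos.2 (D.period_pos i)

/-- The parameter of the point of the `i`-th circle with time `t`, up to the period. -/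
noncomputable def param (i : Fin m) (t : ℝ) : D.Param :=
  ⟨(i, toIcoMod (D.period_pos' i) 0 t), by
    have := toIcoMod_mem_Ico' (D.period_pos' i) t
    exact ⟨this.1, this.2⟩⟩

/-- The periodic parametrization of the `i`-th polygon. -/
noncomputable def lift (i : Fin m) (t : ℝ) : ℝ × ℝ :=
  AffineMap.lineMap (D.vertex i ⌊t⌋) (D.vertex i (⌊t⌋ + 1)) (Int.fract t)

/-- The direction of an edge. -/
def edge (i : Fin m) (k : ℤ) : ℝ × ℝ := D.vertex i (k + 1) - D.vertex i k

theorem param_eq_iff {i j : Fin m} {t t' : ℝ} :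
    D.param i t = D.param j t' ↔ i = j ∧ ∃ z : ℤ, t' = t + z * D.period i := by
  have h : D.param i t = D.param j t' ↔
      (i, toIcoMod (D.period_pos' i) 0 t) = (j, toIcoMod (D.period_pos' j) 0 t') := Subtype.ext_iff
  rw [h, Prod.mk.injEq]
  refine and_congr_right fun hij => ?_
  subst hij
  rw [toIcoMod_eq_toIcoMod]
  exact exists_congr fun z => by rw [zsmul_eq_mul, sub_eq_iff_eq_add']

theorem vertex_add_mul (i : Fin m) (k z : ℤ) :
    D.vertex i (k + z * D.period i) = D.vertex i k := by
  induction z using Int.induction_on with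
  | zero => simp
  | succ z ih => rw [add_mul, one_mul, ← add_assoc, D.vertex_periodic, ih]
  | pred z ih => rw [← ih, ← D.vertex_periodic]; congr 1; ring

theorem exists_time_param (i : Fin m) (t : ℝ) :
    ∃ z : ℤ, (D.param i t).time = t + ((z * D.period i : ℤ) : ℝ) := by
  refine ⟨-toIcoDiv (D.period_pos' i) 0 t, ?_⟩
  change toIcoMod (D.period_pos' i) 0 t = _
  rw [toIcoMod, zsmul_eq_mul]
  push_cast
  ring

theorem fract_param (i : Fin m) (t : ℝ) : Int.fract (D.param i t).time = Int.fract t := by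
  obtain ⟨z, hz⟩ := D.exists_time_param i t
  rw [hz, Int.fract_add_intCast]

theorem point_param (i : Fin m) (t : ℝ) : D.point (D.param i t) = D.lift i t := by
  obtain ⟨z, hz⟩ := D.exists_time_param i t
  have hi : (D.param i t).circle = i := rfl
  rw [point, D.fract_param, lift, hz, Int.floor_add_intCast, hi, D.vertex_add_mul,
    add_right_comm, D.vertex_add_mul]

theorem direction_param (i : Fin m) (t : ℝ) : D.direction (D.param i t) = D.edge i ⌊t⌋ := by
  obtain ⟨z, hz⟩ := D.exists_time_param i t
  have hi : (D.param i t).circle = i := rfl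
  rw [direction, edge, hz, Int.floor_add_intCast, hi, D.vertex_add_mul,
    add_right_comm, D.vertex_add_mul]

theorem param_circle_time (x : D.Param) : D.param x.circle x.time = x := by
  refine Subtype.ext (Prod.ext rfl ?_)
  change toIcoMod _ 0 x.time = x.time
  rw [toIcoMod_eq_self]
  exact ⟨x.2.1, by rw [zero_add]; exact x.2.2⟩

theorem param_add_congr {i j : Fin m} {t t' : ℝ} (h : D.param i t = D.param j t') (s : ℝ) :
    D.param i (t + s) = D.param j (t' + s) := by
  rw [param_eq_iff] at *
  obtain ⟨hij, z, hz⟩ := h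
  exact ⟨hij, z, by rw [hz]; ring⟩

/-- The right end is included although the floor there already belongs to the next edge; pieces of
arcs that end at a vertex need this. -/
theorem lift_eq {i : Fin m} {k : ℤ} {t : ℝ} (h₁ : (k : ℝ) ≤ t) (h₂ : t ≤ k + 1) :
    D.lift i t = D.vertex i k + (t - k) • D.edge i k := by
  rcases h₂.lt_or_eq with h | h
  · have hk : ⌊t⌋ = k := Int.floor_eq_iff.2 ⟨h₁, h⟩
    rw [lift, edge, AffineMap.lineMap_apply, hk, Int.fract, hk, vsub_eq_sub, vadd_eq_add, add_comm]
  · have hk : ⌊t⌋ = k + 1 := by rw [h]; exact_mod_cast Int.floor_intCast (k + 1)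
    have hf : Int.fract t = 0 := by rw [Int.fract, hk, h]; push_cast; ring
    rw [lift, hk, hf, AffineMap.lineMap_apply_zero, edge, h]
    simp

theorem lift_sub_lift {i : Fin m} {k : ℤ} {t t' : ℝ} (h₁ : (k : ℝ) ≤ t) (h₂ : t ≤ k + 1)
    (h₁' : (k : ℝ) ≤ t') (h₂' : t' ≤ k + 1) :
    D.lift i t' - D.lift i t = (t' - t) • D.edge i k := by
  rw [D.lift_eq h₁ h₂, D.lift_eq h₁' h₂', add_sub_add_left_eq_sub, ← sub_smul]
  congr 1
  ring

theorem exists_lift_eq {i : Fin m} {k : ℤ} {t t' : ℝ} (h₁ : (k : ℝ) ≤ t) (h : t ≤ t')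
    (h₂' : t' ≤ k + 1) {X : ℝ × ℝ} (hX : X ∈ segment ℝ (D.lift i t) (D.lift i t')) :
    ∃ s, t ≤ s ∧ s ≤ t' ∧ D.lift i s = X := by
  rw [segment_eq_image_lineMap] at hX
  obtain ⟨c, ⟨hc0, hc1⟩, rfl⟩ := hX
  have h1 : t ≤ t + c * (t' - t) := by nlinarith
  have h2 : t + c * (t' - t) ≤ t' := by nlinarith
  refine ⟨t + c * (t' - t), h1, h2, ?_⟩
  rw [AffineMap.lineMap_apply, vsub_eq_sub, vadd_eq_add,
    D.lift_sub_lift h₁ (h.trans h₂') (h₁.trans h) h₂', ← sub_eq_iff_eq_add,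
    D.lift_sub_lift h₁ (h.trans h₂') (h₁.trans h1) (h2.trans h₂'), smul_smul]
  congr 1
  ring

end PolygonalCurves

/-- A degenerate edge would make a vertex coincide with the midpoint of the edge, but double points
are not at vertices. -/
theorem LinkDiagram.edge_ne_zero {m : ℕ} (L : LinkDiagram m) (i : Fin m) (k : ℤ) :
    L.edge i k ≠ 0 := by
  intro h
  have hne : L.param i k ≠ L.param i (k + 1 / 2) := by
    rw [Ne, L.param_eq_iff]
    rintro ⟨-, z, hz⟩
    have h1 : (1 : ℝ) = ((2 * (z * L.period i) : ℤ) : ℝ) := by push_cast; linarith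
    have h2 : (1 : ℤ) = 2 * (z * L.period i) := by exact_mod_cast h1
    omega
  refine (L.transversal _ _ hne ?_).1 ?_
  · rw [L.point_param, L.point_param, L.lift_eq (k := k) (by linarith) (by linarith),
      L.lift_eq (k := k) (by linarith) (by linarith), h, smul_zero, smul_zero]
  · rw [L.fract_param, Int.fract_intCast]

/-! ### Subdivision of an interval at the integers -/

section Breaks

variable {a b : ℝ}

/-- The number of integers between `a` and `b`. -/
noncomputable def breakCount (a b : ℝ) : ℕ := (⌊b⌋ - ⌊a⌋).toNat

/-- The points `a`, the integers between `a` and `b`, and `b`. -/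
noncomputable def breakTime (a b : ℝ) (j : ℕ) : ℝ := max a (min b (⌊a⌋ + j))

theorem floor_add_breakCount (hab : a ≤ b) : ⌊a⌋ + breakCount a b = ⌊b⌋ := by
  have := Int.floor_mono hab
  rw [breakCount]
  omega

theorem breakTime_zero (hab : a ≤ b) : breakTime a b 0 = a := by
  have := Int.floor_le a
  rw [breakTime, Nat.cast_zero, add_zero, min_eq_right (this.trans hab), max_eq_left this]

theorem breakTime_last (hab : a ≤ b) : breakTime a b (breakCount a b + 1) = b := by
  have h1 : ((⌊a⌋ : ℝ) + (breakCount a b + 1 : ℕ)) = ⌊b⌋ + 1 := by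
    rw [← floor_add_breakCount hab]; push_cast; ring
  have h2 := Int.lt_floor_add_one b
  rw [breakTime, h1, min_eq_left h2.le, max_eq_right hab]

theorem le_breakTime (j : ℕ) : a ≤ breakTime a b j := le_max_left _ _

theorem breakTime_le (hab : a ≤ b) (j : ℕ) : breakTime a b j ≤ b := max_le hab (min_le_left _ _)

theorem le_breakTime_of_le (hab : a ≤ b) {j : ℕ} (hj : j ≤ breakCount a b) :
    ((⌊a⌋ + j : ℤ) : ℝ) ≤ breakTime a b j := by
  have h1 : ((⌊a⌋ + j : ℤ) : ℝ) ≤ ⌊b⌋ := by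
    rw [← floor_add_breakCount hab]
    push_cast
    have : (j : ℝ) ≤ breakCount a b := Nat.cast_le.2 hj
    linarith
  have h2 := Int.floor_le b
  refine le_max_of_le_right (le_min (h1.trans h2) ?_)
  push_cast
  exact le_rfl

theorem breakTime_succ_le (j : ℕ) : breakTime a b (j + 1) ≤ ((⌊a⌋ + j : ℤ) : ℝ) + 1 := by
  have h1 := (Int.lt_floor_add_one a).le
  have h2 : (0 : ℝ) ≤ j := Nat.cast_nonneg j
  refine max_le (by push_cast; linarith) (min_le_of_right_le ?_)
  push_cast
  linarith

/-- If `b` were an integer, the last two break times would both be `b`. This is one reason to keep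
the marked points away from the vertices. -/
theorem breakTime_lt_succ (hab : a < b) (hb : Int.fract b ≠ 0) {j : ℕ} (hj : j ≤ breakCount a b) :
    breakTime a b j < breakTime a b (j + 1) := by
  have hb' : (⌊b⌋ : ℝ) < b := by
    have := (Int.fract_nonneg b).lt_of_ne' hb
    rw [Int.fract] at this
    linarith
  have h1 : (⌊a⌋ : ℝ) + j ≤ ⌊b⌋ := by
    rw [← floor_add_breakCount hab.le]
    push_cast
    have : (j : ℝ) ≤ breakCount a b := Nat.cast_le.2 hj
    linarith
  have h2 := Int.lt_floor_add_one a
  have h3 : (0 : ℝ) ≤ j := Nat.cast_nonneg j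
  refine max_lt (lt_max_of_lt_right (lt_min hab (by push_cast; linarith))) ?_
  refine lt_max_of_lt_right (lt_of_le_of_lt (min_le_right _ _) (lt_min (by linarith) ?_))
  push_cast
  linarith

theorem breakTime_eq_left_iff (hab : a < b) (hb : Int.fract b ≠ 0) {j : ℕ}
    (hj : j ≤ breakCount a b + 1) (h : breakTime a b j = a) : j = 0 := by
  rcases j with _ | j
  · rfl
  · have := breakTime_lt_succ hab hb (Nat.le_of_succ_le_succ hj)
    have := le_breakTime (a := a) (b := b) j
    linarith

theorem breakTime_eq_right_iff (hab : a < b) (hb : Int.fract b ≠ 0) {j : ℕ}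
    (hj : j ≤ breakCount a b + 1) (h : breakTime a b j = b) : j = breakCount a b + 1 := by
  by_contra hne
  have := breakTime_lt_succ hab hb (show j ≤ breakCount a b by omega)
  have := breakTime_le hab.le (j + 1)
  linarith

theorem floor_eq_of_le_of_le {k : ℤ} {t : ℝ} (h₁ : (k : ℝ) ≤ t) (h₂ : t ≤ k + 1)
    (ht : Int.fract t ≠ 0) : ⌊t⌋ = k := by
  refine Int.floor_eq_iff.2 ⟨h₁, h₂.lt_of_ne fun h => ht ?_⟩
  rw [h]
  simp

end Breaks

end GaussLink

/-! ### Planar angles of a link diagram with marked points -/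

namespace GaussLink

open Plane BasedArrowDiagram

/-- A placement of the marked points of a based diagram on the polygons of a link diagram. -/
structure Placement {m : ℕ} {α : Type*} (L : LinkDiagram m) (B : BasedArrowDiagram m α)
    (s : α → ℤˣ) where
  /-- the position of a marked point on its circle -/
  time : Pt α → ℝ
  /-- the length of the arc from a marked point to the next one -/
  len : Pt α → ℝ
  injective : ∀ p q, L.param (B.circle p) (time p) = L.param (B.circle q) (time q) → p = q
  len_pos : ∀ p, 0 < len p
  param_add_len : ∀ p,
    L.param (B.circle p) (time p + len p) = L.param (B.circle (B.next p)) (time (B.next p))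
  param_ne : ∀ p t, 0 < t → t < len p → ∀ q,
    L.param (B.circle p) (time p + t) ≠ L.param (B.circle q) (time q)
  fract_time : ∀ p, Int.fract (time p) ≠ 0
  crossing : ∀ x y : L.Param, x ≠ y → L.point x = L.point y → ∃ p,
    x = L.param (B.circle p) (time p) ∧
      y = L.param (B.circle (Pt.opp p)) (time (Pt.opp p))
  lift_opp : ∀ p,
    L.lift (B.circle (Pt.opp p)) (time (Pt.opp p)) = L.lift (B.circle p) (time p)
  sign : ∀ a, 0 < ((s a : ℤ) : ℝ) *
    L.det (L.param (B.circle (some (a, false))) (time (some (a, false))))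
      (L.param (B.circle (some (a, true))) (time (some (a, true))))

namespace Placement

variable {m : ℕ} {α : Type*} {L : LinkDiagram m} {B : BasedArrowDiagram m α} {s : α → ℤˣ}
  (D : Placement L B s)

/-- The image of a marked point in the plane. -/
noncomputable def point (p : Pt α) : ℝ × ℝ := L.lift (B.circle p) (D.time p)

/-- The direction of the curve at a marked point. -/
noncomputable def dir (p : Pt α) : ℝ × ℝ := L.edge (B.circle p) ⌊D.time p⌋

/-- The vertices of the arc that starts at a marked point. -/
noncomputable def vertices (p : Pt α) (k : ℕ) : ℝ × ℝ :=
  L.lift (B.circle p) (breakTime (D.time p) (D.time p + D.len p) k)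

/-- The number of inner vertices of the arc that starts at a marked point. -/
noncomputable def count (p : Pt α) : ℕ := breakCount (D.time p) (D.time p + D.len p)

theorem lt_end (p : Pt α) : D.time p < D.time p + D.len p := by
  have := D.len_pos p
  linarith

theorem fract_end (p : Pt α) : Int.fract (D.time p + D.len p) ≠ 0 := by
  have h := L.fract_param (B.circle p) (D.time p + D.len p)
  rw [D.param_add_len, L.fract_param] at h
  rw [← h]
  exact D.fract_time _

theorem lift_end (p : Pt α) :
    L.lift (B.circle p) (D.time p + D.len p) = D.point (B.next p) := by
  rw [← L.point_param, D.param_add_len, L.point_param, point]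

theorem edge_end (p : Pt α) :
    L.edge (B.circle p) ⌊D.time p + D.len p⌋ = D.dir (B.next p) := by
  rw [← L.direction_param, D.param_add_len, L.direction_param, dir]

theorem point_eq_iff {p q : Pt α} : D.point p = D.point q ↔ p = q ∨ Pt.opp p = q := by
  constructor
  · intro h
    by_cases hpq : p = q
    · exact Or.inl hpq
    · right
      obtain ⟨r, h1, h2⟩ := D.crossing (L.param (B.circle p) (D.time p))
        (L.param (B.circle q) (D.time q)) (fun h => hpq (D.injective _ _ h))
        (by rw [L.point_param, L.point_param]; exact h)
      rw [D.injective _ _ h1, D.injective _ _ h2]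
  · rintro (rfl | rfl)
    · rfl
    · exact (D.lift_opp p).symm

theorem eq_ends {p : Pt α} {t : ℝ} (h₁ : D.time p ≤ t) (h₂ : t ≤ D.time p + D.len p) {q : Pt α}
    (h : L.param (B.circle p) t = L.param (B.circle q) (D.time q)) :
    t = D.time p ∨ t = D.time p + D.len p := by
  by_contra hne
  push Not at hne
  refine D.param_ne p (t - D.time p) ?_ ?_ q ?_
  · have := h₁.lt_of_ne' hne.1
    linarith
  · have := h₂.lt_of_ne hne.2
    linarith
  · rw [add_sub_cancel, h]

/-- From a common parameter inside the arc of `p`, go back until the nearer of the two starting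
points is reached. It would be a marked point inside the other arc, or both starting points would be
the same. -/
theorem eq_ends_of_param_eq {p q : Pt α} (hpq : p ≠ q) {t t' : ℝ} (h₁ : D.time p ≤ t)
    (h₂ : t ≤ D.time p + D.len p) (h₁' : D.time q ≤ t') (h₂' : t' ≤ D.time q + D.len q)
    (h : L.param (B.circle p) t = L.param (B.circle q) t') :
    t = D.time p ∨ t = D.time p + D.len p := by
  by_contra hne
  push Not at hne
  have h3 := h₁.lt_of_ne' hne.1
  have h4 := h₂.lt_of_ne hne.2
  rcases lt_trichotomy (t - D.time p) (t' - D.time q) with hlt | heq | hgt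
  · refine D.param_ne q (t' - D.time q - (t - D.time p)) (by linarith) (by linarith) p ?_
    have := L.param_add_congr h (-(t - D.time p))
    rw [show t + -(t - D.time p) = D.time p by ring] at this
    rw [this]
    congr 1
    ring
  · refine hpq (D.injective p q ?_)
    have := L.param_add_congr h (-(t - D.time p))
    rw [show t + -(t - D.time p) = D.time p by ring] at this
    rw [this, heq]
    congr 1
    ring
  · refine D.param_ne p (t - D.time p - (t' - D.time q)) (by linarith) (by linarith) q ?_
    have := L.param_add_congr h (-(t' - D.time q))
    rw [show t' + -(t' - D.time q) = D.time q by ring] at this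
    rw [← this]
    congr 1
    ring

/-- Points of two arcs coincide in the plane either as parameters or at a crossing. All crossings
are marked points, hence ends of arcs, and the branches there are transversal. -/
theorem eq_ends_of_lift_eq {p q : Pt α} (hpq : p ≠ q) {t t' : ℝ} (h₁ : D.time p ≤ t)
    (h₂ : t ≤ D.time p + D.len p) (h₁' : D.time q ≤ t') (h₂' : t' ≤ D.time q + D.len q)
    (h : L.lift (B.circle p) t = L.lift (B.circle q) t') :
    (t = D.time p ∨ t = D.time p + D.len p) ∧ (t' = D.time q ∨ t' = D.time q + D.len q) ∧
      (L.param (B.circle p) t = L.param (B.circle q) t' ∨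
        cross (L.edge (B.circle p) ⌊t⌋) (L.edge (B.circle q) ⌊t'⌋) ≠ 0) := by
  by_cases hx : L.param (B.circle p) t = L.param (B.circle q) t'
  · exact ⟨D.eq_ends_of_param_eq hpq h₁ h₂ h₁' h₂' hx,
      D.eq_ends_of_param_eq hpq.symm h₁' h₂' h₁ h₂ hx.symm, Or.inl hx⟩
  · have hp : L.point (L.param (B.circle p) t) = L.point (L.param (B.circle q) t') := by
      rw [L.point_param, L.point_param, h]
    obtain ⟨r, h3, h4⟩ := D.crossing _ _ hx hp
    refine ⟨D.eq_ends h₁ h₂ h3, D.eq_ends h₁' h₂' h4, Or.inr ?_⟩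
    have := (L.transversal _ _ hx hp).2.2
    rwa [PolygonalCurves.det, L.direction_param, L.direction_param] at this

theorem vertices_sub {p : Pt α} {k : ℕ} (hk : k ≤ D.count p) :
    ∃ c : ℝ, 0 < c ∧ D.vertices p (k + 1) - D.vertices p k =
      c • L.edge (B.circle p) (⌊D.time p⌋ + k) := by
  have hlt := D.lt_end p
  have h := breakTime_lt_succ hlt (D.fract_end p) hk
  have h1 := le_breakTime_of_le hlt.le hk
  have h2 := breakTime_succ_le (a := D.time p) (b := D.time p + D.len p) k
  exact ⟨_, sub_pos.2 h, L.lift_sub_lift h1 (h.le.trans h2) (h1.trans h.le) h2⟩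

theorem vertices_zero (p : Pt α) : D.vertices p 0 = D.point p := by
  rw [vertices, breakTime_zero (D.lt_end p).le, point]

theorem vertices_last (p : Pt α) : D.vertices p (D.count p + 1) = D.point (B.next p) := by
  rw [vertices, count, breakTime_last (D.lt_end p).le, lift_end]

theorem vertices_ne {p : Pt α} {k : ℕ} (hk : k ≤ D.count p) :
    D.vertices p k ≠ D.vertices p (k + 1) := by
  obtain ⟨c, hc, h⟩ := D.vertices_sub hk
  rw [ne_comm, ← sub_ne_zero, h]
  exact smul_ne_zero hc.ne' (L.edge_ne_zero _ _)

theorem vertices_first_sub (p : Pt α) :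
    ∃ c : ℝ, 0 < c ∧ D.vertices p 1 - D.vertices p 0 = c • D.dir p := by
  obtain ⟨c, hc, h⟩ := D.vertices_sub (Nat.zero_le (D.count p))
  exact ⟨c, hc, by simpa [dir] using h⟩

theorem vertices_last_sub (p : Pt α) : ∃ c : ℝ, 0 < c ∧
    D.vertices p (D.count p + 1) - D.vertices p (D.count p) = c • D.dir (B.next p) := by
  obtain ⟨c, hc, h⟩ := D.vertices_sub (le_refl (D.count p))
  refine ⟨c, hc, ?_⟩
  rw [h, ← edge_end, count, floor_add_breakCount (D.lt_end p).le]

/-- Pieces of the same edge are collinear. Pieces of different edges share no parameter that is an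
end of an arc, since such an end is inside a unique edge; so they can meet only at a crossing,
transversally. -/
theorem segments {p q : Pt α} (hpq : p ≠ q) {k l : ℕ} (hk : k ≤ D.count p) (hl : l ≤ D.count q) :
    (∃ X v : ℝ × ℝ, ∃ a b c d : ℝ, D.vertices p k = X + a • v ∧ D.vertices p (k + 1) = X + b • v ∧
        D.vertices q l = X + c • v ∧ D.vertices q (l + 1) = X + d • v) ∨
      ∀ X ∈ segment ℝ (D.vertices p k) (D.vertices p (k + 1)),
        X ∈ segment ℝ (D.vertices q l) (D.vertices q (l + 1)) →
        (X = D.vertices p k ∨ X = D.vertices p (k + 1)) ∧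
        (X = D.vertices q l ∨ X = D.vertices q (l + 1)) ∧
          cross (D.vertices p (k + 1) - D.vertices p k)
            (D.vertices q (l + 1) - D.vertices q l) ≠ 0 := by
  obtain ⟨c, hc, hsub⟩ := D.vertices_sub hk
  obtain ⟨c', hc', hsub'⟩ := D.vertices_sub hl
  have hlt := D.lt_end p
  have h := breakTime_lt_succ hlt (D.fract_end p) hk
  have h1 := le_breakTime_of_le hlt.le hk
  have h2 := breakTime_succ_le (a := D.time p) (b := D.time p + D.len p) k
  have h3 := le_breakTime (a := D.time p) (b := D.time p + D.len p) k
  have h4 := breakTime_le hlt.le (k + 1)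
  have hlt' := D.lt_end q
  have h' := breakTime_lt_succ hlt' (D.fract_end q) hl
  have h1' := le_breakTime_of_le hlt'.le hl
  have h2' := breakTime_succ_le (a := D.time q) (b := D.time q + D.len q) l
  have h3' := le_breakTime (a := D.time q) (b := D.time q + D.len q) l
  have h4' := breakTime_le hlt'.le (l + 1)
  set e : ℤ := ⌊D.time p⌋ + k with he
  set e' : ℤ := ⌊D.time q⌋ + l with he'
  by_cases hE : B.circle p = B.circle q ∧ ∃ z : ℤ, e' = e + z * L.period (B.circle p)
  · left
    obtain ⟨hi, z, hz⟩ := hE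
    have hv : L.vertex (B.circle q) e' = L.vertex (B.circle p) e := by
      rw [← hi, hz, L.vertex_add_mul]
    have hed : L.edge (B.circle q) e' = L.edge (B.circle p) e := by
      rw [PolygonalCurves.edge, PolygonalCurves.edge, ← hi, hz, L.vertex_add_mul, add_right_comm,
        L.vertex_add_mul]
    have e1 := L.lift_eq (i := B.circle q) h1' (h'.le.trans h2')
    have e2 := L.lift_eq (i := B.circle q) (h1'.trans h'.le) h2'
    rw [hv, hed] at e1 e2
    exact ⟨L.vertex (B.circle p) e, L.edge (B.circle p) e, _, _, _, _,
      L.lift_eq h1 (h.le.trans h2), L.lift_eq (h1.trans h.le) h2, e1, e2⟩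
  · right
    intro X hX hX'
    obtain ⟨t, ht1, ht2, htX⟩ := L.exists_lift_eq h1 h.le h2 hX
    obtain ⟨t', ht1', ht2', htX'⟩ := L.exists_lift_eq h1' h'.le h2' hX'
    obtain ⟨h5, h6, h7⟩ := D.eq_ends_of_lift_eq hpq (h3.trans ht1) (ht2.trans h4) (h3'.trans ht1')
      (ht2'.trans h4') (htX.trans htX'.symm)
    have hft : Int.fract t ≠ 0 := by
      rcases h5 with rfl | rfl
      · exact D.fract_time p
      · exact D.fract_end p
    have hft' : Int.fract t' ≠ 0 := by
      rcases h6 with rfl | rfl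
      · exact D.fract_time q
      · exact D.fract_end q
    have hfl := floor_eq_of_le_of_le (h1.trans ht1) (ht2.trans h2) hft
    have hfl' := floor_eq_of_le_of_le (h1'.trans ht1') (ht2'.trans h2') hft'
    refine ⟨?_, ?_, ?_⟩
    · rcases h5 with h5 | h5
      · left; rw [← htX, vertices, le_antisymm ht1 (h5.le.trans h3)]
      · right; rw [← htX, vertices, le_antisymm ht2 (h4.trans h5.ge)]
    · rcases h6 with h6 | h6
      · left; rw [← htX', vertices, le_antisymm ht1' (h6.le.trans h3')]
      · right; rw [← htX', vertices, le_antisymm ht2' (h4'.trans h6.ge)]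
    · rw [hsub, hsub', cross_smul_smul]
      refine mul_ne_zero (mul_pos hc hc').ne' ?_
      rcases h7 with h7 | h7
      · rw [L.param_eq_iff] at h7
        obtain ⟨hi, z, hz⟩ := h7
        refine absurd ⟨hi, z, ?_⟩ hE
        rw [← hfl', ← hfl, hz]
        have := Int.floor_add_intCast t (z * L.period (B.circle p))
        push_cast at this
        exact this
      · rwa [hfl, hfl'] at h7

theorem vertices_eq {p q : Pt α} (hpq : p ≠ q) {k l : ℕ} (hk : k ≤ D.count p + 1)
    (hl : l ≤ D.count q + 1) (h : D.vertices p k = D.vertices q l) :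
    (k = 0 ∨ k = D.count p + 1) ∧ (l = 0 ∨ l = D.count q + 1) := by
  have hlt := D.lt_end p
  have hlt' := D.lt_end q
  obtain ⟨h1, h2, -⟩ := D.eq_ends_of_lift_eq hpq (le_breakTime k) (breakTime_le hlt.le k)
    (le_breakTime l) (breakTime_le hlt'.le l) h
  exact ⟨h1.imp (breakTime_eq_left_iff hlt (D.fract_end p) hk)
    (breakTime_eq_right_iff hlt (D.fract_end p) hk),
    h2.imp (breakTime_eq_left_iff hlt' (D.fract_end q) hl)
    (breakTime_eq_right_iff hlt' (D.fract_end q) hl)⟩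

/-- Marked points have the same image not only as the two ends of an arrow but also when they are
equal; in the latter case the turn vanishes. -/
theorem ite_point_eq [DecidableEq α] {p q : Pt α} {x y : ℝ} (h₁ : p = q → x = 0)
    (h₂ : Pt.opp p = q → x = y) :
    (if D.point p = D.point q then x else 0) = if Pt.opp p = q then y else 0 := by
  by_cases h : Pt.opp p = q
  · rw [if_pos (D.point_eq_iff.2 (Or.inr h)), if_pos h, h₂ h]
  · rw [if_neg h]
    by_cases h' : p = q
    · rw [h₁ h', ite_self]
    · rw [if_neg (fun h'' => (D.point_eq_iff.1 h'').elim h' h)]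

theorem turn_dir_self (p : Pt α) : turn (D.dir p) (D.dir p) = 0 :=
  turn_of_cross_eq_zero (by rw [cross]; ring)

theorem turn_neg_dir_self (p : Pt α) : turn (-D.dir p) (D.dir p) = 0 :=
  turn_of_cross_eq_zero (by rw [cross_neg_left, cross]; ring)

/-- The angles of a link diagram. -/
noncomputable def planarAngles [Fintype α] [DecidableEq α] : B.PlanarAngles s where
  angle p q := polylineTurn (D.vertices p) (D.count p + 1) (D.point q)
  angle_opp p q := by rw [D.point_eq_iff.2 (Or.inr (Pt.opp_involutive q))]
  corner p := turn (-D.dir (Pt.opp p)) (D.dir p)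
  cocorner p := turn (D.dir p) (D.dir (Pt.opp p))
  corner_opp p := by
    rw [Pt.opp_involutive, turn_swap, ← turn_neg_neg, neg_neg]
  cocorner_opp p := by rw [Pt.opp_involutive, turn_swap]
  corner_add_cocorner a := by
    rw [turn_neg_add_turn]
    have h := D.sign a
    rw [PolygonalCurves.det, L.direction_param, L.direction_param] at h
    congr 1
    change 0 < _ * cross (D.dir (some (a, false))) (D.dir (some (a, true))) at h
    rw [opp_some, Bool.not_false]
    rcases Int.units_eq_one_or (s a) with hs | hs
    · rw [hs] at h ⊢
      rw [sign_pos (by simpa using h)]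
      simp
    · rw [hs] at h ⊢
      rw [sign_neg (by simpa using h)]
      simp
  intersection p q := by
    -- For a single arc the left side is zero. On the right the corner terms vanish, and the two
    -- cocorner terms, present only for a kink, cancel.
    by_cases hpq : p = q
    · subst hpq
      have h1 : ∀ x : Pt α, Pt.opp x = x → turn (-D.dir (Pt.opp x)) (D.dir x) = 0 := fun x hx => by
        rw [hx, D.turn_neg_dir_self]
      have h2 : (if Pt.opp (B.next p) = p then turn (D.dir (B.next p)) (D.dir (Pt.opp (B.next p)))
          else 0) + (if Pt.opp p = B.next p then turn (D.dir p) (D.dir (Pt.opp p)) else 0) = 0 := by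
        by_cases h : Pt.opp p = B.next p
        · rw [if_pos h, ← h, Pt.opp_involutive, if_pos rfl, turn_swap]
          ring
        · rw [if_neg h, if_neg (fun h' => h ((congrArg Pt.opp h').symm.trans (Pt.opp_involutive _))),
            add_zero]
      have h3 : ∀ x : Pt α, (if Pt.opp x = x then turn (-D.dir (Pt.opp x)) (D.dir x) else 0) = 0 :=
        fun x => by
          split_ifs with hx
          · exact h1 x hx
          · rfl
      rw [h3, h3, add_assoc, h2]
      ring
    have h := polyline_intersection (D.vertices p) (D.vertices q) (D.count p) (D.count q)
      (fun k hk => D.vertices_ne hk) (fun l hl => D.vertices_ne hl)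
      (fun k hk l hl => D.segments hpq hk hl) (fun k hk l hl => D.vertices_eq hpq hk hl)
    obtain ⟨c1, hc1, h1⟩ := D.vertices_first_sub p
    obtain ⟨c2, hc2, h2⟩ := D.vertices_last_sub p
    obtain ⟨c3, hc3, h3⟩ := D.vertices_first_sub q
    obtain ⟨c4, hc4, h4⟩ := D.vertices_last_sub q
    rw [h1, h2, h3, h4] at h
    simp only [← smul_neg, D.vertices_zero, D.vertices_last, turn_smul_smul hc3 hc1,
      turn_smul_smul hc4 hc2, turn_smul_smul hc2 hc3, turn_smul_smul hc1 hc4] at h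
    rw [h]
    congr 1
    · congr 1
      · congr 1
        · exact D.ite_point_eq (fun h => absurd h hpq) (fun h => by rw [h])
        · exact D.ite_point_eq (fun h => absurd (B.next.injective h) hpq) (fun h => by rw [h])
      · exact D.ite_point_eq (fun h => by rw [h, D.turn_dir_self]) (fun h => by rw [h])
    · exact D.ite_point_eq (fun h => by rw [h, D.turn_dir_self]) (fun h => by rw [h])

end Placement

end GaussLink

/-! ### Placing the base point on a polygon -/

namespace GaussLink

open Plane BasedArrowDiagram

namespace PolygonalCurves

variable {m : ℕ} (D : PolygonalCurves m)

theorem timeTo_pos (x y : D.Param) : 0 < D.timeTo x y := by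
  have h1 : 0 ≤ y.time := y.2.1
  have h2 : x.time < D.period x.circle := x.2.2
  unfold timeTo
  split_ifs <;> linarith

theorem param_add_timeTo (x y : D.Param) (h : x.circle = y.circle) :
    D.param x.circle (x.time + D.timeTo x y) = y := by
  rw [← D.param_circle_time y, D.param_eq_iff]
  refine ⟨h, ?_⟩
  rw [D.param_circle_time]
  unfold timeTo
  split_ifs
  · exact ⟨0, by simp⟩
  · exact ⟨-1, by push_cast; ring⟩

theorem timeTo_le {x y : D.Param} {t : ℝ} (ht : 0 < t)
    (h : D.param x.circle (x.time + t) = y) : D.timeTo x y ≤ t := by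
  rw [← D.param_circle_time y, D.param_eq_iff] at h
  obtain ⟨hc, z, hz⟩ := h
  have hn := D.period_pos' x.circle
  have h1 : 0 ≤ x.time := x.2.1
  unfold timeTo
  split_ifs with hlt
  · have h2 : (z : ℝ) < 1 := by
      by_contra hz1
      push Not at hz1
      have h3 : y.time < D.period y.circle := y.2.2
      rw [← hc] at h3
      nlinarith
    have h5 : (z : ℝ) ≤ 0 := by exact_mod_cast Int.lt_add_one_iff.1 (by exact_mod_cast h2)
    nlinarith
  · have h2 : (z : ℝ) < 0 := by
      by_contra hz1
      push Not at hz1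
      nlinarith
    have h5 : (z : ℝ) ≤ -1 := by
      have : z < 0 := by exact_mod_cast h2
      exact_mod_cast Int.le_sub_one_of_lt this
    nlinarith

end PolygonalCurves

variable {m : ℕ} {α : Type*} {G : GaussDiagram m α} {L : LinkDiagram m}

/-- The position of the base point of a basing of the Gauss diagram of `L`, whose ends of arrows
have the positions `pos`. -/
theorem exists_basePosition {pos : α × Bool → L.Param}
    (hcirc : ∀ e, (pos e).circle = G.circle e) (hinj : Function.Injective pos)
    (hempty : ∀ e t, 0 < t → t < L.timeTo (pos e) (pos (G.next e)) →
      ∀ f, L.param (G.circle e) ((pos e).time + t) ≠ pos f)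
    {B : BasedGaussDiagram m α} (hB : B.IsBasingOf G) :
    ∃ (t₀ : ℝ) (len : Pt α → ℝ), Int.fract t₀ ≠ 0 ∧
      (∀ e, L.param (B.circle none) t₀ ≠ pos e) ∧ (∀ p, 0 < len p) ∧
      (∀ p : Pt α, L.param (B.circle p) (p.elim t₀ (fun e => (pos e).time) + len p) =
        (B.next p).elim (L.param (B.circle none) t₀) pos) ∧
      (∀ p t, 0 < t → t < len p → ∀ q : Pt α,
        L.param (B.circle p) (p.elim t₀ (fun e => (pos e).time) + t) ≠
          q.elim (L.param (B.circle none) t₀) pos) := by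
  classical
  have hpar : ∀ e, L.param (G.circle e) (pos e).time = pos e := fun e => by
    rw [← hcirc, L.param_circle_time]
  have hlen : ∀ e, 0 < L.timeTo (pos e) (pos (G.next e)) := fun e => L.timeTo_pos _ _
  have hadd : ∀ e, L.param (G.circle e) ((pos e).time + L.timeTo (pos e) (pos (G.next e))) =
      pos (G.next e) := fun e => by
    rw [← hcirc, L.param_add_timeTo]
    rw [hcirc, hcirc, ← G.sameCycle_iff]
    exact Equiv.Perm.sameCycle_apply_right.2 (Equiv.Perm.SameCycle.refl _ _)
  have hnext : ∀ e, B.next (some e) ≠ none → B.next (some e) = some (G.next e) := by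
    intro e he
    obtain ⟨x, hx⟩ := Option.ne_none_iff_exists'.1 he
    have := Equiv.removeNone_some B.next ⟨x, hx⟩
    rw [hB.2.1] at this
    exact this.symm
  by_cases hn : B.next none = none
  · have hne : ∀ e, B.circle none ≠ G.circle e := by
      intro e he
      rw [← hB.1, ← B.sameCycle_iff] at he
      have := he.eq_of_left hn
      simp at this
    have hnn : ∀ e, B.next (some e) ≠ none := fun e h => by
      have := B.next.injective (h.trans hn.symm)
      simp at this
    have hpos := L.period_pos' (B.circle none)
    -- On a circle without ends of arrows any time that is not an integer will do, and the arc from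
    -- the base point to itself is the full period.
    refine ⟨1 / 2, fun p => p.elim (L.period (B.circle none))
      fun e => L.timeTo (pos e) (pos (G.next e)), ?_, ?_, ?_, ?_, ?_⟩
    · rw [Int.fract_eq_self.2 (by norm_num)]; norm_num
    · intro e h
      rw [← hpar, L.param_eq_iff] at h
      exact hne e h.1
    · rintro (_ | e)
      · exact hpos
      · exact hlen e
    · rintro (_ | e)
      · rw [hn]
        simp only [Option.elim]
        rw [L.param_eq_iff]
        exact ⟨rfl, -1, by push_cast; ring⟩
      · rw [hnext e (hnn e)]
        simp only [Option.elim]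
        rw [hB.1, hadd]
    · rintro (_ | e) t ht htl (_ | f) h
      · simp only [Option.elim] at h htl
        rw [L.param_eq_iff] at h
        obtain ⟨-, z, hz⟩ := h
        have h1 : (z : ℝ) < 0 := by by_contra h; push Not at h; nlinarith
        have h2 : (-1 : ℝ) < z := by by_contra h; push Not at h; nlinarith
        have h3 : z < 0 := by exact_mod_cast h1
        have h4 : -1 < z := by exact_mod_cast h2
        omega
      · simp only [Option.elim] at h
        rw [← hpar, L.param_eq_iff] at h
        exact hne f h.1
      · simp only [Option.elim] at h
        rw [L.param_eq_iff, hB.1] at h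
        exact hne e h.1.symm
      · simp only [Option.elim] at h htl
        rw [hB.1] at h
        exact hempty e t ht htl f h
  · obtain ⟨g, e₀, hg, he₀⟩ := exists_prev_none hn
    have hge : G.next g = e₀ := by
      have := Equiv.removeNone_none B.next hg
      rw [hB.2.1, he₀] at this
      exact Option.some_injective _ this
    have hcg : B.circle none = G.circle g := by
      rw [← hB.1, ← hg, eq_comm, ← B.sameCycle_iff]
      exact Equiv.Perm.sameCycle_apply_right.2 (Equiv.Perm.SameCycle.refl _ _)
    -- An irrational time keeps the base point away from the vertices.
    obtain ⟨t₀, hirr, ht₀, ht₀'⟩ := exists_irrational_btwn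
      (show (pos g).time < (pos g).time + L.timeTo (pos g) (pos (G.next g)) by
        have := hlen g; linarith)
    have hbase : ∀ e, L.param (B.circle none) t₀ ≠ pos e := by
      intro e h
      refine hempty g (t₀ - (pos g).time) (by linarith) (by linarith) e ?_
      rw [add_sub_cancel, ← hcg, h]
    have hshift : ∀ e t, L.param (G.circle e) ((pos e).time + t) = L.param (B.circle none) t₀ →
        ∀ r, L.param (G.circle e) ((pos e).time + (t + r)) =
          L.param (G.circle g) ((pos g).time + (t₀ - (pos g).time + r)) := by
      intro e t h r
      have := L.param_add_congr h r
      rw [hcg] at this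
      rw [← add_assoc, this]
      congr 1
      ring
    refine ⟨t₀, fun p => p.elim (L.timeTo (pos g) (pos (G.next g)) - (t₀ - (pos g).time))
      fun e => if e = g then t₀ - (pos g).time else L.timeTo (pos e) (pos (G.next e)),
      ?_, hbase, ?_, ?_, ?_⟩
    · intro h
      rw [Int.fract_eq_zero_iff] at h
      obtain ⟨z, hz⟩ := h
      exact hirr.ne_int z hz.symm
    · rintro (_ | e)
      · simp only [Option.elim]
        linarith
      · simp only [Option.elim]
        split_ifs
        · linarith
        · exact hlen e
    · rintro (_ | e)
      · rw [he₀]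
        simp only [Option.elim]
        rw [hcg, ← hge]
        refine Eq.trans ?_ (hadd g)
        congr 1
        ring
      · by_cases he : e = g
        · subst he
          rw [hg]
          simp only [Option.elim, if_true]
          rw [hB.1, add_sub_cancel, hcg]
        · rw [hnext e fun h => he (Option.some_injective _ (B.next.injective (h.trans hg.symm)))]
          simp only [Option.elim, if_neg he]
          rw [hB.1, hadd]
    · rintro (_ | e) t ht htl (_ | f) h
      · simp only [Option.elim] at h htl
        refine hempty g t ht (by linarith) g ?_
        have := L.param_add_congr h ((pos g).time - t₀)
        rwa [hcg, add_right_comm, add_sub_cancel, hpar] at this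
      · simp only [Option.elim] at h htl
        refine hempty g (t₀ - (pos g).time + t) (by linarith) (by linarith) f ?_
        rw [← h, hcg]
        congr 1
        ring
      · simp only [Option.elim] at h htl
        rw [hB.1] at h
        -- Going back from the base point by the shorter of the two distances, to `e` or to `g`,
        -- gives an end of an arrow inside the arc of the other one. Equal distances force `e = g`.
        rcases lt_trichotomy t (t₀ - (pos g).time) with hlt | heq | hgt
        · refine hempty g (t₀ - (pos g).time + -t) (by linarith) (by linarith) e ?_
          rw [← hshift e t h, add_neg_cancel, add_zero, hpar]
        · split_ifs at htl with he
          · linarith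
          · have := hshift e t h (-t)
            rw [add_neg_cancel, add_zero, hpar, heq, add_neg_cancel, add_zero, hpar] at this
            exact he (hinj this)
        · split_ifs at htl with he
          · linarith
          · refine hempty e (t + -(t₀ - (pos g).time)) (by linarith) (by linarith) g ?_
            rw [hshift e t h, add_neg_cancel, add_zero, hpar]
      · simp only [Option.elim] at h htl
        rw [hB.1] at h
        refine hempty e t ht ?_ f h
        split_ifs at htl with he
        · subst he; linarith
        · exact htl

theorem GaussDiagram.IsGaussDiagramOf.nonempty_placement (hG : G.IsGaussDiagramOf L)
    {B : BasedGaussDiagram m α} (hB : B.IsBasingOf G) :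
    Nonempty (Placement L B.toBasedArrowDiagram G.sign) := by
  obtain ⟨pos, hcirc, hnear, harrow, htail, huniq, hsign⟩ := hG.exists_position
  have hpar : ∀ e, L.param (G.circle e) (pos e).time = pos e := fun e => by
    rw [← hcirc, L.param_circle_time]
  have hhead : ∀ a, pos (a, true) ∉ L.overpass := fun a =>
    (L.overpass_iff _ _ (harrow a).1 (harrow a).2).1 (htail a)
  -- A tail and a head cannot coincide, because only tails are on overpasses. Two tails, or two
  -- heads, at one place give a triple point unless the opposite ends coincide as well, and then the
  -- arrows are the same.
  have hinj : Function.Injective pos := by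
    rintro ⟨a, b⟩ ⟨a', b'⟩ h
    have hab : ∀ a a', pos (a, false) = pos (a', false) → pos (a, true) = pos (a', true) →
        a = a' := fun a a' h1 h2 =>
      (huniq _ _ (harrow a).1 (harrow a).2 (htail a)).unique ⟨rfl, rfl⟩ ⟨h1.symm, h2.symm⟩
    cases b <;> cases b'
    · by_cases h2 : pos (a, true) = pos (a', true)
      · rw [hab a a' h h2]
      · exact absurd ⟨(harrow a).2.symm, (congrArg L.point h).trans (harrow a').2⟩
          (L.no_triple _ _ _ (harrow a).1.symm (h ▸ (harrow a').1) h2)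
    · exact absurd (htail a) (h ▸ hhead a')
    · exact absurd (htail a') (h ▸ hhead a)
    · by_cases h2 : pos (a, false) = pos (a', false)
      · rw [hab a a' h2 h]
      · exact absurd ⟨(harrow a).2, (congrArg L.point h).trans (harrow a').2.symm⟩
          (L.no_triple _ _ _ (harrow a).1 (h ▸ (harrow a').1.symm) h2)
  have hempty : ∀ e t, 0 < t → t < L.timeTo (pos e) (pos (G.next e)) →
      ∀ f, L.param (G.circle e) ((pos e).time + t) ≠ pos f := by
    intro e t ht htl f h
    have h1 : G.circle f = G.circle e := by
      rw [← hpar f, L.param_eq_iff] at h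
      exact h.1.symm
    have h2 := L.timeTo_le ht ((congrArg (L.param · _) (hcirc e)).trans h)
    have h3 := hnear e f h1
    linarith
  obtain ⟨t₀, len, hfract, hbase, hlen, hadd, hne⟩ := exists_basePosition hcirc hinj hempty hB
  have hat : ∀ p : Pt α, L.param (B.circle p) (p.elim t₀ fun e => (pos e).time) =
      p.elim (L.param (B.circle none) t₀) pos := by
    rintro (_ | e)
    · rfl
    · simp only [Option.elim]
      rw [hB.1, hpar]
  refine ⟨⟨fun p => p.elim t₀ fun e => (pos e).time, len, ?_, hlen, ?_, ?_, ?_, ?_, ?_, ?_⟩⟩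
  · intro p q h
    rw [hat, hat] at h
    rcases p with _ | e <;> rcases q with _ | f
    · rfl
    · exact absurd h (hbase f)
    · exact absurd h.symm (hbase e)
    · rw [hinj h]
  · intro p
    rw [hat, hadd]
  · intro p t ht htl q
    rw [hat]
    exact hne p t ht htl q
  · rintro (_ | ⟨a, _ | _⟩)
    · exact hfract
    · exact (L.transversal _ _ (harrow a).1 (harrow a).2).1
    · exact (L.transversal _ _ (harrow a).1 (harrow a).2).2.1
  · intro x y hxy h
    simp only [hat]
    by_cases hx : x ∈ L.overpass
    · obtain ⟨a, ⟨h1, h2⟩, -⟩ := huniq x y hxy h hx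
      exact ⟨some (a, false), h1.symm, h2.symm⟩
    · have hy : y ∈ L.overpass := (L.overpass_iff y x hxy.symm h.symm).2 hx
      obtain ⟨a, ⟨h1, h2⟩, -⟩ := huniq y x hxy.symm h.symm hy
      exact ⟨some (a, true), h2.symm, h1.symm⟩
  · intro p
    rw [← L.point_param, ← L.point_param, hat, hat]
    rcases p with _ | ⟨a, _ | _⟩
    · rfl
    · exact (harrow a).2.symm
    · exact (harrow a).2
  · intro a
    rw [hat, hat]
    exact hsign a

end GaussLink

/-! ### Classical links and the virtual counterexample -/

namespace GaussLink

open BasedArrowDiagram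

theorem GaussDiagram.IsGaussDiagramOf.nabla_eq {m : ℕ} {α : Type*} [Fintype α]
    {G : GaussDiagram m α} {L : LinkDiagram m} (hG : G.IsGaussDiagramOf L)
    {B B' : BasedGaussDiagram m α} (hB : B.IsBasingOf G) (hB' : B'.IsBasingOf G) :
    B.nablaA = B'.nablaA ∧ B.nablaD = B'.nablaD := by
  classical
  obtain ⟨D⟩ := hG.nonempty_placement hB
  obtain ⟨D'⟩ := hG.nonempty_placement hB'
  exact ⟨nabla_eq_of_planarAngles hB hB' D.planarAngles D'.planarAngles true
      (fun n => B.coeff_nablaA_eq n) (fun n => B'.coeff_nablaA_eq n),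
    nabla_eq_of_planarAngles hB hB' D.planarAngles D'.planarAngles false
      (fun n => B.coeff_nablaD_eq n) (fun n => B'.coeff_nablaD_eq n)⟩

/-! ### A virtual knot -/

namespace VirtualTrefoil

/-- The cyclic order of the ends of the two arrows on the circle. -/
def next : Equiv.Perm (Fin 2 × Bool) where
  toFun e := if e.1 = 0 then (1, !e.2) else (0, e.2)
  invFun e := if e.1 = 1 then (0, !e.2) else (1, e.2)
  left_inv := by unfold Function.LeftInverse; decide
  right_inv := by unfold Function.RightInverse Function.LeftInverse; decide

/-- The Gauss diagram of the virtual trefoil. -/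
def diagram : GaussDiagram 1 (Fin 2) where
  circle _ := 0
  next := next
  sameCycle_iff e e' := by
    have h : ∀ e e', ∃ k : Fin 4, (next ^ (k : ℕ)) e = e' := by decide
    obtain ⟨k, hk⟩ := h e e'
    exact iff_of_true ⟨k, by simpa using hk⟩ rfl
  sign _ := 1

/-- The order of the marked points for a base point before the end `(0, c)`. -/
def basedNext (c : Bool) : Equiv.Perm (Pt (Fin 2)) :=
  (Equiv.optionCongr next).trans (Equiv.swap none (some (0, c)))

/-- The diagram of the virtual trefoil with the base point before the end `(0, c)`. -/
def based (c : Bool) : BasedGaussDiagram 1 (Fin 2) where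
  circle _ := 0
  next := basedNext c
  sameCycle_iff p q := by
    have h : ∀ c p q, ∃ k : Fin 5, (basedNext c ^ (k : ℕ)) p = q := by decide
    obtain ⟨k, hk⟩ := h c p q
    exact iff_of_true ⟨k, by simpa using hk⟩ rfl
  sign _ := 1

theorem isBasingOf (c : Bool) : (based c).IsBasingOf diagram := by
  refine ⟨fun _ => rfl, ?_, rfl⟩
  have h : ∀ c e, Equiv.removeNone (basedNext c) e = next e := by decide
  exact Equiv.ext (h c)

/-- From a base point before `(0, c)`, the passage smoothed at both arrows meets `(0, c)` after one
step and `(1, c)` after two. Thus the type of the full state is the value of `c`. -/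
theorem isMonotoneState (c : Bool) :
    (based c).IsMonotoneState c Finset.univ := by
  refine ⟨fun i => ⟨none, Subsingleton.elim _ _⟩, fun q => ?_, fun a _ => ?_⟩
  · have h : ∀ c q, ∃ k : Fin 5,
        ((based c).toBasedArrowDiagram.smoothTrace Finset.univ ^ (k : ℕ)) none = q := by decide
    obtain ⟨k, hk⟩ := h c q
    exact ⟨k, by simpa using hk⟩
  · have h : ∀ (c : Bool) (a : Fin 2),
        ((based c).toBasedArrowDiagram.smoothTrace Finset.univ ^ ((a : ℕ) + 1)) none =
            some (a, c) ∧
          ∀ j < (a : ℕ) + 1,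
            ((based c).toBasedArrowDiagram.smoothTrace Finset.univ ^ j) none ≠ some (a, !c) := by
      decide
    exact ⟨_, h c a⟩

theorem not_isMonotoneState (c : Bool) :
    ¬ (based c).IsMonotoneState (!c) Finset.univ := by
  intro h
  have h1 := h.2.2 0 (Finset.mem_univ _)
  rw [Bool.not_not] at h1
  exact ((isMonotoneState c).2.2 0 (Finset.mem_univ _)).asymm (end_ne 0 c) h1

-- The full set is the only state with two arrows, so the coefficient of `z ^ 2` tells the two base
-- points apart.
open Classical in
theorem sum_monotoneStates (c c' : Bool) :
    (∑ S : Finset (Fin 2), if S.card = 2 ∧ (based c).IsMonotoneState c' S then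
      ∏ a ∈ S, ((based c).sign a : ℤ) else 0) = if c' = c then 1 else 0 := by
  rw [Finset.sum_eq_single Finset.univ]
  · by_cases h : c' = c
    · subst h
      rw [if_pos ⟨rfl, isMonotoneState c'⟩, if_pos rfl]
      exact Finset.prod_eq_one fun _ _ => rfl
    · have h' : c' = !c := (by decide : ∀ x y : Bool, x ≠ y → x = !y) _ _ h
      rw [if_neg h, if_neg]
      rw [h']
      exact fun hh => not_isMonotoneState c hh.2
  · intro S _ hS
    refine if_neg fun h => hS ?_
    exact (Finset.card_eq_iff_eq_univ S).1 h.1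
  · simp

theorem nablaA_ne : (based true).nablaA ≠ (based false).nablaA := by
  intro h
  have h2 := congrArg (Polynomial.coeff · 2) h
  simp only [BasedGaussDiagram.coeff_nablaA_eq] at h2
  rw [sum_monotoneStates true true, sum_monotoneStates false true] at h2
  simp at h2

theorem nablaD_ne : (based true).nablaD ≠ (based false).nablaD := by
  intro h
  have h2 := congrArg (Polynomial.coeff · 2) h
  simp only [BasedGaussDiagram.coeff_nablaD_eq] at h2
  rw [sum_monotoneStates true false, sum_monotoneStates false false] at h2
  simp at h2

end VirtualTrefoil

end GaussLink

theorem mainTheorem6 :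
    (∀ (m : ℕ) (α : Type) [Fintype α] (G : GaussLink.GaussDiagram m α), G.IsClassical →
      ∀ B B' : GaussLink.BasedGaussDiagram m α, B.IsBasingOf G → B'.IsBasingOf G →
        B.nablaA = B'.nablaA ∧ B.nablaD = B'.nablaD) ∧
    (∃ (G : GaussLink.GaussDiagram 1 (Fin 2)) (B B' : GaussLink.BasedGaussDiagram 1 (Fin 2)),
      B.IsBasingOf G ∧ B'.IsBasingOf G ∧ B.nablaA ≠ B'.nablaA ∧ B.nablaD ≠ B'.nablaD) := by
  refine ⟨fun m α _ G ⟨L, hG⟩ B B' hB hB' => hG.nabla_eq hB hB', ?_⟩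
  exact ⟨GaussLink.VirtualTrefoil.diagram, GaussLink.VirtualTrefoil.based true,
    GaussLink.VirtualTrefoil.based false, GaussLink.VirtualTrefoil.isBasingOf true,
    GaussLink.VirtualTrefoil.isBasingOf false, GaussLink.VirtualTrefoil.nablaA_ne,
    GaussLink.VirtualTrefoil.nablaD_ne⟩
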